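/- Let $p>3$ be a prime, $f\ge 1$, $k=\mathbb F_{p^f}$, $W=W(k)$, $K=W[1/p]$, $e=p^f-1$, $E(u)=u^e+p$, $v=u^e$, $P(v)=v+p$. Fix a root $\pi$ of $E$ in $\overline K$, put $L=K(\pi)$, $\Delta=\mathrm{Gal}(L/K)$ and $\omega_\pi:\Delta\to W^\times$, $g\mapsto g(\pi)/\pi$. Let $\mathcal O$ be the ring of integers of a finite extension of $\mathbb Q_p$ with an embedding $\sigma_0:W\hookrightarrow\mathcal O$, put $\sigma_j=\sigma_0\circ\varphi^{-j}$ ($j\in\mathbb Z/f$), and let $R$ be a complete local Noetherian flat $\mathcal O$-algebra with finite residue field. Let $0\le a_{k,j}\le p-1$ ($k=1,2,3$, $j\in\mathbb Z/f$), $\mathbf a_k^{(j)}=\sum_{i=0}^{f-1}a_{k,-j+i}\,p^i$, and let $\tau=\eta_1\oplus\eta_2\oplus\eta_3$ with $\eta_k=(\sigma_0\circ\omega_\pi)^{-\mathbf a_k^{(0)}}$. Assume that $\tau$ is $n$-generic with $n\ge2$: $n\le|a_{k,j}-a_{l,j}|\le p-1-n$ for all $k\ne l$ and all $j$. Let $(s_j)\in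 S_3^f$ be the orientation of $\tau$: $\mathbf a^{(j)}_{s_j(1)}\ge\mathbf a^{(j)}_{s_j(2)}\ge\mathbf a^{(j)}_{s_j(3)}$. Let $\mathfrak M$ be a Kisin module over $R$, that is, a finitely generated projective $(W\otimes_{\mathbb Z_p}R)[[u]]$-module of rank $3$ with a Frobenius $\phi:\varphi^*\mathfrak M\to\mathfrak M$ whose cokernel is killed by $E(u)^2$, with descent datum of type $\tau$: a semilinear action of $\Delta$ (with $g(u)=\omega_\pi(g)u$) commuting with $\phi$, such that $\mathfrak M^{(j)}/u\cong\tau\otimes_{\mathcal O}R$ for all $j$, where $\mathfrak M=\bigoplus_j\mathfrak M^{(j)}$ and $x\in W$ acts on $\mathfrak M^{(j)}$ by $\sigma_j(x)$. Let $\beta^{(j)}=(f^{(j)}_1,f^{(j)}_2,f^{(j)}_3)$ be an eigenbasis: an $R[[u]]$-basis of $\mathfrak M^{(j)}$ with $\Delta$ acting on $f_k^{(j)}$ by $\eta_k$. Let $C^{(j)}\in\mathrm{Mat}_3(R[[u]])$ be the matrix of $\phi:\varphi^*\mathfrak M^{(j)}\to\mathfrak M^{(j+1)}$ in these bases. Let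 $A^{(j)}\in \mathrm{Mat}_3(R[[v]])$ be the matrix of its restriction to the $\eta_{s_{j+1}(3)}$-isotypic parts, in the bases $(u^{d_k}\otimes f^{(j)}_{s_{j+1}(k)})_k$ and $(u^{d_k}f^{(j+1)}_{s_{j+1}(k)})_k$ with $d_k=\mathbf a^{(j+1)}_{s_{j+1}(k)}-\mathbf a^{(j+1)}_{s_{j+1}(3)}$. For a matrix $D$ let $\mathrm{Ad}^{-1}_{s_j}(D)$ be the matrix with entries $u^{-\mathbf a^{(j)}_{s_j(k)}}D_{s_j(k),s_j(l)}u^{\mathbf a^{(j)}_{s_j(l)}}$ (removing the descent datum). Put $\lambda=\prod_{i\ge0}\varphi^i(E(u)/p)$, $N_\nabla=-u\lambda\frac{d}{du}$ (with $\varphi(u)=u^p$, trivial on coefficients), $N^{(j)}_0=0$ and $$N_i^{(j)}=E(u)C^{(j-1)}\varphi(N_{i-1}^{(j-1)})(C^{(j-1)})^{-1}-N_\nabla(C^{(j-1)})(C^{(j-1)})^{-1}\quad(i\ge1).$$ Then $C^{(j)}$ is invertible over $R[1/p][[u]]$, the matrices $A^{(j)}$ exist, and $N_i^{(j)}$ converges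 coefficientwise over $R[1/p][[u]]$ to a matrix $N^{(j)}_\infty$ such that $N_\infty^{(j)}C^{(j-1)}+N_\nabla(C^{(j-1)})=E(u)C^{(j-1)}\varphi(N_\infty^{(j-1)})$, $N^{(j)}_\infty\equiv0$ mod $u$, and $\lambda N_\infty^{(j)}$ has entries in $\mathcal O^{\mathrm{rig}}_R=\{\sum_m a_mu^m : a_m\in R[1/p],\ p^ma_m^k\to0\ p\text{-adically for all }k>0\}$. There is a matrix $A^{(j-1),\dagger}\in\mathrm{Mat}_3(R[[v]])$ with $A^{(j-1),\dagger}=\mathrm{Ad}_{s_j}^{-1}\big(\tfrac1\lambda N_\nabla(C^{(j-1)})\big)=\mathrm{Ad}_{s_j}^{-1}\big(-u\tfrac{d}{du}C^{(j-1)}\big)$. Moreover $P(v)^2(A^{(j-1)})^{-1}\in\mathrm{Mat}_3(R[[v]])$, and $\mathrm{Ad}^{-1}_{s_j}(\lambda N^{(j)}_\infty)$ is a matrix of power series in $v$ over $R[1/p]$ that converges $p$-adically at $v=-p$. Put $P_N(A^{(j-1)})=A^{(j-1),\dagger}P(v)^2(A^{(j-1)})^{-1}$. There is a unit $z$ of $R[1/p]$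 such that for every $j$ there are $M_{\mathrm{err}}^{(j)},Z^{(j)}\in\mathrm{Mat}_3(R)$ with $$\mathrm{Ad}^{-1}_{s_j}(\lambda N_\infty^{(j)})\big|_{u=\pi}=z\Big(P_N(A^{(j-1)})\big|_{v=-p}-p^{n-1}M_{\mathrm{err}}^{(j)}\Big),$$ $$M_{\mathrm{err}}^{(j)}=\big(A^{(j-1)}|_{v=-p}\big)\,Z^{(j)}\,\big(\big(P(v)^2(A^{(j-1)})^{-1}\big)|_{v=-p}\big),$$ where evaluation at $u=\pi$ of a power series in $v=u^e$ means evaluation at $v=-p$. -/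

import Mathlib

open scoped TensorProduct PowerSeries
open Filter

namespace KisinMonodromy

noncomputable section

/-! ### The base fields -/

/-- `W = W(k)` with `k` the field with `p ^ f` elements. -/
abbrev W (p f : ℕ) [Fact p.Prime] : Type := WittVector p (GaloisField p f)

/-- `K`, the fraction field of `W(k)`: the unramified extension of `ℚ_p` of degree `f`. -/
abbrev K (p f : ℕ) [Fact p.Prime] : Type := FractionRing (W p f)

/-- The structure map `ℤ_p = W(𝔽_p) → W(k)`. -/
def padicToW (p f : ℕ) [Fact p.Prime] : ℤ_[p] →+* W p f :=
  (WittVector.map (algebraMap (ZMod p) (GaloisField p f))).comp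
    (WittVector.equiv p).symm.toRingHom

instance instAlgebraPadicW (p f : ℕ) [Fact p.Prime] : Algebra ℤ_[p] (W p f) :=
  (padicToW p f).toAlgebra

/-- `e = p ^ f - 1`. -/
def ee (p f : ℕ) : ℕ := p ^ f - 1

theorem ee_ne_zero (p f : ℕ) [hp : Fact p.Prime] [NeZero f] : ee p f ≠ 0 := by
  have h := Nat.one_lt_pow (NeZero.ne f) hp.out.one_lt
  unfold ee
  omega

theorem p_ne_zero (p : ℕ) [hp : Fact p.Prime] : p ≠ 0 := hp.out.ne_zero

/-- The roots `π` of `E(u) = u ^ e + p` in an algebraic closure of `K`. -/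
abbrev Unif (p f : ℕ) [Fact p.Prime] : Type :=
  {x : AlgebraicClosure (K p f) // x ^ ee p f = -(p : AlgebraicClosure (K p f))}

/-- `L = K(π)`. -/
abbrev L {p f : ℕ} [Fact p.Prime] (π : Unif p f) :
    IntermediateField (K p f) (AlgebraicClosure (K p f)) :=
  IntermediateField.adjoin (K p f) {(π : AlgebraicClosure (K p f))}

/-- `π` as an element of `L`. -/
def gen {p f : ℕ} [Fact p.Prime] (π : Unif p f) : L π :=
  IntermediateField.AdjoinSimple.gen (K p f) (π : AlgebraicClosure (K p f))

/-- `Δ = Gal(L / K)`. -/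
abbrev Delta {p f : ℕ} [Fact p.Prime] (π : Unif p f) : Type := L π ≃ₐ[K p f] L π

/-- The embedding of `W` in `L`. -/
def WtoL {p f : ℕ} [Fact p.Prime] (π : Unif p f) : W p f →+* L π :=
  (algebraMap (K p f) (L π)).comp (algebraMap (W p f) (K p f))

theorem WtoL_injective {p f : ℕ} [Fact p.Prime] (π : Unif p f) :
    Function.Injective (WtoL π) :=
  (algebraMap (K p f) (L π)).injective.comp (IsFractionRing.injective (W p f) (K p f))

theorem gen_pow {p f : ℕ} [Fact p.Prime] (π : Unif p f) :
    gen π ^ ee p f = -(p : L π) := by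
  apply Subtype.ext
  have h := π.2
  push_cast
  simpa [gen] using h

theorem gen_ne_zero {p f : ℕ} [hp : Fact p.Prime] [NeZero f] (π : Unif p f) : gen π ≠ 0 := by
  intro h
  have h1 := gen_pow π
  rw [h, zero_pow (ee_ne_zero p f)] at h1
  have h2 : WtoL π (p : W p f) = WtoL π 0 := by
    rw [map_natCast, map_zero]
    exact neg_eq_zero.mp h1.symm
  have h3 := WtoL_injective π h2
  exact WittVector.p_nonzero p (GaloisField p f) h3

theorem exists_ratio {p f : ℕ} [hp : Fact p.Prime] [NeZero f] (π : Unif p f) (g : Delta π) :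
    ∃ w : (W p f)ˣ, WtoL π w * gen π = g (gen π) := by
  classical
  have : Fintype (GaloisField p f) := Fintype.ofFinite _
  let T : (GaloisField p f)ˣ → L π :=
    fun a => WtoL π (WittVector.teichmuller p (a : GaloisField p f))
  have hTinj : Function.Injective T := by
    intro a b hab
    have h1 := WtoL_injective π hab
    have h2 := congrArg (fun w => WittVector.coeff w 0) h1
    simp only [WittVector.teichmuller_coeff_zero] at h2
    exact Units.ext h2
  have hcard : Fintype.card (GaloisField p f)ˣ = ee p f := by
    rw [Fintype.card_units, ← Nat.card_eq_fintype_card, GaloisField.card p f (NeZero.ne f)]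
    rfl
  have hTpow : ∀ a, T a ^ ee p f = 1 := by
    intro a
    have h1 : a ^ ee p f = 1 := by rw [← hcard]; exact pow_card_eq_one
    have h2 : (a : GaloisField p f) ^ ee p f = 1 := by
      rw [← Units.val_pow_eq_pow_val, h1, Units.val_one]
    simp only [T]
    rw [← map_pow, ← map_pow, h2, map_one, map_one]
  have hsub : Finset.univ.image T ⊆ Polynomial.nthRootsFinset (ee p f) (1 : L π) := by
    intro x hx
    obtain ⟨a, -, rfl⟩ := Finset.mem_image.mp hx
    exact (Polynomial.mem_nthRootsFinset (Nat.pos_of_ne_zero (ee_ne_zero p f)) _).mpr (hTpow a)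
  have heq : Finset.univ.image T = Polynomial.nthRootsFinset (ee p f) (1 : L π) := by
    apply Finset.eq_of_subset_of_card_le hsub
    rw [Finset.card_image_of_injective _ hTinj, Finset.card_univ, hcard]
    unfold Polynomial.nthRootsFinset
    exact (@Multiset.toFinset_card_le _ (Classical.decEq _) _).trans (Polynomial.card_nthRoots _ _)
  have hz : g (gen π) / gen π ∈ Polynomial.nthRootsFinset (ee p f) (1 : L π) := by
    rw [Polynomial.mem_nthRootsFinset (Nat.pos_of_ne_zero (ee_ne_zero p f)), div_pow, ← map_pow,
      gen_pow, map_neg, map_natCast, ← gen_pow]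
    exact div_self (pow_ne_zero _ (gen_ne_zero π))
  rw [← heq] at hz
  obtain ⟨a, -, ha⟩ := Finset.mem_image.mp hz
  refine ⟨Units.map (WittVector.teichmuller p) a, ?_⟩
  have h1 : T a * gen π = g (gen π) := by
    rw [ha, div_mul_cancel₀ _ (gen_ne_zero π)]
  exact h1

/-- The character `ω_π : Δ → Wˣ`, `g ↦ g(π) / π`. -/
def omegaPi {p f : ℕ} [Fact p.Prime] [NeZero f] (π : Unif p f) : Delta π →* (W p f)ˣ where
  toFun g := (exists_ratio π g).choose
  map_one' := by
    have h := (exists_ratio π 1).choose_spec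
    apply Units.ext
    apply WtoL_injective π
    apply mul_right_cancel₀ (gen_ne_zero π)
    rw [h]
    simp
  map_mul' g h := by
    have hgh := (exists_ratio π (g * h)).choose_spec
    have hg := (exists_ratio π g).choose_spec
    have hh := (exists_ratio π h).choose_spec
    apply Units.ext
    apply WtoL_injective π
    apply mul_right_cancel₀ (gen_ne_zero π)
    have hfix : ∀ w : W p f, g (WtoL π w) = WtoL π w := fun w => g.commutes _
    calc WtoL π ((exists_ratio π (g * h)).choose : W p f) * gen π
        = g (h (gen π)) := hgh
      _ = g (WtoL π ((exists_ratio π h).choose : W p f) * gen π) := by rw [hh]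
      _ = WtoL π ((exists_ratio π h).choose : W p f) *
            (WtoL π ((exists_ratio π g).choose : W p f) * gen π) := by rw [map_mul, hfix, hg]
      _ = _ := by rw [Units.val_mul, map_mul]; ring

/-! ### Embeddings and tame inertial types -/

/-- `σ_j = σ_0 ∘ φ ^ (-j)`, where `φ` is the Frobenius of `W`. -/
def sigma {p f : ℕ} [Fact p.Prime] [NeZero f] {O : Type*} [CommRing O] (σ₀ : W p f →+* O)
    (j : ZMod f) : W p f →+* O :=
  σ₀.comp (((WittVector.frobeniusEquiv p (GaloisField p f)).symm : RingAut (W p f)) ^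
    j.val : RingAut (W p f)).toRingHom

/-- The integer `𝐚_k^{(j)} = ∑_{i=0}^{f-1} a_{k,-j+i} p ^ i`. -/
def digitSum (p : ℕ) {f : ℕ} (a : Fin 3 → ZMod f → ℕ) (j : ZMod f) (k : Fin 3) : ℕ :=
  ∑ i ∈ Finset.range f, a k ((i : ZMod f) - j) * p ^ i

/-- The characters `η_k = ω_f ^ (-𝐚_k^{(0)})` whose sum is the tame type `τ`, where
`ω_f = σ_0 ∘ ω_π`; they factor through the quotient `Δ` of the inertia group. -/
def tameType {p f : ℕ} [Fact p.Prime] [NeZero f] {O : Type*} [CommRing O] (σ₀ : W p f →+* O)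
    (π : Unif p f) (a : Fin 3 → ZMod f → ℕ) (k : Fin 3) : Delta π →* Oˣ :=
  ((Units.map (σ₀ : W p f →* O)).comp (omegaPi π)) ^ (-(digitSum p a 0 k : ℤ))

/-- `n`-genericity. -/
def IsGeneric (p n : ℕ) {f : ℕ} (a : Fin 3 → ZMod f → ℕ) : Prop :=
  ∀ (j : ZMod f) (k l : Fin 3), k ≠ l →
    (n : ℤ) ≤ |(a k j : ℤ) - a l j| ∧ |(a k j : ℤ) - a l j| ≤ (p : ℤ) - 1 - n

/-- Orientations: `𝐚^{(j)}_{s_j(1)} ≥ 𝐚^{(j)}_{s_j(2)} ≥ 𝐚^{(j)}_{s_j(3)}` (indices start at `0` in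
the code). -/
def IsOrientation (p : ℕ) {f : ℕ} (a : Fin 3 → ZMod f → ℕ) (s : ZMod f → Equiv.Perm (Fin 3)) :
    Prop :=
  ∀ j, digitSum p a j (s j 1) ≤ digitSum p a j (s j 0) ∧
    digitSum p a j (s j 2) ≤ digitSum p a j (s j 1)

/-! ### The ring `(W ⊗ R)⟦u⟧` -/

/-- `(W ⊗_{ℤ_p} R)⟦u⟧`. -/
abbrev SR (p f : ℕ) [Fact p.Prime] (R : Type*) [CommRing R] [Algebra ℤ_[p] R] : Type _ :=
  (W p f ⊗[ℤ_[p]] R)⟦X⟧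

/-- The Frobenius of `W` as a `ℤ_p`-algebra map. -/
def frobW (p f : ℕ) [Fact p.Prime] : W p f →ₐ[ℤ_[p]] W p f :=
  { (WittVector.frobenius : W p f →+* W p f) with
    commutes' := by
      intro x
      change WittVector.frobenius (WittVector.map (algebraMap (ZMod p) (GaloisField p f))
        ((WittVector.equiv p).symm x)) = WittVector.map (algebraMap (ZMod p) (GaloisField p f))
        ((WittVector.equiv p).symm x)
      ext n
      rw [WittVector.coeff_frobenius_charP, WittVector.map_coeff, ← map_pow, ZMod.pow_card] }

/-- The Frobenius `φ` of `(W ⊗ R)⟦u⟧`: trivial on `R`, the Frobenius on `W`, and `u ↦ u ^ p`. -/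
def frobS (p f : ℕ) [Fact p.Prime] (R : Type*) [CommRing R] [Algebra ℤ_[p] R] :
    SR p f R →+* SR p f R :=
  (PowerSeries.expand (R := W p f ⊗[ℤ_[p]] R) p (p_ne_zero p)).toRingHom.comp
    (PowerSeries.map (Algebra.TensorProduct.map (frobW p f) (AlgHom.id ℤ_[p] R)).toRingHom)

/-- The automorphism `ĝ` of `(W ⊗ R)⟦u⟧`: linear over `W ⊗ R`, and `u ↦ (ω_π(g) ⊗ 1) u`. -/
def gHat {p f : ℕ} [Fact p.Prime] [NeZero f] (R : Type*) [CommRing R] [Algebra ℤ_[p] R]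
    (π : Unif p f) (g : Delta π) : SR p f R →+* SR p f R :=
  PowerSeries.rescale ((omegaPi π g : W p f) ⊗ₜ[ℤ_[p]] (1 : R))

/-- The constant `x ⊗ 1`. -/
def ofW (p f : ℕ) [Fact p.Prime] (R : Type*) [CommRing R] [Algebra ℤ_[p] R] (x : W p f) :
    SR p f R :=
  PowerSeries.C (x ⊗ₜ[ℤ_[p]] (1 : R))

/-- The inclusion `R⟦u⟧ → (W ⊗ R)⟦u⟧`. -/
def incl (p f : ℕ) [Fact p.Prime] (R : Type*) [CommRing R] [Algebra ℤ_[p] R] :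
    R⟦X⟧ →+* SR p f R :=
  PowerSeries.map (Algebra.TensorProduct.includeRight : R →ₐ[ℤ_[p]] W p f ⊗[ℤ_[p]] R).toRingHom

/-- The constant `1 ⊗ r`. -/
def ofR (p f : ℕ) [Fact p.Prime] {R : Type*} [CommRing R] [Algebra ℤ_[p] R] (r : R) :
    SR p f R :=
  incl p f R (PowerSeries.C r)

/-- `E(u) = u ^ e + p`. -/
def Eis (p f : ℕ) (T : Type*) [CommRing T] : T⟦X⟧ := PowerSeries.X ^ ee p f + (p : T⟦X⟧)

/-- `R[1/p]`. -/
abbrev Rp (p : ℕ) (R : Type*) [CommRing R] : Type _ := Localization.Away (p : R)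

/-- `1/p`. -/
def pInv (p : ℕ) (R : Type*) [CommRing R] : Rp p R := IsLocalization.Away.invSelf (p : R)

/-- `R⟦u⟧ → R[1/p]⟦u⟧`. -/
def toRp (p : ℕ) (R : Type*) [CommRing R] : R⟦X⟧ →+* (Rp p R)⟦X⟧ :=
  PowerSeries.map (algebraMap R (Rp p R))

/-! ### Kisin modules with descent datum -/

/-- The submodule `M^{(j)}` on which `x ⊗ 1` acts as `1 ⊗ σ_j(x)` for all `x ∈ W`. -/
def component {p f : ℕ} [Fact p.Prime] [NeZero f] {O : Type*} [CommRing O] (σ₀ : W p f →+* O)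
    (R : Type*) [CommRing R] [Algebra ℤ_[p] R] [Algebra O R]
    (M : Type*) [AddCommGroup M] [Module (SR p f R) M] (j : ZMod f) :
    Submodule (SR p f R) M where
  carrier := {m | ∀ x : W p f, ofW p f R x • m = ofR p f (algebraMap O R (sigma σ₀ j x)) • m}
  add_mem' := by
    intro m m' hm hm' x
    rw [smul_add, smul_add, hm x, hm' x]
  zero_mem' := by
    intro x
    rw [smul_zero, smul_zero]
  smul_mem' := by
    intro c m hm x
    rw [smul_comm, hm x, smul_comm]

/-- A Kisin module over `R` of rank `3`, with height in `[0, h]` and descent datum of type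
`τ = η_1 ⊕ η_2 ⊕ η_3`. The linear map `φ^*(M) → M` is given as a `φ`-semilinear map
`frob : M → M`; the image of the former is the span of the image of the latter. -/
structure KisinModule {p f : ℕ} [Fact p.Prime] [NeZero f] {O : Type*} [CommRing O]
    (σ₀ : W p f →+* O) (π : Unif p f) (η : Fin 3 → Delta π →* Oˣ) (h : ℕ)
    (R : Type*) [CommRing R] [Algebra ℤ_[p] R] [Algebra O R]
    (M : Type*) [AddCommGroup M] [Module (SR p f R) M] where
  finite : Module.Finite (SR p f R) M
  projective : Module.Projective (SR p f R) M
  rank : ∀ P : PrimeSpectrum (SR p f R), Module.rankAtStalk M P = 3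
  frob : M →ₛₗ[frobS p f R] M
  height : ∀ m : M, Eis p f (W p f ⊗[ℤ_[p]] R) ^ h • m ∈
    Submodule.span (SR p f R) (Set.range frob)
  /-- the action of `Δ` by additive bijections -/
  dd : Delta π → M ≃+ M
  dd_mul : ∀ (g g' : Delta π) (m : M), dd (g * g') m = dd g (dd g' m)
  dd_smul : ∀ (g : Delta π) (c : SR p f R) (m : M), dd g (c • m) = gHat R π g c • dd g m
  dd_frob : ∀ (g : Delta π) (m : M), dd g (frob m) = frob (dd g m)
  /-- `M^{(j)} / u M^{(j)}` has an `R`-basis on which `Δ` acts through `η_1, η_2, η_3` -/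
  type_eq : ∀ j : ZMod f, ∃ b : Fin 3 → M,
    (∀ k, b k ∈ component σ₀ R M j) ∧
    (∀ m ∈ component σ₀ R M j, ∃! c : Fin 3 → R, ∃ m' ∈ component σ₀ R M j,
      m = ∑ k, ofR p f (c k) • b k + (PowerSeries.X : SR p f R) • m') ∧
    ∀ (g : Delta π) (k : Fin 3), ∃ m' ∈ component σ₀ R M j,
      dd g (b k) = ofR p f (algebraMap O R (η k g)) • b k + (PowerSeries.X : SR p f R) • m'

theorem symm_pow_iterate {p f : ℕ} [Fact p.Prime] (m : ℕ) (x : W p f) :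
    (((WittVector.frobeniusEquiv p (GaloisField p f)).symm : RingAut (W p f)) ^ m :
      RingAut (W p f)) ((WittVector.frobenius (p := p))^[m] x) = x := by
  induction m with
  | zero => rfl
  | succ m ih =>
    rw [Function.iterate_succ_apply', pow_succ, RingAut.mul_apply]
    have h1 : (WittVector.frobeniusEquiv p (GaloisField p f)).symm
        (WittVector.frobenius ((WittVector.frobenius (p := p))^[m] x)) =
        (WittVector.frobenius (p := p))^[m] x :=
      (WittVector.frobeniusEquiv p (GaloisField p f)).symm_apply_apply _
    rw [h1, ih]

theorem frobenius_surjective {p f : ℕ} [Fact p.Prime] (x : W p f) : ∃ y : W p f, WittVector.frobenius y = x :=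
  (WittVector.frobenius_bijective p (GaloisField p f)).2 x

section Modules

variable {p f : ℕ} [Fact p.Prime] [NeZero f] {O : Type*} [CommRing O]
  {σ₀ : W p f →+* O} {π : Unif p f} {η : Fin 3 → Delta π →* Oˣ} {h : ℕ}
  {R : Type*} [CommRing R] [Algebra ℤ_[p] R] [Algebra O R]
  {M : Type*} [AddCommGroup M] [Module (SR p f R) M]

/-- An eigenbasis: for each `j`, an `R⟦u⟧`-basis of `M^{(j)}` whose `k`-th member is an
eigenvector of `Δ` with character `η_k`. -/
structure Eigenbasis (𝔐 : KisinModule σ₀ π η h R M) where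
  vec : ZMod f → Fin 3 → M
  mem : ∀ j k, vec j k ∈ component σ₀ R M j
  isBasis : ∀ j, ∀ m ∈ component σ₀ R M j, ∃! c : Fin 3 → R⟦X⟧,
    m = ∑ k, incl p f R (c k) • vec j k
  eigen : ∀ j k (g : Delta π),
    𝔐.dd g (vec j k) = ofR p f (algebraMap O R (η k g)) • vec j k

theorem frobenius_iterate (x : W p f) : (WittVector.frobenius (p := p))^[f] x = x := by
  have hcoeff : ∀ (m : ℕ) (y : W p f) (i : ℕ),
      ((WittVector.frobenius (p := p))^[m] y).coeff i = y.coeff i ^ p ^ m := by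
    intro m
    induction m with
    | zero => intro y i; simp
    | succ m ih =>
      intro y i
      rw [Function.iterate_succ_apply, ih, WittVector.coeff_frobenius_charP, ← pow_mul,
        ← pow_succ']
  ext i
  rw [hcoeff]
  have : Fintype (GaloisField p f) := Fintype.ofFinite _
  have hc : Fintype.card (GaloisField p f) = p ^ f := by
    rw [← Nat.card_eq_fintype_card, GaloisField.card p f (NeZero.ne f)]
  rw [← hc, FiniteField.pow_card]

theorem sigma_iterate (j : ZMod f) (x : W p f) :
    sigma σ₀ j ((WittVector.frobenius (p := p))^[j.val] x) = σ₀ x :=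
  congrArg σ₀ (symm_pow_iterate j.val x)

theorem sigma_succ (j : ZMod f) (y : W p f) :
    sigma σ₀ (j + 1) (WittVector.frobenius y) = sigma σ₀ j y := by
  obtain ⟨x, rfl⟩ : ∃ x : W p f, (WittVector.frobenius (p := p))^[j.val] x = y :=
    (WittVector.frobenius_bijective p (GaloisField p f)).2.iterate j.val y
  rw [sigma_iterate, ← Function.iterate_succ_apply' (f := WittVector.frobenius (p := p))]
  have hlt : j.val < f := ZMod.val_lt j
  have hv : (j + 1).val = (j.val + 1) % f := by
    rw [ZMod.val_add, ZMod.val_one_eq_one_mod, Nat.add_mod_mod]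
  rcases Nat.lt_or_ge (j.val + 1) f with h1 | h1
  · rw [Nat.mod_eq_of_lt h1] at hv
    have h2 := sigma_iterate (σ₀ := σ₀) (j + 1) x
    rw [hv] at h2
    exact h2
  · have h2 : j.val + 1 = f := by omega
    have h3 : (j + 1).val = 0 := by rw [hv, h2, Nat.mod_self]
    have h4 := sigma_iterate (σ₀ := σ₀) (j + 1) x
    rw [h3] at h4
    rw [Nat.succ_eq_add_one, h2, frobenius_iterate]
    exact h4

/-- `φ` maps `M^{(j)}` to `M^{(j+1)}`. -/
theorem frob_mem (𝔐 : KisinModule σ₀ π η h R M) (j : ZMod f) {m : M}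
    (hm : m ∈ component σ₀ R M j) : 𝔐.frob m ∈ component σ₀ R M (j + 1) := by
  intro x
  obtain ⟨y, rfl⟩ := frobenius_surjective x
  have hw : frobS p f R (ofW p f R y) = ofW p f R (WittVector.frobenius y) := by
    simp [frobS, ofW, PowerSeries.expand_C, frobW]
  have hr : ∀ r : R, frobS p f R (ofR p f r) = ofR p f r := by
    intro r
    simp [frobS, ofR, incl, PowerSeries.expand_C]
  rw [sigma_succ, ← hw, ← hr, ← 𝔐.frob.map_smulₛₗ, ← 𝔐.frob.map_smulₛₗ, hm y]

/-- The matrix `C^{(j)}` of `φ_M^{(j)}`: `φ_M(β^{(j)}) = β^{(j+1)} C^{(j)}`. -/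
def frobMatrix {𝔐 : KisinModule σ₀ π η h R M} (β : Eigenbasis 𝔐) (j : ZMod f) :
    Matrix (Fin 3) (Fin 3) R⟦X⟧ :=
  Matrix.of fun k l =>
    (β.isBasis (j + 1) (𝔐.frob (β.vec j l)) (frob_mem 𝔐 j (β.mem j l))).choose k

/-- The matrices `C^{(j)}` over `R[1/p]⟦u⟧`. -/
def frobMatrixRp {𝔐 : KisinModule σ₀ π η h R M} (β : Eigenbasis 𝔐) (j : ZMod f) :
    Matrix (Fin 3) (Fin 3) (Rp p R)⟦X⟧ :=
  (frobMatrix β j).map (toRp p R)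

/-- `A^{(j)}` is the matrix of `φ^{(j)}_{M, s_{j+1}(3)}`: with
`d_k = 𝐚^{(j+1)}_{s_{j+1}(k)} - 𝐚^{(j+1)}_{s_{j+1}(3)}`, it maps the basis
`(u ^ d_k ⊗ f^{(j)}_{s_{j+1}(k)})_k` of the `η_{s_{j+1}(3)}`-part of `φ^*(M^{(j)})` to the basis
`(u ^ d_k f^{(j+1)}_{s_{j+1}(k)})_k` of the `η_{s_{j+1}(3)}`-part of `M^{(j+1)}` multiplied by
`A^{(j)}`, whose entries are power series in `v = u ^ e`. -/
def IsIsotypicMatrix {𝔐 : KisinModule σ₀ π η h R M} (β : Eigenbasis 𝔐)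
    (a : Fin 3 → ZMod f → ℕ) (s : ZMod f → Equiv.Perm (Fin 3))
    (A : ZMod f → Matrix (Fin 3) (Fin 3) R⟦X⟧) : Prop :=
  ∀ (j : ZMod f) (l : Fin 3),
    let d : Fin 3 → ℕ := fun k =>
      digitSum p a (j + 1) (s (j + 1) k) - digitSum p a (j + 1) (s (j + 1) 2)
    (PowerSeries.X : SR p f R) ^ d l • 𝔐.frob (β.vec j (s (j + 1) l)) =
      ∑ k, incl p f R (PowerSeries.expand (ee p f) (ee_ne_zero p f) (A j k l)) •
        ((PowerSeries.X : SR p f R) ^ d k • β.vec (j + 1) (s (j + 1) k))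

end Modules

/-- `D = Ad_{s}(u^{𝐚_1}, u^{𝐚_2}, u^{𝐚_3})(B(u ^ e))`, that is, `Ad_s⁻¹(D) = B` as a matrix in
`v = u ^ e`, where `b_k` is the exponent `𝐚_k^{(j)}` and `s = s_j`. Entrywise this is
`D_{s(k),s(l)} = u ^ (b_{s(k)} - b_{s(l)}) B_{k,l}(u ^ e)`; it is multiplied out to avoid negative
powers of `u`, and it determines `B`. -/
def RemovesDescent {T : Type*} [CommRing T] (p : ℕ) {f : ℕ} [Fact p.Prime] [NeZero f]
    (b : Fin 3 → ℕ) (s : Equiv.Perm (Fin 3)) (D B : Matrix (Fin 3) (Fin 3) T⟦X⟧) : Prop :=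
  ∀ k l, D (s k) (s l) * PowerSeries.X ^ b (s l) =
    PowerSeries.X ^ b (s k) * PowerSeries.expand (ee p f) (ee_ne_zero p f) (B k l)

/-! ### Power series over `R[1/p]` -/

/-- The Frobenius on power series with coefficients in `R[1/p]`: `u ↦ u ^ p`, trivial on
coefficients. -/
def frobRp (p : ℕ) [Fact p.Prime] (R : Type*) [CommRing R] : (Rp p R)⟦X⟧ →+* (Rp p R)⟦X⟧ :=
  (PowerSeries.expand (R := Rp p R) p (p_ne_zero p)).toRingHom

/-- `λ = ∏_{i ≥ 0} φ^i(E(u)/p)`. Since `φ^i(E(u)/p) = 1 + u^{e p^i}/p` and `m < e p^i` for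
`m < i`, the coefficient of `u^m` in the product is the one in the product over `i ≤ m`. -/
def lam (p f : ℕ) [Fact p.Prime] (R : Type*) [CommRing R] : (Rp p R)⟦X⟧ :=
  PowerSeries.mk fun m => PowerSeries.coeff m
    (∏ i ∈ Finset.range (m + 1),
      (frobRp p R)^[i] (PowerSeries.C (pInv p R) * Eis p f (Rp p R)))

/-- `N_∇ = -u λ d/du`. -/
def nabla (p f : ℕ) [Fact p.Prime] (R : Type*) [CommRing R] (F : (Rp p R)⟦X⟧) : (Rp p R)⟦X⟧ :=
  -(PowerSeries.X * lam p f R * PowerSeries.derivative (Rp p R) F)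

/-- The sequence `N_0^{(j)} = 0`,
`N_i^{(j)} = E(u) C^{(j-1)} φ(N_{i-1}^{(j-1)}) (C^{(j-1)})⁻¹ - N_∇(C^{(j-1)}) (C^{(j-1)})⁻¹`. -/
def approx (p f : ℕ) [Fact p.Prime] (R : Type*) [CommRing R]
    (C : ZMod f → Matrix (Fin 3) (Fin 3) (Rp p R)⟦X⟧) :
    ℕ → ZMod f → Matrix (Fin 3) (Fin 3) (Rp p R)⟦X⟧
  | 0, _ => 0
  | i + 1, j =>
    Eis p f (Rp p R) • (C (j - 1) * (approx p f R C i (j - 1)).map (frobRp p R) * (C (j - 1))⁻¹)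
      - (C (j - 1)).map (nabla p f R) * (C (j - 1))⁻¹

/-- `N_∞^{(j)} = lim_i N_i^{(j)}` for all `j`: every coefficient of every entry of `N_i^{(j)}` is
eventually equal to that of `N_∞^{(j)}`. -/
def IsMonodromyMatrix (p f : ℕ) [Fact p.Prime] (R : Type*) [CommRing R]
    (C N : ZMod f → Matrix (Fin 3) (Fin 3) (Rp p R)⟦X⟧) : Prop :=
  ∀ (j : ZMod f) (k l : Fin 3) (m : ℕ), ∀ᶠ i in atTop,
    PowerSeries.coeff m (approx p f R C i j k l) = PowerSeries.coeff m (N j k l)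

/-- The commutation with Frobenius,
`N^{(j)} C^{(j-1)} + N_∇(C^{(j-1)}) = E(u) C^{(j-1)} φ(N^{(j-1)})`, and `N^{(j)} ≡ 0 mod u`. -/
def SatisfiesCommutation (p f : ℕ) [Fact p.Prime] (R : Type*) [CommRing R]
    (C N : ZMod f → Matrix (Fin 3) (Fin 3) (Rp p R)⟦X⟧) : Prop :=
  (∀ j, N j * C (j - 1) + (C (j - 1)).map (nabla p f R) =
    Eis p f (Rp p R) • (C (j - 1) * (N (j - 1)).map (frobRp p R))) ∧
  ∀ j k l, PowerSeries.constantCoeff (N j k l) = 0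

/-- `F = ∑ a_m u^m` lies in `𝒪^rig_R`: for every `k > 0`, `p^m a_m^k → 0` in the `p`-adic topology
of `R[1/p]`. -/
def IsRigid (p : ℕ) (R : Type*) [CommRing R] (F : (Rp p R)⟦X⟧) : Prop :=
  ∀ k : ℕ, 0 < k → ∀ c : ℕ, ∀ᶠ m in atTop, ∃ r : R,
    (p : Rp p R) ^ m * PowerSeries.coeff m F ^ k = algebraMap R (Rp p R) ((p : R) ^ c * r)

/-- The series `F(v)` with coefficients in the `R`-algebra `T` converges at `v = -p`, with value
`x`, for the topology of `T` in which the images of the `p^c R` are neighbourhoods of `0`. -/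
def EvalsTo (p : ℕ) (R : Type*) [CommRing R] {T : Type*} [CommRing T] [Algebra R T]
    (F : T⟦X⟧) (x : T) : Prop :=
  ∀ c : ℕ, ∀ᶠ m in atTop, ∃ r : R,
    x - ∑ i ∈ Finset.range m, PowerSeries.coeff i F * (-(p : T)) ^ i =
      algebraMap R T ((p : R) ^ c * r)

/-- Entrywise evaluation of a matrix at `v = -p`. -/
def MatEvalsTo (p : ℕ) (R : Type*) [CommRing R] {T : Type*} [CommRing T] [Algebra R T]
    (F : Matrix (Fin 3) (Fin 3) T⟦X⟧) (x : Matrix (Fin 3) (Fin 3) T) : Prop :=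
  ∀ k l, EvalsTo p R (F k l) (x k l)

end

end KisinMonodromy

open KisinMonodromy

namespace KisinMonodromy

noncomputable section

/-! ### Adic completeness -/

section Completeness

variable {R : Type*} [CommRing R] [IsLocalRing R] [IsNoetherianRing R]
  [IsAdicComplete (IsLocalRing.maximalIdeal R) R]

/-! The limit `N` of the iteration is a fixed point, `N = E C φ(N) C⁻¹ - λ (-u dC/du) C⁻¹`, where
indices `j` are suppressed. Height at most 2 makes `D = E² C⁻¹` integral, and the product formula
gives `p λ = E φ(λ)`. Multiplying the fixed point equation by `p² λ` therefore removes every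
denominator on the right: `p² (λN) = p C φ(λN) D - φ(λ)² (-u dC/du) D` (`lam_smul_eq`). Rigidity of
`λN` follows from this identity alone: `φ` divides indices by `p`, so each passage through `φ` uses
up one base-`p` digit of the index, and the denominators grow only logarithmically.

The descent datum forces every matrix involved to be a conjugate, by a diagonal matrix of powers of
`u`, of a matrix in `v = u ^ e`. For `C` this comes from commutation with `Δ`; for `N` it passes
through the iteration. If `A`, `B`, `A†`, `G` correspond to `C`, `D`, `-u dC/du`, `λN`, the identity
becomes `p² G = p A Y B - φ(λ)² A† B`, with `Y_{kl} = v^{α_k - α_l} φ(G_{kl})`, where the `α_k` are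
the digits in the relation `p 𝐚^{(j-1)} = 𝐚^{(j)} + e α`.

By induction the coefficient of `v^r` in `G` has denominator at most `p^{r+2}`. A nonzero
coefficient of `v^t` in `Y` equals one of `v^r` in `G` with `t = p r + α_k - α_l`, and genericity
gives `r + n ≤ t` (`coeff_frob_twist`). Hence `Y(-p)` is divisible by `p^{n-2}`. The value `w` of
`φ(λ)` at `v = -p` is a unit of `R`, because `w ≡ 1 mod p`. Evaluating the identity yields the
theorem with `z = -w²/p²`, which does not depend on `j`, and with error `p · p^{n-2} = p^{n-1}`
times `A Z B` (`exists_value`). -/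

theorem isAdicComplete_span_singleton {x : R} (hx : x ∈ IsLocalRing.maximalIdeal R) :
    IsAdicComplete (Ideal.span {x}) R := by
  have hne : Ideal.span {x} ≠ ⊤ := by
    intro h
    apply (IsLocalRing.maximalIdeal.isMaximal R).ne_top
    rw [eq_top_iff, ← h, Ideal.span_singleton_le_iff_mem]
    exact hx
  have hle : Ideal.span {x} ≤ IsLocalRing.maximalIdeal R := by
    rwa [Ideal.span_singleton_le_iff_mem]
  have : IsHausdorff (Ideal.span {x}) R := IsHausdorff.of_isLocalRing _ _ hne
  have : IsPrecomplete (Ideal.span {x}) R := by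
    constructor
    intro g hg
    obtain ⟨l, hl⟩ := IsPrecomplete.prec
      (inferInstance : IsPrecomplete (IsLocalRing.maximalIdeal R) R) (f := g) (by
        intro m n hmn
        exact (hg hmn).mono (Submodule.smul_mono_left (Ideal.pow_right_mono hle m)))
    refine ⟨l, fun n => ?_⟩
    set J : Ideal R := Ideal.span {x} ^ n
    -- The limit `l` is only known for the maximal ideal. It is also an `x`-adic limit because the
    -- ideal `J = (x^n)` is closed: `R ⧸ J` is separated by Krull's theorem, and modulo `J` the term
    -- `g n` may be replaced by any later one.
    have h0 : (Ideal.Quotient.mk J) (g n - l) = 0 := by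
      apply IsHausdorff.haus
        (inferInstance : IsHausdorff (IsLocalRing.maximalIdeal R) (R ⧸ J))
      intro N
      rw [SModEq.zero]
      have h1 : (Ideal.Quotient.mk J) (g n - l) =
          (Ideal.Quotient.mk J) (g (max n N) - l) := by
        rw [Ideal.Quotient.eq]
        have h2 := hg (le_max_left n N)
        rw [SModEq.sub_mem, smul_eq_mul, Ideal.mul_top] at h2
        convert h2 using 1
        ring
      rw [h1]
      have h3 := (hl (max n N)).mono (Submodule.smul_mono_left
        (Ideal.pow_le_pow_right (le_max_right n N)))
      rw [SModEq.sub_mem, smul_eq_mul, Ideal.mul_top] at h3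
      have h4 : (Ideal.Quotient.mk J) (g (max n N) - l) =
          (g (max n N) - l) • (1 : R ⧸ J) := by
        rw [Algebra.smul_def, mul_one]; rfl
      rw [h4]
      exact Submodule.smul_mem_smul h3 Submodule.mem_top
    rw [Ideal.Quotient.eq_zero_iff_mem] at h0
    rw [SModEq.sub_mem, smul_eq_mul, Ideal.mul_top]
    exact h0
  exact {}

end Completeness

/-- The rate `i / 2` is weak enough to cover both geometric series in `p` and series whose terms
only decay like `p^{i - i/p}`. The explicit remainder estimate allows denominators to be cleared
before summing. -/
theorem exists_sum_of_dvd {S : Type*} [CommRing S] {q : S} [IsAdicComplete (Ideal.span {q}) S]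
    (y : ℕ → S) (hy : ∀ i, q ^ (i / 2) ∣ y i) :
    ∃ s, ∀ c M, 2 * c ≤ M → q ^ c ∣ s - ∑ i ∈ Finset.range M, y i := by
  have htail : ∀ c M N, 2 * c ≤ M → M ≤ N →
      q ^ c ∣ ∑ i ∈ Finset.range N, y i - ∑ i ∈ Finset.range M, y i := by
    intro c M N h1 h2
    rw [← Finset.sum_Ico_eq_sub _ h2]
    refine Finset.dvd_sum fun i hi => (pow_dvd_pow q ?_).trans (hy i)
    rw [Finset.mem_Ico] at hi
    omega
  obtain ⟨s, hs⟩ := IsPrecomplete.prec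
    (inferInstance : IsPrecomplete (Ideal.span {q}) S)
    (f := fun c => ∑ i ∈ Finset.range (2 * c), y i) (by
      intro m n hmn
      rw [SModEq.sub_mem, smul_eq_mul, Ideal.mul_top, Ideal.span_singleton_pow,
        Ideal.mem_span_singleton, ← dvd_neg, neg_sub]
      exact htail _ _ _ le_rfl (by omega))
  refine ⟨s, fun c M h => ?_⟩
  have h1 := hs c
  rw [SModEq.sub_mem, smul_eq_mul, Ideal.mul_top, Ideal.span_singleton_pow,
    Ideal.mem_span_singleton, ← dvd_neg, neg_sub] at h1
  have h2 := dvd_sub h1 (htail c _ M le_rfl h)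
  convert h2 using 1
  ring

/-! ### Evaluation at `v = -p` -/

section Evaluation

variable (p : ℕ) (R : Type*) [CommRing R]

/-- The image of `p ^ c R` in `R[1/p]`. -/
def lattice (c : ℕ) : AddSubgroup (Rp p R) where
  carrier := {x | ∃ r : R, x = algebraMap R (Rp p R) ((p : R) ^ c * r)}
  add_mem' := by
    rintro _ _ ⟨r, rfl⟩ ⟨r', rfl⟩
    exact ⟨r + r', by rw [← map_add, mul_add]⟩
  zero_mem' := ⟨0, by simp⟩
  neg_mem' := by
    rintro _ ⟨r, rfl⟩
    exact ⟨-r, by rw [← map_neg, mul_neg]⟩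

variable {p R}

theorem mul_mem_lattice {c d : ℕ} {x y : Rp p R} (hx : x ∈ lattice p R c)
    (hy : y ∈ lattice p R d) : x * y ∈ lattice p R (c + d) := by
  obtain ⟨r, rfl⟩ := hx
  obtain ⟨r', rfl⟩ := hy
  exact ⟨r * r', by rw [← map_mul]; congr 1; ring⟩

theorem lattice_anti {c d : ℕ} (h : c ≤ d) : lattice p R d ≤ lattice p R c := by
  rintro _ ⟨r, rfl⟩
  refine ⟨(p : R) ^ (d - c) * r, ?_⟩
  rw [← mul_assoc, ← pow_add, Nat.add_sub_cancel' h]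

theorem algebraMap_mem_lattice (r : R) : algebraMap R (Rp p R) r ∈ lattice p R 0 :=
  ⟨r, by simp⟩

theorem pow_mem_lattice (c : ℕ) : (p : Rp p R) ^ c ∈ lattice p R c :=
  ⟨1, by simp⟩

theorem pInv_mul : pInv p R * (p : Rp p R) = 1 := by
  have h := IsLocalization.Away.mul_invSelf (S := Rp p R) (p : R)
  rw [mul_comm, map_natCast] at h
  exact h

/-- `p` is invertible in `R[1/p]`, so powers of it cancel even before injectivity of `R → R[1/p]` is
known. -/
theorem pow_mul_mem_lattice_iff {c d : ℕ} {x : Rp p R} :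
    (p : Rp p R) ^ d * x ∈ lattice p R (c + d) ↔ x ∈ lattice p R c := by
  constructor
  · rintro ⟨r, hr⟩
    refine ⟨r, ?_⟩
    have h : pInv p R ^ d * ((p : Rp p R) ^ d * x) = x := by
      rw [← mul_assoc, ← mul_pow, pInv_mul, one_pow, one_mul]
    rw [← h, hr, pow_add, mul_comm ((p : R) ^ c), mul_assoc, map_mul, ← mul_assoc, map_pow,
      map_natCast, ← mul_pow, pInv_mul, one_pow, one_mul]
  · intro h
    rw [add_comm c d]
    exact mul_mem_lattice (pow_mem_lattice d) h

theorem exists_pow_mul_mem (x : Rp p R) : ∃ K, (p : Rp p R) ^ K * x ∈ lattice p R 0 := by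
  obtain ⟨K, r, hr⟩ := IsLocalization.Away.surj (p : R) x
  refine ⟨K, r, ?_⟩
  rw [map_natCast] at hr
  rw [mul_comm, hr]
  simp

theorem isUnit_p : IsUnit (p : Rp p R) := IsUnit.of_mul_eq_one_right _ pInv_mul

/-- `p ^ m Q_m → 0`. -/
def IsNull (Q : (Rp p R)⟦X⟧) : Prop :=
  ∀ c : ℕ, ∀ᶠ m in atTop, (p : Rp p R) ^ m * PowerSeries.coeff m Q ∈ lattice p R c

theorem IsNull.exists_bound {Q : (Rp p R)⟦X⟧} (hQ : IsNull Q) :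
    ∃ K, ∀ m, (p : Rp p R) ^ (K + m) * PowerSeries.coeff m Q ∈ lattice p R 0 := by
  obtain ⟨M, hM⟩ := eventually_atTop.mp (hQ 0)
  choose k hk using fun m => exists_pow_mul_mem (PowerSeries.coeff m Q)
  refine ⟨∑ i ∈ Finset.range M, k i, fun m => ?_⟩
  rcases le_or_gt M m with h | h
  · rw [pow_add, mul_assoc]
    exact lattice_anti (Nat.zero_le _) (mul_mem_lattice (pow_mem_lattice _) (hM m h))
  · have h1 : k m ≤ ∑ i ∈ Finset.range M, k i :=
      Finset.single_le_sum (fun _ _ => Nat.zero_le _) (Finset.mem_range.mpr h)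
    have h2 : ∑ i ∈ Finset.range M, k i + m = (∑ i ∈ Finset.range M, k i + m - k m) + k m := by
      omega
    rw [h2, pow_add, mul_assoc]
    exact lattice_anti (Nat.zero_le _) (mul_mem_lattice (pow_mem_lattice _) (hk m))

theorem IsNull.add {Q Q' : (Rp p R)⟦X⟧} (hQ : IsNull Q) (hQ' : IsNull Q') :
    IsNull (Q + Q') := by
  intro c
  filter_upwards [hQ c, hQ' c] with m h h'
  rw [map_add, mul_add]
  exact add_mem h h'

/-- In each term of the Cauchy product one of the two indices is large. Its factor is small enough
to absorb the bounded denominator `p^K` or `p^{K'}` of the other. -/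
theorem IsNull.mul {Q Q' : (Rp p R)⟦X⟧} (hQ : IsNull Q) (hQ' : IsNull Q') :
    IsNull (Q * Q') := by
  intro c
  obtain ⟨K, hK⟩ := hQ.exists_bound
  obtain ⟨K', hK'⟩ := hQ'.exists_bound
  obtain ⟨M, hM⟩ := eventually_atTop.mp (hQ (c + K'))
  obtain ⟨M', hM'⟩ := eventually_atTop.mp (hQ' (c + K))
  refine eventually_atTop.mpr ⟨M + M', fun m hm => ?_⟩
  rw [PowerSeries.coeff_mul, Finset.mul_sum]
  refine sum_mem fun ij hij => ?_
  obtain ⟨i, j⟩ := ij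
  rw [Finset.HasAntidiagonal.mem_antidiagonal] at hij
  simp only at hij ⊢
  rcases Nat.lt_or_ge i M with h | h
  · have h2 := mul_mem_lattice (hK i) (hM' j (by omega))
    rw [zero_add] at h2
    rw [← pow_mul_mem_lattice_iff (d := K)]
    convert h2 using 1
    rw [← hij, pow_add, pow_add]
    ring
  · have h2 := mul_mem_lattice (hM i h) (hK' j)
    rw [add_zero] at h2
    rw [← pow_mul_mem_lattice_iff (d := K')]
    convert h2 using 1
    rw [← hij, pow_add, pow_add]
    ring

theorem isNull_C (x : Rp p R) : IsNull (PowerSeries.C x) := by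
  intro c
  filter_upwards [eventually_gt_atTop 0] with m hm
  rw [PowerSeries.coeff_C, if_neg (by omega), mul_zero]
  exact zero_mem _

theorem isNull_X_add_p : IsNull (PowerSeries.X + PowerSeries.C (p : Rp p R)) := by
  intro c
  filter_upwards [eventually_gt_atTop 1] with m hm
  rw [map_add, PowerSeries.coeff_C, if_neg (by omega), PowerSeries.coeff_X, if_neg (by omega),
    add_zero, mul_zero]
  exact zero_mem _

theorem partial_sum_eq {Q : (Rp p R)⟦X⟧} (x : Rp p R) (m : ℕ) :
    x - ∑ i ∈ Finset.range (m + 1), PowerSeries.coeff i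
      (PowerSeries.C x + (PowerSeries.X + PowerSeries.C (p : Rp p R)) * Q) * (-(p : Rp p R)) ^ i =
    (-(p : Rp p R)) ^ (m + 1) * PowerSeries.coeff m Q := by
  induction m with
  | zero => simp [add_mul]
  | succ m ih =>
    rw [Finset.sum_range_succ, ← sub_sub, ih]
    simp only [map_add, add_mul, PowerSeries.coeff_succ_X_mul, PowerSeries.coeff_C_mul,
      PowerSeries.coeff_C, Nat.succ_ne_zero, if_false, zero_add]
    ring

theorem neg_pow_mul_mem {c m : ℕ} {x : Rp p R} :
    (-(p : Rp p R)) ^ m * x ∈ lattice p R c ↔ (p : Rp p R) ^ m * x ∈ lattice p R c := by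
  rw [neg_pow]
  rcases neg_one_pow_eq_or (Rp p R) m with h | h <;> rw [h]
  · rw [one_mul]
  · rw [neg_one_mul, neg_mul, neg_mem_iff]

/-- Division by `v + p`: the quotient has coefficients `S_{m+1} / (-p)^{m+1}`, where `S_m` is the
remainder after `m` terms, so convergence of the partial sums is exactly nullity of the quotient.
Compatibility of evaluation with sums and products becomes algebra in `R[1/p]⟦v⟧`. -/
theorem evalsTo_iff {F : (Rp p R)⟦X⟧} {x : Rp p R} :
    EvalsTo p R F x ↔ ∃ Q, IsNull Q ∧
      F = PowerSeries.C x + (PowerSeries.X + PowerSeries.C (p : Rp p R)) * Q := by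
  constructor
  · intro h
    have hu : IsUnit (-(p : Rp p R)) := isUnit_p.neg
    obtain ⟨w, hw⟩ := hu
    let S : ℕ → Rp p R := fun m =>
      x - ∑ i ∈ Finset.range m, PowerSeries.coeff i F * (-(p : Rp p R)) ^ i
    have hS : ∀ m, S (m + 1) = S m - PowerSeries.coeff m F * (-(p : Rp p R)) ^ m := by
      intro m
      simp only [S, Finset.sum_range_succ]
      ring
    let Q : (Rp p R)⟦X⟧ := PowerSeries.mk fun m => ((w⁻¹ : (Rp p R)ˣ) : Rp p R) ^ (m + 1) * S (m + 1)
    have hw1 : ((w⁻¹ : (Rp p R)ˣ) : Rp p R) * (-(p : Rp p R)) = 1 := by rw [← hw]; simp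
    have hQ : ∀ m, (-(p : Rp p R)) ^ (m + 1) * PowerSeries.coeff m Q = S (m + 1) := by
      intro m
      simp only [Q, PowerSeries.coeff_mk]
      rw [← mul_assoc, ← mul_pow, mul_comm _ ((w⁻¹ : (Rp p R)ˣ) : Rp p R), hw1, one_pow, one_mul]
    refine ⟨Q, fun c => ?_, ?_⟩
    -- One extra power of `p` is needed: `Q_m` comes from division by `(-p)^{m+1}`, while nullity
    -- weights it by `p^m`.
    · obtain ⟨M, hM⟩ := eventually_atTop.mp (h (c + 1))
      refine eventually_atTop.mpr ⟨M, fun m hm => ?_⟩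
      have h1 : S (m + 1) ∈ lattice p R (c + 1) := hM (m + 1) (by omega)
      rw [← hQ, neg_pow_mul_mem, pow_succ', mul_assoc] at h1
      have h2 := pow_mul_mem_lattice_iff (c := c) (d := 1)
        (x := (p : Rp p R) ^ m * PowerSeries.coeff m Q)
      rw [pow_one] at h2
      exact h2.mp h1
    · ext m
      have hcancel : ∀ (k : ℕ) (y z : Rp p R), (-(p : Rp p R)) ^ k * y = (-(p : Rp p R)) ^ k * z →
          y = z := fun k y z => (isUnit_p.neg.pow k).mul_left_cancel
      rw [map_add, add_mul, map_add, PowerSeries.coeff_C_mul]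
      apply hcancel m
      cases m with
      | zero =>
        have h1 := hQ 0
        rw [hS 0] at h1
        simp only [S, Finset.range_zero, Finset.sum_empty, pow_zero, mul_one, zero_add,
          pow_one, sub_zero] at h1
        simp only [pow_zero, one_mul, PowerSeries.coeff_zero_C, PowerSeries.coeff_zero_X_mul,
          zero_add]
        linear_combination h1
      | succ m =>
        have h1 := hQ (m + 1)
        rw [hS (m + 1), ← hQ m] at h1
        rw [PowerSeries.coeff_succ_X_mul, PowerSeries.coeff_C, if_neg (by omega), zero_add]
        rw [pow_succ _ (m + 1)] at h1
        linear_combination h1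
  · rintro ⟨Q, hQ, rfl⟩ c
    obtain ⟨M, hM⟩ := eventually_atTop.mp (hQ c)
    refine eventually_atTop.mpr ⟨M + 1, fun m hm => ?_⟩
    obtain ⟨m, rfl⟩ : ∃ m', m = m' + 1 := ⟨m - 1, by omega⟩
    rw [partial_sum_eq]
    change _ ∈ lattice p R c
    rw [neg_pow_mul_mem, pow_succ', mul_assoc]
    have := mul_mem_lattice (pow_mem_lattice (p := p) (R := R) 1) (hM m (by omega))
    rw [pow_one] at this
    exact lattice_anti (by omega) this

theorem EvalsTo.mul {F F' : (Rp p R)⟦X⟧} {x x' : Rp p R} (h : EvalsTo p R F x)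
    (h' : EvalsTo p R F' x') : EvalsTo p R (F * F') (x * x') := by
  rw [evalsTo_iff] at *
  obtain ⟨Q, hQ, rfl⟩ := h
  obtain ⟨Q', hQ', rfl⟩ := h'
  refine ⟨PowerSeries.C x * Q' + Q * PowerSeries.C x' +
    (PowerSeries.X + PowerSeries.C (p : Rp p R)) * (Q * Q'),
    (((isNull_C x).mul hQ').add (hQ.mul (isNull_C x'))).add (isNull_X_add_p.mul (hQ.mul hQ')), ?_⟩
  rw [map_mul]
  ring

theorem EvalsTo.add {F F' : (Rp p R)⟦X⟧} {x x' : Rp p R} (h : EvalsTo p R F x)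
    (h' : EvalsTo p R F' x') : EvalsTo p R (F + F') (x + x') := by
  rw [evalsTo_iff] at *
  obtain ⟨Q, hQ, rfl⟩ := h
  obtain ⟨Q', hQ', rfl⟩ := h'
  refine ⟨Q + Q', hQ.add hQ', ?_⟩
  rw [map_add]
  ring

theorem evalsTo_C (x : Rp p R) : EvalsTo p R (PowerSeries.C x) x := by
  rw [evalsTo_iff]
  refine ⟨PowerSeries.C 0, isNull_C 0, ?_⟩
  rw [map_zero, mul_zero, add_zero]

theorem evalsTo_sum {ι : Type*} (s : Finset ι) {F : ι → (Rp p R)⟦X⟧} {x : ι → Rp p R}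
    (h : ∀ i ∈ s, EvalsTo p R (F i) (x i)) : EvalsTo p R (∑ i ∈ s, F i) (∑ i ∈ s, x i) := by
  classical
  induction s using Finset.induction_on with
  | empty => simpa using evalsTo_C (p := p) (R := R) 0
  | insert i s hi ih =>
    rw [Finset.sum_insert hi, Finset.sum_insert hi]
    exact (h i (Finset.mem_insert_self _ _)).add
      (ih fun j hj => h j (Finset.mem_insert_of_mem hj))

theorem MatEvalsTo.mul {F F' : Matrix (Fin 3) (Fin 3) (Rp p R)⟦X⟧}
    {x x' : Matrix (Fin 3) (Fin 3) (Rp p R)} (h : MatEvalsTo p R F x)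
    (h' : MatEvalsTo p R F' x') : MatEvalsTo p R (F * F') (x * x') := by
  intro k l
  rw [Matrix.mul_apply, Matrix.mul_apply]
  exact evalsTo_sum _ fun i _ => (h k i).mul (h' i l)

theorem MatEvalsTo.add {F F' : Matrix (Fin 3) (Fin 3) (Rp p R)⟦X⟧}
    {x x' : Matrix (Fin 3) (Fin 3) (Rp p R)} (h : MatEvalsTo p R F x)
    (h' : MatEvalsTo p R F' x') : MatEvalsTo p R (F + F') (x + x') :=
  fun k l => (h k l).add (h' k l)

theorem MatEvalsTo.smul {F : (Rp p R)⟦X⟧} {F' : Matrix (Fin 3) (Fin 3) (Rp p R)⟦X⟧}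
    {x : Rp p R} {x' : Matrix (Fin 3) (Fin 3) (Rp p R)} (h : EvalsTo p R F x)
    (h' : MatEvalsTo p R F' x') : MatEvalsTo p R (F • F') (x • x') :=
  fun k l => h.mul (h' k l)

theorem EvalsTo.map {F : R⟦X⟧} {x : R} (h : EvalsTo p R F x) :
    EvalsTo p R (toRp p R F) (algebraMap R (Rp p R) x) := by
  intro c
  filter_upwards [h c] with m hm
  obtain ⟨r, hr⟩ := hm
  refine ⟨r, ?_⟩
  rw [Algebra.algebraMap_self_apply] at hr
  rw [← hr]
  simp [toRp]

theorem MatEvalsTo.map {F : Matrix (Fin 3) (Fin 3) R⟦X⟧} {x : Matrix (Fin 3) (Fin 3) R}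
    (h : MatEvalsTo p R F x) :
    MatEvalsTo p R (F.map (toRp p R)) (x.map (algebraMap R (Rp p R))) :=
  fun k l => (h k l).map

variable [IsAdicComplete (Ideal.span {(p : R)}) R]

theorem exists_evalsTo (F : R⟦X⟧) : ∃ x, EvalsTo p R F x := by
  obtain ⟨s, hs⟩ := exists_sum_of_dvd (q := (p : R))
    (fun i => PowerSeries.coeff i F * (-(p : R)) ^ i) (fun i => by
      rw [neg_pow]
      exact ((pow_dvd_pow _ (Nat.div_le_self i 2)).mul_left _).mul_left _)
  refine ⟨s, fun c => eventually_atTop.mpr ⟨2 * c, fun M hM => ?_⟩⟩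
  exact hs c M hM

theorem exists_matEvalsTo (F : Matrix (Fin 3) (Fin 3) R⟦X⟧) : ∃ x, MatEvalsTo p R F x := by
  choose x hx using fun k l => exists_evalsTo (p := p) (F k l)
  exact ⟨Matrix.of x, hx⟩

/-- Multiplying by `p^K` makes all terms integral with decay `p^{m/2}`. The sum then exists in `R`
by completeness, and dividing by `p^K` only shifts the rate of convergence. -/
theorem exists_evalsTo_of_bound {F : (Rp p R)⟦X⟧} (K : ℕ)
    (h : ∀ m, (p : Rp p R) ^ (K + m) * PowerSeries.coeff m F ∈ lattice p R (m / 2)) :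
    ∃ x, EvalsTo p R F x := by
  have h' : ∀ m, (p : Rp p R) ^ K * (PowerSeries.coeff m F * (-(p : Rp p R)) ^ m) ∈
      lattice p R (m / 2) := by
    intro m
    have h1 := h m
    rw [pow_add, mul_assoc, mul_left_comm, ← neg_pow_mul_mem] at h1
    convert h1 using 1
    ring
  choose r hr using h'
  obtain ⟨s, hs⟩ := exists_sum_of_dvd (q := (p : R)) (fun i => (p : R) ^ (i / 2) * r i)
    (fun i => dvd_mul_right _ _)
  refine ⟨pInv p R ^ K * algebraMap R (Rp p R) s, fun c =>
    eventually_atTop.mpr ⟨2 * (c + K), fun M hM => ?_⟩⟩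
  change _ ∈ lattice p R c
  rw [← pow_mul_mem_lattice_iff (d := K), mul_sub, ← mul_assoc, ← mul_pow, mul_comm (p : Rp p R),
    pInv_mul, one_pow, one_mul, Finset.mul_sum, Finset.sum_congr rfl fun i _ => hr i, ← map_sum,
    ← map_sub]
  obtain ⟨t, ht⟩ := hs (c + K) M hM
  exact ⟨t, by rw [ht]⟩

end Evaluation

/-! ### The series `λ` -/

theorem expand_injective {T : Type*} [CommRing T] {q : ℕ} (hq : q ≠ 0) :
    Function.Injective (PowerSeries.expand (R := T) q hq) := by
  intro F G h
  ext m
  rw [← PowerSeries.coeff_expand_mul q hq, h, PowerSeries.coeff_expand_mul]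

section Lambda

variable (p : ℕ) [hp : Fact p.Prime] (R : Type*) [CommRing R]

/-- The factor `1 + v ^ (p ^ i) / p` of `λ`, with `v = u ^ e`. -/
def lamFactor (i : ℕ) : (Rp p R)⟦X⟧ := 1 + PowerSeries.C (pInv p R) * PowerSeries.X ^ p ^ i

/-- `λ` as a power series in `v = u ^ e`. -/
def lamV : (Rp p R)⟦X⟧ :=
  PowerSeries.mk fun m => PowerSeries.coeff m (∏ i ∈ Finset.range (m + 1), lamFactor p R i)

variable {p R}

/-- The factor with index `M` differs from 1 only in degree `p^M > M`. -/
theorem coeff_prod_lamFactor {m M : ℕ} (h : m < M) :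
    PowerSeries.coeff m (∏ i ∈ Finset.range M, lamFactor p R i) =
      PowerSeries.coeff m (lamV p R) := by
  induction M, h using Nat.le_induction with
  | base => rw [lamV, PowerSeries.coeff_mk]
  | succ M hM ih =>
    rw [Finset.prod_range_succ, lamFactor, mul_add, mul_one, map_add, ih, add_eq_left,
      ← mul_assoc, PowerSeries.coeff_mul_X_pow', if_neg]
    have := Nat.lt_pow_self hp.out.one_lt (n := M)
    omega

theorem frobRp_lamFactor (i : ℕ) : frobRp p R (lamFactor p R i) = lamFactor p R (i + 1) := by
  simp [frobRp, lamFactor, PowerSeries.expand_C, pow_succ, ← pow_mul, mul_comm]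

theorem lamV_eq : lamV p R = lamFactor p R 0 * frobRp p R (lamV p R) := by
  ext m
  -- With `m + 2` factors, removing the factor of index 0 leaves `m + 1` of them, enough to
  -- determine every coefficient of `φ(λ)` up to degree `m`.
  rw [← coeff_prod_lamFactor (show m < m + 2 by omega), Finset.prod_range_succ', mul_comm]
  simp_rw [← frobRp_lamFactor]
  rw [← map_prod, PowerSeries.coeff_mul, PowerSeries.coeff_mul]
  refine Finset.sum_congr rfl fun ij hij => ?_
  rw [Finset.HasAntidiagonal.mem_antidiagonal] at hij
  congr 1
  change PowerSeries.coeff ij.2 (PowerSeries.expand p _ _) =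
    PowerSeries.coeff ij.2 (PowerSeries.expand p _ _)
  rw [PowerSeries.coeff_expand, PowerSeries.coeff_expand]
  split_ifs
  · apply coeff_prod_lamFactor
    have := Nat.div_le_self ij.2 p
    omega
  · rfl

theorem coeff_zero_lamV : PowerSeries.coeff 0 (lamV p R) = 1 := by
  rw [lamV, PowerSeries.coeff_mk]
  simp [lamFactor]

theorem coeff_succ_lamV (m : ℕ) :
    PowerSeries.coeff (m + 1) (lamV p R) =
      PowerSeries.coeff (m + 1) (frobRp p R (lamV p R)) +
        pInv p R * PowerSeries.coeff m (frobRp p R (lamV p R)) := by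
  conv_lhs => rw [lamV_eq]
  rw [lamFactor, pow_zero, pow_one, add_mul, one_mul, map_add, mul_assoc, PowerSeries.coeff_C_mul,
    PowerSeries.coeff_succ_X_mul]

theorem coeff_frobRp (F : (Rp p R)⟦X⟧) (m : ℕ) : PowerSeries.coeff m (frobRp p R F) =
    if p ∣ m then PowerSeries.coeff (m / p) F else 0 :=
  PowerSeries.coeff_expand p (p_ne_zero p) F

/-- `p ^ t` times the `t`-th coefficient is integral. -/
theorem pow_mul_coeff_lamV_mem (t : ℕ) :
    (p : Rp p R) ^ t * PowerSeries.coeff t (lamV p R) ∈ lattice p R 0 := by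
  have hp1 := hp.out.two_le
  induction t using Nat.strong_induction_on with
  | _ t ih =>
    -- A coefficient of `φ(λ)` at `s > 0` is zero or the coefficient of `λ` at `s / p < s`, so
    -- induction applies; the factor `1/p` of the recursion is paid for by passing from `t` to `t +
    -- 1`.
    have key : ∀ s ≤ t,
        (p : Rp p R) ^ s * PowerSeries.coeff s (frobRp p R (lamV p R)) ∈ lattice p R 0 := by
      intro s hs
      rw [coeff_frobRp]
      split_ifs with hd
      · obtain ⟨r, rfl⟩ := hd
        rw [Nat.mul_div_cancel_left r (by omega)]
        rcases Nat.eq_zero_or_pos r with rfl | hr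
        · rw [coeff_zero_lamV, mul_zero, pow_zero, one_mul]
          exact ⟨1, by simp⟩
        · have h1 : r < p * r := by nlinarith
          have h2 : p * r = (p * r - r) + r := by omega
          rw [h2, pow_add, mul_assoc]
          exact lattice_anti (Nat.zero_le _) (mul_mem_lattice (pow_mem_lattice _) (ih r (by omega)))
      · rw [mul_zero]
        exact zero_mem _
    cases t with
    | zero => rw [coeff_zero_lamV]; exact ⟨1, by simp⟩
    | succ t =>
      rw [coeff_succ_lamV, mul_add]
      refine add_mem (key _ le_rfl) ?_
      have h1 : (p : Rp p R) ^ (t + 1) *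
          (pInv p R * PowerSeries.coeff t (frobRp p R (lamV p R))) =
          (p : Rp p R) ^ t * PowerSeries.coeff t (frobRp p R (lamV p R)) := by
        rw [pow_succ]
        linear_combination (p : Rp p R) ^ t * PowerSeries.coeff t (frobRp p R (lamV p R)) *
          pInv_mul (p := p) (R := R)
      rw [h1]
      exact key t (by omega)

/-- The `t`-th coefficient of `φ(λ)` sits at index `t / p` in `λ` and has denominator at most
`p^{t/p}`. This gain makes `φ(λ)` converge at `v = -p`. -/
theorem pow_mul_coeff_frobRp_lamV_mem (t : ℕ) :
    (p : Rp p R) ^ t * PowerSeries.coeff t (frobRp p R (lamV p R)) ∈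
      lattice p R (t - t / p) := by
  rw [coeff_frobRp]
  split_ifs with hd
  · obtain ⟨r, rfl⟩ := hd
    have hp1 := hp.out.two_le
    rw [Nat.mul_div_cancel_left r (by omega)]
    have h1 : r ≤ p * r := by nlinarith
    rw [← Nat.sub_add_cancel h1, pow_add, mul_assoc, Nat.sub_add_cancel h1]
    exact mul_mem_lattice (pow_mem_lattice _) (pow_mul_coeff_lamV_mem r)
  · rw [mul_zero]
    exact zero_mem _

/-- `φ(λ)` has a value at `v = -p`, and it is a unit of `R`. -/
theorem exists_evalsTo_frobRp_lamV [IsLocalRing R] [IsAdicComplete (Ideal.span {(p : R)}) R]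
    (hpR : (p : R) ∈ IsLocalRing.maximalIdeal R) :
    ∃ w : Rˣ, EvalsTo p R (frobRp p R (lamV p R)) (algebraMap R (Rp p R) w) := by
  have hp1 := hp.out.two_le
  obtain ⟨x, hx⟩ := exists_evalsTo_of_bound (F := frobRp p R (lamV p R)) 0 (fun m => by
    rw [zero_add]
    refine lattice_anti ?_ (pow_mul_coeff_frobRp_lamV_mem m)
    have : m / p ≤ m / 2 := Nat.div_le_div_left hp1 (by omega)
    omega)
  obtain ⟨M, hM⟩ := eventually_atTop.mp (hx 1)
  -- Modulo `p` only the constant term 1 survives: every term of positive index `t` is divisible by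
  -- `p^{t - t/p}` with `t / p < t`.
  have h1 : x - _ ∈ lattice p R 1 := hM (M + 1) (by omega)
  rw [Finset.sum_range_succ'] at h1
  have h0 : PowerSeries.coeff 0 (frobRp p R (lamV p R)) = 1 := by
    rw [coeff_frobRp, if_pos (dvd_zero p), Nat.zero_div, coeff_zero_lamV]
  rw [h0, pow_zero, mul_one] at h1
  have h2 : ∑ k ∈ Finset.range M, PowerSeries.coeff (k + 1) (frobRp p R (lamV p R)) *
      (-(p : Rp p R)) ^ (k + 1) ∈ lattice p R 1 := by
    refine sum_mem fun k _ => ?_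
    rw [mul_comm, neg_pow_mul_mem]
    refine lattice_anti ?_ (pow_mul_coeff_frobRp_lamV_mem (k + 1))
    have : (k + 1) / p < k + 1 := Nat.div_lt_self (by omega) (by omega)
    omega
  have h3 := add_mem h1 h2
  obtain ⟨r, hr⟩ := h3
  have h4 : x = algebraMap R (Rp p R) (1 + (p : R) * r) := by
    rw [map_add, map_one]
    rw [pow_one] at hr
    rw [← hr]
    ring
  have h5 : IsUnit (1 + (p : R) * r) := by
    have h6 : (p : R) * r ∈ IsLocalRing.maximalIdeal R := Ideal.mul_mem_right _ _ hpR
    by_contra h7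
    have h8 : 1 + (p : R) * r ∈ IsLocalRing.maximalIdeal R := h7
    have h9 := Ideal.sub_mem _ h8 h6
    rw [add_sub_cancel_right] at h9
    exact h9 isUnit_one
  exact ⟨h5.unit, by rw [IsUnit.unit_spec, ← h4]; exact hx⟩

/-! ### `λ` as a series in `u`: functional equation and denominators. -/

section WithDegree

variable {f : ℕ} [NeZero f]

theorem frobRp_iterate_Eis (i : ℕ) :
    (frobRp p R)^[i] (PowerSeries.C (pInv p R) * Eis p f (Rp p R)) =
      PowerSeries.expand (ee p f) (ee_ne_zero p f) (lamFactor p R i) := by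
  induction i with
  | zero =>
    rw [Function.iterate_zero_apply, Eis, lamFactor, pow_zero, pow_one, mul_add, map_add, map_one,
      map_mul, PowerSeries.expand_C, PowerSeries.expand_X, add_comm]
    congr 1
    rw [← map_natCast (PowerSeries.C (R := Rp p R)), ← map_mul, pInv_mul, map_one]
  | succ i ih =>
    rw [Function.iterate_succ_apply', ih, ← frobRp_lamFactor]
    change PowerSeries.expand p _ _ = PowerSeries.expand _ _ (PowerSeries.expand p _ _)
    rw [← PowerSeries.expand_mul, ← PowerSeries.expand_mul]
    congr 2
    exact mul_comm _ _

theorem lam_eq_expand : lam p f R = PowerSeries.expand (ee p f) (ee_ne_zero p f) (lamV p R) := by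
  ext m
  rw [lam, PowerSeries.coeff_mk]
  simp_rw [frobRp_iterate_Eis]
  rw [← map_prod, PowerSeries.coeff_expand, PowerSeries.coeff_expand]
  split_ifs
  · apply coeff_prod_lamFactor
    have := Nat.div_le_self m (ee p f)
    omega
  · rfl

theorem frobRp_expand (F : (Rp p R)⟦X⟧) :
    frobRp p R (PowerSeries.expand (ee p f) (ee_ne_zero p f) F) =
      PowerSeries.expand (ee p f) (ee_ne_zero p f) (frobRp p R F) := by
  change PowerSeries.expand p _ _ = PowerSeries.expand _ _ (PowerSeries.expand p _ _)
  rw [← PowerSeries.expand_mul, ← PowerSeries.expand_mul]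
  congr 2
  exact mul_comm _ _

/-- The factor `E(u)/p` of index 0 is split off the product. The identity converts the factors `p λ`
of the monodromy equation into factors `E(u)`, which cancel the denominator of `C⁻¹`. -/
theorem p_mul_lam : (p : (Rp p R)⟦X⟧) * lam p f R = Eis p f (Rp p R) * frobRp p R (lam p f R) := by
  rw [lam_eq_expand, frobRp_expand]
  conv_lhs => rw [lamV_eq]
  rw [map_mul, ← frobRp_iterate_Eis, Function.iterate_zero_apply, ← mul_assoc, ← mul_assoc,
    ← map_natCast (PowerSeries.C (R := Rp p R)), ← map_mul, mul_comm (p : Rp p R), pInv_mul,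
    map_one, one_mul]

/-- The number of digits of `m` in base `p`. -/
def digitCount (p m : ℕ) : ℕ := Nat.log p (p * m)

theorem digitCount_mono {m m' : ℕ} (h : m ≤ m') : digitCount p m ≤ digitCount p m' :=
  Nat.log_mono_right (Nat.mul_le_mul_left p h)

theorem digitCount_mul {m : ℕ} (h : 0 < m) : digitCount p (p * m) = digitCount p m + 1 := by
  rw [digitCount, digitCount, mul_comm p (p * m),
    Nat.log_mul_base hp.out.one_lt (Nat.mul_ne_zero hp.out.ne_zero h.ne')]

theorem digitCount_pos {m : ℕ} (h : 0 < m) : 1 ≤ digitCount p m := by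
  have h1 := digitCount_mono (p := p) (show 1 ≤ m from h)
  have h2 : digitCount p 1 = 1 := by
    rw [digitCount, mul_one]
    have := Nat.log_pow hp.out.one_lt 1
    rwa [pow_one] at this
  omega

/-- In `λ = φ(λ) + u^e φ(λ)/p`, a coefficient of `φ(λ)` at a positive index comes from `λ` at an
index with one digit fewer, and the saved digit pays for the `1/p`. -/
theorem pow_digitCount_mul_coeff_lam_mem (m : ℕ) :
    (p : Rp p R) ^ digitCount p m * PowerSeries.coeff m (lam p f R) ∈ lattice p R 0 := by
  have hp1 := hp.out.two_le
  have he := Nat.pos_of_ne_zero (ee_ne_zero p f)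
  have raise : ∀ {a b : ℕ} {x : Rp p R}, a ≤ b → (p : Rp p R) ^ a * x ∈ lattice p R 0 →
      (p : Rp p R) ^ b * x ∈ lattice p R 0 := by
    intro a b x hab h
    rw [← Nat.sub_add_cancel hab, pow_add, mul_assoc]
    exact lattice_anti (Nat.zero_le _) (mul_mem_lattice (pow_mem_lattice _) h)
  induction m using Nat.strong_induction_on with
  | _ m ih =>
    have hfrob : ∀ s ≤ m, 0 < s → (p : Rp p R) ^ (digitCount p s - 1) *
        PowerSeries.coeff s (frobRp p R (lam p f R)) ∈ lattice p R 0 := by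
      intro s hs hs0
      rw [coeff_frobRp]
      split_ifs with hd
      · obtain ⟨r, rfl⟩ := hd
        rw [Nat.mul_div_cancel_left r (by omega)]
        have hr : 0 < r := Nat.pos_of_mul_pos_left hs0
        rw [digitCount_mul hr, Nat.add_sub_cancel]
        exact ih r (by nlinarith)
      · rw [mul_zero]
        exact zero_mem _
    have h0 : PowerSeries.coeff 0 (lam p f R) = 1 := by
      rw [lam_eq_expand, PowerSeries.coeff_expand, if_pos (dvd_zero _), Nat.zero_div,
        coeff_zero_lamV]
    rcases Nat.eq_zero_or_pos m with rfl | hm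
    · rw [h0, mul_one]
      exact lattice_anti (Nat.zero_le _) (pow_mem_lattice _)
    have h1 : PowerSeries.coeff m (lam p f R) =
        PowerSeries.coeff m (frobRp p R (lam p f R)) +
        pInv p R * PowerSeries.coeff m (PowerSeries.X ^ ee p f * frobRp p R (lam p f R)) := by
      have h2 := congrArg (PowerSeries.coeff m) (p_mul_lam (p := p) (R := R) (f := f))
      rw [Eis, add_mul, map_add, ← map_natCast (PowerSeries.C (R := Rp p R)),
        PowerSeries.coeff_C_mul, PowerSeries.coeff_C_mul] at h2
      linear_combination pInv p R * h2 + (PowerSeries.coeff m (frobRp p R (lam p f R)) -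
        PowerSeries.coeff m (lam p f R)) * pInv_mul (p := p) (R := R)
    rw [h1, mul_add]
    refine add_mem (raise (by omega) (hfrob m le_rfl hm)) ?_
    have h3 := digitCount_pos (p := p) hm
    obtain ⟨d, hd⟩ : ∃ d, digitCount p m = d + 1 := ⟨digitCount p m - 1, by omega⟩
    have h4 : ∀ y : Rp p R, (p : Rp p R) ^ digitCount p m * (pInv p R * y) =
        (p : Rp p R) ^ d * y := by
      intro y
      rw [hd, pow_succ]
      linear_combination (p : Rp p R) ^ d * y * pInv_mul (p := p) (R := R)
    rw [h4, PowerSeries.coeff_X_pow_mul']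
    split_ifs with h5
    -- Index 0 has no digit to lose, so the constant term of `φ(λ)` is treated apart.
    · rcases Nat.eq_zero_or_pos (m - ee p f) with h6 | h6
      · rw [h6, coeff_frobRp, if_pos (dvd_zero _), Nat.zero_div, h0, mul_one]
        exact lattice_anti (Nat.zero_le _) (pow_mem_lattice _)
      · have h7 := digitCount_mono (p := p) (Nat.sub_le m (ee p f))
        exact raise (by omega) (hfrob _ (Nat.sub_le _ _) h6)
    · rw [mul_zero]
      exact zero_mem _

end WithDegree

end Lambda

/-! ### The exponents `𝐚_k^{(j)}` -/

section Digits

variable {p f : ℕ} [hp : Fact p.Prime] [NeZero f] {a : Fin 3 → ZMod f → ℕ}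

/-- Multiplication by `p` shifts the digits; the top digit reaches `p^f = e + 1`, so it reappears at
the bottom and leaves `e` times itself. -/
theorem p_mul_digitSum (j : ZMod f) (k : Fin 3) :
    p * digitSum p a j k = digitSum p a (j + 1) k + ee p f * a k (-(j + 1)) := by
  obtain ⟨f', rfl⟩ : ∃ f', f = f' + 1 := ⟨f - 1, by have := NeZero.pos f; omega⟩
  have h1 : digitSum p a (j + 1) k =
      ∑ i ∈ Finset.range f', a k ((i : ZMod (f' + 1)) - j) * p ^ (i + 1) + a k (-(j + 1)) := by
    rw [digitSum, Finset.sum_range_succ']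
    simp only [pow_zero, mul_one, Nat.cast_zero, zero_sub]
    congr 1
    refine Finset.sum_congr rfl fun i _ => ?_
    congr 2
    push_cast
    ring
  have h2 : p * digitSum p a j k =
      ∑ i ∈ Finset.range f', a k ((i : ZMod (f' + 1)) - j) * p ^ (i + 1) +
        a k (-(j + 1)) * p ^ (f' + 1) := by
    rw [digitSum, Finset.sum_range_succ, mul_add, Finset.mul_sum]
    congr 1
    · refine Finset.sum_congr rfl fun i _ => ?_
      ring
    · have h3 : ((f' : ℕ) : ZMod (f' + 1)) - j = -(j + 1) := by
        have h4 := ZMod.natCast_self (f' + 1)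
        push_cast at h4
        linear_combination h4
      rw [h3]
      ring
  have h3 : p ^ (f' + 1) = ee p (f' + 1) + 1 := by
    have := Nat.pos_of_ne_zero (ee_ne_zero p (f' + 1))
    unfold ee at this ⊢
    omega
  rw [h2, h1, h3]
  ring

theorem sum_mul_pow_lt {c : ℕ → ℕ} (hc : ∀ i, c i ≤ p - 1) (m : ℕ) :
    ∑ i ∈ Finset.range m, c i * p ^ i < p ^ m := by
  have hp1 := hp.out.two_le
  induction m with
  | zero => simp
  | succ m ih =>
    rw [Finset.sum_range_succ, pow_succ]
    obtain ⟨q, rfl⟩ : ∃ q, p = q + 1 := ⟨p - 1, by omega⟩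
    have := Nat.mul_le_mul_right ((q + 1) ^ m) (hc m)
    rw [Nat.add_sub_cancel] at this
    nlinarith

/-- The leading digits of `𝐚_k^{(j)}` decide the order. -/
theorem digitSum_lt_of_lt (ha : ∀ k j, a k j ≤ p - 1) {j : ZMod f} {k l : Fin 3}
    (h : a k (-(j + 1)) < a l (-(j + 1))) : digitSum p a j k < digitSum p a j l := by
  obtain ⟨f', rfl⟩ : ∃ f', f = f' + 1 := ⟨f - 1, by have := NeZero.pos f; omega⟩
  have h3 : ((f' : ℕ) : ZMod (f' + 1)) - j = -(j + 1) := by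
    have h4 := ZMod.natCast_self (f' + 1)
    push_cast at h4
    linear_combination h4
  rw [digitSum, digitSum, Finset.sum_range_succ, Finset.sum_range_succ, h3]
  have h1 : ∑ i ∈ Finset.range f', a k ((i : ZMod (f' + 1)) - j) * p ^ i < p ^ f' :=
    sum_mul_pow_lt (fun i => ha _ _) f'
  have h2 := Nat.mul_le_mul_right (p ^ f') (Nat.succ_le_of_lt h)
  rw [Nat.succ_eq_add_one, add_mul, one_mul] at h2
  omega

/-- Digitwise the excess is at most `p - 2`, and `∑ (p - 2) p^i = e - ∑ p^i < e`. Strictness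
matters: exponents known modulo `e` are then known to have a non-negative quotient. -/
theorem digitSum_lt_add {k l : Fin 3} (h : ∀ j, a k j ≤ a l j + (p - 2)) (j : ZMod f) :
    digitSum p a j k < digitSum p a j l + ee p f := by
  have hp1 := hp.out.two_le
  have h1 : digitSum p a j k ≤ digitSum p a j l +
      ∑ i ∈ Finset.range f, (p - 2) * p ^ i := by
    rw [digitSum, digitSum, ← Finset.sum_add_distrib]
    refine Finset.sum_le_sum fun i _ => ?_
    rw [← add_mul]
    exact Nat.mul_le_mul_right _ (h _)
  have h2 : ∑ i ∈ Finset.range f, (p - 2) * p ^ i + ∑ i ∈ Finset.range f, p ^ i = ee p f := by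
    rw [← Finset.sum_add_distrib]
    have h3 : ∀ i ∈ Finset.range f, (p - 2) * p ^ i + p ^ i = (p - 1) * p ^ i := by
      intro i _
      rw [← Nat.succ_mul]
      congr 1
      omega
    rw [Finset.sum_congr rfl h3, ← Finset.mul_sum, mul_comm, Nat.geomSum_eq hp1, ee]
    exact Nat.div_mul_cancel (by simpa using Nat.sub_dvd_pow_sub_pow p 1 f)
  have h4 : 0 < ∑ i ∈ Finset.range f, p ^ i :=
    Finset.sum_pos (fun i _ => pow_pos (by omega) i)
      (Finset.nonempty_range_iff.mpr (NeZero.ne f))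
  omega

end Digits

/-! ### Removing the descent datum -/

section Removal

variable {p f : ℕ} [hp : Fact p.Prime] [NeZero f]

/-- The diagonal matrix of the `u ^ {b_k}`. -/
def diagX (T : Type*) [CommRing T] (b : Fin 3 → ℕ) : Matrix (Fin 3) (Fin 3) T⟦X⟧ :=
  Matrix.diagonal fun k => PowerSeries.X ^ b k

/-- `D = Ad(u ^ b) B(u ^ e)`. -/
def IsTwist (p f : ℕ) [Fact p.Prime] [NeZero f] {T : Type*} [CommRing T]
    (b : Fin 3 → ℕ) (D B : Matrix (Fin 3) (Fin 3) T⟦X⟧) : Prop :=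
  D * diagX T b =
    diagX T b * B.map (PowerSeries.expand (R := T) (ee p f) (ee_ne_zero p f)).toRingHom

variable {T : Type*} [CommRing T] {b : Fin 3 → ℕ} {D D' B B' : Matrix (Fin 3) (Fin 3) T⟦X⟧}

theorem isTwist_iff : IsTwist p f b D B ↔ ∀ k l, D k l * PowerSeries.X ^ b l =
    PowerSeries.X ^ b k * PowerSeries.expand (ee p f) (ee_ne_zero p f) (B k l) := by
  rw [IsTwist, ← Matrix.ext_iff]
  refine forall_congr' fun k => forall_congr' fun l => ?_
  rw [diagX, Matrix.mul_diagonal, Matrix.diagonal_mul]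
  rfl

/-- The orientation only relabels rows and columns. The computations use the unpermuted indices, and
the permutation is restored at the very end. -/
theorem removesDescent_iff {s : Equiv.Perm (Fin 3)} :
    RemovesDescent p (f := f) b s D B ↔ IsTwist p f b D (B.submatrix s.symm s.symm) := by
  rw [isTwist_iff]
  constructor
  · intro h k l
    simpa using h (s.symm k) (s.symm l)
  · intro h k l
    simpa using h (s k) (s l)

theorem IsTwist.mul (h : IsTwist p f b D B) (h' : IsTwist p f b D' B') :
    IsTwist p f b (D * D') (B * B') := by
  unfold IsTwist at *
  rw [mul_assoc, h', ← mul_assoc, h, Matrix.map_mul, mul_assoc]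

theorem IsTwist.sub (h : IsTwist p f b D B) (h' : IsTwist p f b D' B') :
    IsTwist p f b (D - D') (B - B') := by
  unfold IsTwist at *
  rw [sub_mul, h, h', ← mul_sub, ← Matrix.map_sub]
  exact map_sub _

theorem IsTwist.smul (F : T⟦X⟧) (h : IsTwist p f b D B) :
    IsTwist p f b (PowerSeries.expand (ee p f) (ee_ne_zero p f) F • D) (F • B) := by
  rw [isTwist_iff] at *
  intro k l
  rw [Matrix.smul_apply, Matrix.smul_apply, smul_eq_mul, smul_eq_mul, map_mul, mul_assoc, h]
  ring

theorem isTwist_zero : IsTwist p f b (0 : Matrix (Fin 3) (Fin 3) T⟦X⟧) 0 := by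
  rw [isTwist_iff]
  intro k l
  simp

theorem isTwist_one : IsTwist p f b (1 : Matrix (Fin 3) (Fin 3) T⟦X⟧) 1 := by
  unfold IsTwist
  rw [Matrix.map_one _ (map_zero _) (map_one _), one_mul, mul_one]

theorem IsTwist.map {T' : Type*} [CommRing T'] (g : T →+* T') (h : IsTwist p f b D B) :
    IsTwist p f b (D.map (PowerSeries.map g)) (B.map (PowerSeries.map g)) := by
  rw [isTwist_iff] at *
  intro k l
  have := congrArg (PowerSeries.map g) (h k l)
  rw [map_mul, map_mul, PowerSeries.map_expand, map_pow, map_pow, PowerSeries.map_X] at this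
  exact this

theorem diagX_mul_left_injective {D D' : Matrix (Fin 3) (Fin 3) T⟦X⟧}
    (h : diagX T b * D = diagX T b * D') : D = D' := by
  refine Matrix.ext fun k l => ?_
  have h1 := congrFun (congrFun h k) l
  rw [diagX, Matrix.diagonal_mul, Matrix.diagonal_mul] at h1
  exact PowerSeries.X_pow_mul_cancel h1

/-- The exponents of `u` in a twist of a matrix over `T⟦u ^ e⟧`. -/
def HasTwistedSupport (p f : ℕ) (b : Fin 3 → ℕ) (D : Matrix (Fin 3) (Fin 3) T⟦X⟧) : Prop :=
  ∀ k l m, PowerSeries.coeff m (D k l) ≠ 0 → ∃ t, m + b l = b k + ee p f * t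

theorem IsTwist.hasTwistedSupport (h : IsTwist p f b D B) : HasTwistedSupport p f b D := by
  rw [isTwist_iff] at h
  intro k l m hm
  have h1 := congrArg (PowerSeries.coeff (m + b l)) (h k l)
  rw [PowerSeries.coeff_mul_X_pow, PowerSeries.coeff_X_pow_mul', PowerSeries.coeff_expand] at h1
  rw [h1] at hm
  split_ifs at hm with h2 h3
  · obtain ⟨t, ht⟩ := h3
    exact ⟨t, by omega⟩
  · exact absurd rfl hm
  · exact absurd rfl hm

/-- Being a twist is a condition on exponents only, so it can be checked coefficient by coefficient
and survives derivatives and coefficientwise limits. -/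
theorem HasTwistedSupport.exists_isTwist (h : HasTwistedSupport p f b D) :
    ∃ B, IsTwist p f b D B := by
  have he := Nat.pos_of_ne_zero (ee_ne_zero p f)
  -- The default 0 stands for the coefficient of a negative power of `u`, which truncated
  -- subtraction would misread.
  refine ⟨Matrix.of fun k l => PowerSeries.mk fun t =>
    if b l ≤ b k + ee p f * t then PowerSeries.coeff (b k + ee p f * t - b l) (D k l) else 0, ?_⟩
  rw [isTwist_iff]
  intro k l
  ext M
  rw [PowerSeries.coeff_mul_X_pow', PowerSeries.coeff_X_pow_mul', PowerSeries.coeff_expand,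
    Matrix.of_apply, PowerSeries.coeff_mk]
  by_cases h1 : b k ≤ M ∧ ee p f ∣ M - b k
  · obtain ⟨h2, t, ht⟩ := h1
    obtain rfl : M = b k + ee p f * t := by omega
    rw [if_pos h2, Nat.add_sub_cancel_left, if_pos (dvd_mul_right _ _),
      Nat.mul_div_cancel_left _ he]
  · have h2 : (if b k ≤ M then if ee p f ∣ M - b k then
        if b l ≤ b k + ee p f * ((M - b k) / ee p f) then
          PowerSeries.coeff (b k + ee p f * ((M - b k) / ee p f) - b l) (D k l) else 0
        else 0 else (0 : T)) = 0 := by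
      split_ifs with h3 h4 h5
      · exact absurd ⟨h3, h4⟩ h1
      all_goals rfl
    rw [h2]
    split_ifs with h3
    · by_contra h4
      obtain ⟨t, ht⟩ := h k l _ h4
      exact h1 ⟨by omega, t, by omega⟩
    · rfl

/-- The side `D_{kl} u^{b_l}` starts in degree `b_l > b_k`, so `B(u^e)` has no constant term: twists
are triangular modulo `v`. -/
theorem IsTwist.constantCoeff_eq_zero (h : IsTwist p f b D B) {k l : Fin 3} (hkl : b k < b l) :
    PowerSeries.coeff 0 (B k l) = 0 := by
  rw [isTwist_iff] at h
  have h1 := congrArg (PowerSeries.coeff (b k)) (h k l)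
  rw [PowerSeries.coeff_mul_X_pow', if_neg (by omega)] at h1
  have h2 := PowerSeries.coeff_X_pow_mul
    (PowerSeries.expand (ee p f) (ee_ne_zero p f) (B k l)) (b k) 0
  rw [zero_add] at h2
  rw [h2, PowerSeries.coeff_expand, if_pos (dvd_zero _), Nat.zero_div] at h1
  exact h1.symm

theorem IsTwist.constantCoeff_diag (h : IsTwist p f b D B) (k : Fin 3) :
    PowerSeries.coeff 0 (B k k) = PowerSeries.coeff 0 (D k k) := by
  rw [isTwist_iff] at h
  have h1 := h k k
  rw [mul_comm] at h1
  have h2 := PowerSeries.X_pow_mul_cancel h1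
  rw [h2, PowerSeries.coeff_expand, if_pos (dvd_zero _), Nat.zero_div]

variable {R : Type*} [CommRing R] {b' α : Fin 3 → ℕ}

/-- `φ` turns a twist by `b'` into a twist by `p b' = b + e α`, and `u^{e α} = v^α` moves into the
matrix as `v^{α_k - α_l}`. A negative exponent is harmless: then `G_{kl}` has no constant term, so
`φ(G_{kl})` is divisible by `v^p`, while `α_l ≤ p - 1`. -/
theorem IsTwist.frob {D G : Matrix (Fin 3) (Fin 3) (Rp p R)⟦X⟧} (h : IsTwist p f b' D G)
    (hb : ∀ k, p * b' k = b k + ee p f * α k) (hα : ∀ k, α k ≤ p - 1)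
    (hlt : ∀ k l, α k < α l → b' k < b' l) :
    ∃ Y, IsTwist p f b (D.map (frobRp p R)) Y ∧
      ∀ k l, PowerSeries.X ^ α l * Y k l = PowerSeries.X ^ α k * frobRp p R (G k l) := by
  have hp1 := hp.out.two_le
  have h1 : ∀ k l, ∃ Y : (Rp p R)⟦X⟧,
      PowerSeries.X ^ α l * Y = PowerSeries.X ^ α k * frobRp p R (G k l) := by
    intro k l
    rcases Nat.lt_or_ge (α k) (α l) with h2 | h2
    · have h3 : (PowerSeries.X : (Rp p R)⟦X⟧) ^ (α l - α k) ∣ frobRp p R (G k l) := by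
        rw [PowerSeries.X_pow_dvd_iff]
        intro m hm
        rw [coeff_frobRp]
        split_ifs with h4
        · obtain ⟨r, rfl⟩ := h4
          have h5 := hα l
          have h6 : r = 0 := by
            by_contra h7
            have := Nat.le_mul_of_pos_right p (Nat.pos_of_ne_zero h7)
            omega
          rw [h6, mul_zero, Nat.zero_div, h.constantCoeff_eq_zero (hlt k l h2)]
        · rfl
      obtain ⟨Y, hY⟩ := h3
      refine ⟨Y, ?_⟩
      rw [hY, ← mul_assoc, ← pow_add, Nat.add_sub_cancel' h2.le]
    · refine ⟨PowerSeries.X ^ (α k - α l) * frobRp p R (G k l), ?_⟩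
      rw [← mul_assoc, ← pow_add, Nat.add_sub_cancel' h2]
  choose Y hY using h1
  refine ⟨Matrix.of Y, ?_, hY⟩
  rw [isTwist_iff] at *
  intro k l
  have h2 := congrArg (frobRp p R) (h k l)
  rw [map_mul, map_mul, frobRp_expand] at h2
  have h3 : ∀ m, frobRp p R (PowerSeries.X ^ m) = PowerSeries.X ^ (p * m) := by
    intro m
    simp [frobRp, pow_mul]
  rw [h3, h3, hb, hb] at h2
  have h4 := congrArg (PowerSeries.expand (ee p f) (ee_ne_zero p f)) (hY k l)
  rw [map_mul, map_mul, map_pow, map_pow, PowerSeries.expand_X, ← pow_mul, ← pow_mul] at h4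
  apply PowerSeries.X_pow_mul_cancel (k := ee p f * α l)
  rw [Matrix.map_apply, Matrix.of_apply, mul_left_comm _ (PowerSeries.X ^ b k), h4]
  rw [pow_add, pow_add] at h2
  linear_combination h2

theorem coeff_of_X_pow_mul_eq {F G : (Rp p R)⟦X⟧} {c d : ℕ}
    (h : PowerSeries.X ^ d * F = PowerSeries.X ^ c * frobRp p R G) (t : ℕ) :
    PowerSeries.coeff t F = 0 ∨
      ∃ r, t + d = c + p * r ∧ PowerSeries.coeff t F = PowerSeries.coeff r G := by
  have h1 := congrArg (PowerSeries.coeff (t + d)) h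
  rw [PowerSeries.coeff_X_pow_mul, PowerSeries.coeff_X_pow_mul', coeff_frobRp] at h1
  split_ifs at h1 with h2 h3
  · obtain ⟨r, hr⟩ := h3
    rw [hr, Nat.mul_div_cancel_left r hp.out.pos] at h1
    exact Or.inr ⟨r, by omega, h1⟩
  · exact Or.inl h1
  · exact Or.inl h1

end Removal

/-! ### The idempotents of `W ⊗ R` -/

section Witt

variable {p f : ℕ} [hp : Fact p.Prime] [NeZero f]

/-- Every element of `W` is a `ℤ_p`-linear combination of Teichmüller representatives. -/
theorem exists_sum_smul_teichmuller [Fintype (GaloisField p f)] (x : W p f) :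
    ∃ c : GaloisField p f → ℤ_[p], x = ∑ a, c a • (WittVector.teichmuller p a : W p f) := by
  classical
  have hcomp : IsAdicComplete (Ideal.span {(p : ℤ_[p])}) ℤ_[p] := by
    rw [← PadicInt.maximalIdeal_eq_span_p]
    infer_instance
  -- The Teichmüller digits of `x`: its Witt components untwisted by powers of Frobenius.
  let d : ℕ → GaloisField p f := fun i =>
    ((_root_.frobeniusEquiv (GaloisField p f) p).symm ^ i) (x.coeff i)
  have hd : ∀ n, (p : W p f) ^ n ∣
      x - ∑ i ∈ Finset.range n, WittVector.teichmuller p (d i) * (p : W p f) ^ i := by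
    intro n
    cases n with
    | zero => simp
    | succ n =>
      have h := WittVector.dvd_sub_sum_teichmuller_iterateFrobeniusEquiv_coeff x n
      rwa [← Nat.range_succ_eq_Iic] at h
  -- The expansion is grouped by digit; the coefficient of `[a]` is the sum of the `p^i` over all
  -- places `i` with digit `a`.
  have hc : ∀ a, ∃ c : ℤ_[p], ∀ m M, 2 * m ≤ M → (p : ℤ_[p]) ^ m ∣
      c - ∑ i ∈ Finset.range M, if d i = a then (p : ℤ_[p]) ^ i else 0 := by
    intro a
    refine exists_sum_of_dvd _ fun i => ?_
    split_ifs
    · exact pow_dvd_pow _ (Nat.div_le_self i 2)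
    · exact dvd_zero _
  choose c hc using hc
  refine ⟨c, ?_⟩
  rw [← sub_eq_zero]
  apply IsHausdorff.haus (inferInstance : IsHausdorff (Ideal.span {(p : W p f)}) (W p f))
  intro n
  rw [SModEq.zero, smul_eq_mul, Ideal.mul_top, Ideal.span_singleton_pow,
    Ideal.mem_span_singleton]
  have h1 := (pow_dvd_pow (p : W p f) (show n ≤ 2 * n by omega)).trans (hd (2 * n))
  have h2 : (p : W p f) ^ n ∣ ∑ a, (c a - ∑ i ∈ Finset.range (2 * n),
      if d i = a then (p : ℤ_[p]) ^ i else 0) • (WittVector.teichmuller p a : W p f) := by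
    refine Finset.dvd_sum fun a _ => ?_
    obtain ⟨r, hr⟩ := hc a n (2 * n) le_rfl
    rw [hr, Algebra.smul_def, map_mul, map_pow, map_natCast, mul_assoc]
    exact dvd_mul_right _ _
  have h3 := dvd_sub h1 h2
  convert h3 using 1
  have h4 : ∑ a, (∑ i ∈ Finset.range (2 * n),
      if d i = a then (p : ℤ_[p]) ^ i else 0) • (WittVector.teichmuller p a : W p f) =
      ∑ i ∈ Finset.range (2 * n), WittVector.teichmuller p (d i) * (p : W p f) ^ i := by
    simp_rw [Finset.sum_smul]
    rw [Finset.sum_comm]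
    refine Finset.sum_congr rfl fun i _ => ?_
    simp_rw [ite_smul, zero_smul]
    rw [Finset.sum_ite_eq, if_pos (Finset.mem_univ _), Algebra.smul_def, map_pow, map_natCast,
      mul_comm]
  simp_rw [sub_smul]
  rw [Finset.sum_sub_distrib, h4]
  ring

/-- Frobenius acts on Witt components by `p`-th powers, so a fixed vector has all its components in
the prime field. -/
theorem exists_padicToW_of_frobenius_eq {x : W p f} (h : WittVector.frobenius x = x) :
    ∃ y, padicToW p f y = x := by
  have h1 : ∀ n, ∃ y : ZMod p, algebraMap (ZMod p) (GaloisField p f) y = x.coeff n := by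
    intro n
    have h2 : x.coeff n ^ p = x.coeff n := by
      rw [← WittVector.coeff_frobenius_charP, h]
    rw [← Subfield.mem_bot_iff_pow_eq_self (F := GaloisField p f)] at h2
    have h3 : (⊥ : Subfield (GaloisField p f)) ≤
        (algebraMap (ZMod p) (GaloisField p f)).fieldRange := bot_le
    exact h3 h2
  choose y hy using h1
  refine ⟨WittVector.equiv p (WittVector.mk p y), ?_⟩
  change WittVector.map (algebraMap (ZMod p) (GaloisField p f))
    ((WittVector.equiv p).symm (WittVector.equiv p (WittVector.mk p y))) = x
  rw [RingEquiv.symm_apply_apply]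
  ext n
  rw [WittVector.map_coeff]
  exact hy n

theorem frobenius_sigma_succ (j : ZMod f) (y : W p f) :
    WittVector.frobenius (sigma (RingHom.id (W p f)) (j + 1) y) =
      sigma (RingHom.id (W p f)) j y := by
  obtain ⟨x, rfl⟩ : ∃ x : W p f, (WittVector.frobenius (p := p))^[(j + 1).val] x = y :=
    (WittVector.frobenius_bijective p (GaloisField p f)).2.iterate _ y
  rw [sigma_iterate, ← sigma_succ, ← Function.iterate_succ_apply' (f := WittVector.frobenius),
    Function.iterate_succ_apply, sigma_iterate]
  rfl

theorem frobenius_teichmuller (a : GaloisField p f) :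
    WittVector.frobenius (WittVector.teichmuller p a : W p f) = WittVector.teichmuller p (a ^ p) := by
  ext n
  rw [WittVector.coeff_frobenius_charP]
  cases n with
  | zero => rw [WittVector.teichmuller_coeff_zero, WittVector.teichmuller_coeff_zero]
  | succ n =>
    rw [WittVector.teichmuller_coeff_pos p _ _ n.succ_pos,
      WittVector.teichmuller_coeff_pos p _ _ n.succ_pos, zero_pow hp.out.ne_zero]

theorem frobenius_iterate_teichmuller (m : ℕ) (a : GaloisField p f) :
    (WittVector.frobenius (p := p))^[m] (WittVector.teichmuller p a : W p f) =
      WittVector.teichmuller p (a ^ p ^ m) := by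
  induction m with
  | zero => simp
  | succ m ih =>
    rw [Function.iterate_succ_apply', ih, frobenius_teichmuller, ← pow_mul, ← pow_succ]

/-- A Teichmüller lift of a generator of `kˣ`. -/
theorem exists_generator (p f : ℕ) [Fact p.Prime] [NeZero f] :
    ∃ c : (GaloisField p f)ˣ, (∀ a, a ∈ Subgroup.zpowers c) ∧ orderOf c = ee p f := by
  have : Fintype (GaloisField p f) := Fintype.ofFinite _
  obtain ⟨c, hc⟩ := IsCyclic.exists_generator (α := (GaloisField p f)ˣ)
  refine ⟨c, hc, ?_⟩
  rw [orderOf_eq_card_of_forall_mem_zpowers hc, Nat.card_units, GaloisField.card p f (NeZero.ne f)]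
  rfl

theorem teichmuller_pow_sub_isUnit {c : (GaloisField p f)ˣ} (hc : orderOf c = ee p f) {i j : ℕ}
    (h : ¬ i ≡ j [MOD ee p f]) :
    IsUnit ((WittVector.teichmuller p (c : GaloisField p f) : W p f) ^ i -
      WittVector.teichmuller p (c : GaloisField p f) ^ j) := by
  apply WittVector.isUnit_of_coeff_zero_ne_zero
  have h1 : ∀ m, WittVector.constantCoeff
      ((WittVector.teichmuller p (c : GaloisField p f) : W p f) ^ m) = (c : GaloisField p f) ^ m := by
    intro m
    rw [map_pow]
    exact congrArg (· ^ m) (WittVector.teichmuller_coeff_zero p _)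
  have h2 := map_sub (WittVector.constantCoeff (p := p) (R := GaloisField p f))
    ((WittVector.teichmuller p (c : GaloisField p f) : W p f) ^ i)
      (WittVector.teichmuller p (c : GaloisField p f) ^ j)
  rw [h1, h1] at h2
  intro h3
  rw [WittVector.constantCoeff_apply, h3] at h2
  apply h
  rw [← hc, ← pow_eq_pow_iff_modEq]
  apply Units.ext
  rw [Units.val_pow_eq_pow_val, Units.val_pow_eq_pow_val]
  exact sub_eq_zero.mp h2.symm

/-- On a Teichmüller generator `ζ` the embedding of index `k` is `ζ ↦ ζ^{p^{f-k}}`, and distinct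
powers of `ζ` modulo `e` remain distinct modulo `p`. This separates the components of `W ⊗ R`. -/
theorem sigma_sub_sigma_isUnit {c : (GaloisField p f)ˣ} (hc : orderOf c = ee p f)
    {S : Type*} [CommRing S] (ρ : W p f →+* S) {i j : ZMod f} (h : i ≠ j) :
    IsUnit (sigma ρ i (WittVector.teichmuller p (c : GaloisField p f)) -
      sigma ρ j (WittVector.teichmuller p (c : GaloisField p f))) := by
  have hfac : ∀ k : ZMod f, sigma (RingHom.id (W p f)) k
      (WittVector.teichmuller p (c : GaloisField p f)) =
      WittVector.teichmuller p (c : GaloisField p f) ^ p ^ (f - k.val) := by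
    intro k
    have h1 : (WittVector.teichmuller p (c : GaloisField p f) : W p f) =
        (WittVector.frobenius (p := p))^[k.val]
          (WittVector.teichmuller p (c : GaloisField p f) ^ p ^ (f - k.val)) := by
      rw [← map_pow, frobenius_iterate_teichmuller, ← pow_mul, ← pow_add,
        Nat.sub_add_cancel (ZMod.val_lt k).le, ← frobenius_iterate_teichmuller, frobenius_iterate]
    conv_lhs => rw [h1]
    rw [sigma_iterate, RingHom.id_apply]
  change IsUnit (ρ (sigma (RingHom.id (W p f)) i _) - ρ (sigma (RingHom.id (W p f)) j _))
  rw [← map_sub, hfac, hfac]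
  refine IsUnit.map ρ (teichmuller_pow_sub_isUnit hc fun h1 => h ?_)
  have hp1 := hp.out.one_lt
  have hcop : ∀ i : ZMod f, p ^ (f - i.val) * p ^ i.val ≡ 1 [MOD ee p f] := by
    intro i
    rw [← pow_add, Nat.sub_add_cancel (ZMod.val_lt i).le]
    have := Nat.one_le_pow f p (by omega)
    exact ((Nat.modEq_iff_dvd' this).mpr dvd_rfl).symm
  have h3 : p ^ i.val ≡ p ^ j.val [MOD ee p f] := by
    have h4 := (hcop j).mul_right (p ^ i.val)
    have h5 := (hcop i).mul_right (p ^ j.val)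
    rw [one_mul] at h4 h5
    refine h4.symm.trans (Nat.ModEq.trans ?_ h5)
    have h6 := (h1.mul_right (p ^ i.val * p ^ j.val)).symm
    convert h6 using 1 <;> ring
  -- The strict inequality can fail for `f = 1`, but then there is only one index.
  have hlt : ∀ i : ZMod f, 1 < f → p ^ i.val < ee p f := by
    intro i hf
    have h4 : p ^ i.val ≤ p ^ (f - 1) :=
      Nat.pow_le_pow_right (by omega) (by have := ZMod.val_lt i; omega)
    have h5 : p ^ f = p * p ^ (f - 1) := by rw [← pow_succ']; congr 1; omega
    have h6 : p ≤ p ^ (f - 1) := Nat.le_self_pow (by omega) p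
    have h7 := Nat.mul_le_mul_right (p ^ (f - 1)) hp1
    unfold ee
    omega
  rcases Nat.lt_or_ge 1 f with hf | hf
  · have h4 := Nat.ModEq.eq_of_lt_of_lt h3 (hlt i hf) (hlt j hf)
    exact ZMod.val_injective f (Nat.pow_right_injective hp1 h4)
  · apply ZMod.val_injective f
    have h4 := ZMod.val_lt i
    have h5 := ZMod.val_lt j
    omega

/-! ### Splitting `W ⊗ R` along the embeddings `σ_j`. -/

section Coefficients

variable {O : Type*} [CommRing O] (σ₀ : W p f →+* O) (R : Type*) [CommRing R] [Algebra ℤ_[p] R]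
  [Algebra O R]

/-- The composite of `σ_j` and `O → R`. -/
def sigmaR (j : ZMod f) : W p f →+* R := (algebraMap O R).comp (sigma σ₀ j)

/-- Every `x` is a natural number modulo `p^n`, so two maps agree modulo every `p^n R`; no
continuity is needed. Hence the given `ℤ_p`-structure on `R` is the one induced by every `σ_j`. -/
theorem padic_ringHom_ext [IsHausdorff (Ideal.span {(p : R)}) R] (g h : ℤ_[p] →+* R) : g = h := by
  ext x
  rw [← sub_eq_zero]
  apply IsHausdorff.haus (inferInstance : IsHausdorff (Ideal.span {(p : R)}) R)
  intro n
  rw [SModEq.zero, smul_eq_mul, Ideal.mul_top, Ideal.span_singleton_pow,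
    Ideal.mem_span_singleton]
  obtain ⟨r, hr⟩ := Ideal.mem_span_singleton.mp (PadicInt.appr_spec n x)
  have h1 : x = (PadicInt.appr x n : ℤ_[p]) + (p : ℤ_[p]) ^ n * r := by rw [← hr]; ring
  rw [h1]
  simp only [map_add, map_natCast, map_mul, map_pow, add_sub_add_left_eq_sub]
  rw [← mul_sub]
  exact dvd_mul_right _ _

variable [IsHausdorff (Ideal.span {(p : R)}) R]

/-- `σ_j : W → R` as a map of `ℤ_p`-algebras. -/
def sigmaAlg (j : ZMod f) : W p f →ₐ[ℤ_[p]] R :=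
  { sigmaR σ₀ R j with
    commutes' := fun x =>
      RingHom.congr_fun (padic_ringHom_ext R ((sigmaR σ₀ R j).comp (padicToW p f))
        (algebraMap ℤ_[p] R)) x }

/-- The `j`-th projection `W ⊗ R → R`, `w ⊗ r ↦ σ_j(w) r`. -/
def proj (j : ZMod f) : W p f ⊗[ℤ_[p]] R →ₐ[ℤ_[p]] R :=
  Algebra.TensorProduct.productMap (sigmaAlg σ₀ R j) (AlgHom.id ℤ_[p] R)

theorem proj_tmul (j : ZMod f) (w : W p f) (r : R) :
    proj σ₀ R j (w ⊗ₜ r) = sigmaR σ₀ R j w * r := rfl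

/-- The polynomial `∏ (X - σ_j(c))` over `W` is Frobenius-invariant, so it descends to `ℤ_p`, and it
kills `c`. In `W ⊗ R` its coefficients may be moved to the right factor, where it splits with roots
`1 ⊗ σ_j(c)`. -/
theorem prod_sub_eq_zero (c : W p f) :
    ∏ j : ZMod f, (c ⊗ₜ[ℤ_[p]] (1 : R) - (1 : W p f) ⊗ₜ[ℤ_[p]] sigmaR σ₀ R j c) = 0 := by
  let θ : ZMod f → W p f := fun j => sigma (RingHom.id (W p f)) j c
  let P : Polynomial (W p f) := ∏ j : ZMod f, (Polynomial.X - Polynomial.C (θ j))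
  have hP : P.map WittVector.frobenius = P := by
    simp only [P, Polynomial.map_prod, Polynomial.map_sub, Polynomial.map_X, Polynomial.map_C]
    refine Fintype.prod_equiv (Equiv.subRight 1) _ _ fun j => ?_
    congr 2
    have h1 := frobenius_sigma_succ (j - 1) c
    rw [sub_add_cancel] at h1
    exact h1
  have hlift : P ∈ Polynomial.lifts (padicToW p f) := by
    rw [Polynomial.lifts_iff_coeff_lifts]
    intro n
    apply exists_padicToW_of_frobenius_eq
    rw [← Polynomial.coeff_map, hP]
  obtain ⟨Q, hQ⟩ := (Polynomial.mem_lifts _).mp hlift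
  have hroot : P.eval c = 0 := by
    rw [Polynomial.eval_prod]
    refine Finset.prod_eq_zero (Finset.mem_univ (0 : ZMod f)) ?_
    have h1 : θ 0 = c := by
      have h2 := sigma_iterate (σ₀ := RingHom.id (W p f)) (0 : ZMod f) c
      rw [ZMod.val_zero] at h2
      exact h2
    rw [h1, Polynomial.eval_sub, Polynomial.eval_X, Polynomial.eval_C, sub_self]
  have h1 : Polynomial.eval₂ (algebraMap ℤ_[p] (W p f ⊗[ℤ_[p]] R)) (c ⊗ₜ[ℤ_[p]] (1 : R)) Q = 0 := by
    have h2 : algebraMap ℤ_[p] (W p f ⊗[ℤ_[p]] R) =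
        (Algebra.TensorProduct.includeLeft : W p f →ₐ[ℤ_[p]] W p f ⊗[ℤ_[p]] R).toRingHom.comp
          (padicToW p f) := rfl
    rw [h2, ← Polynomial.eval₂_map, hQ]
    have h3 := Polynomial.hom_eval₂ P (RingHom.id (W p f))
      (Algebra.TensorProduct.includeLeft : W p f →ₐ[ℤ_[p]] W p f ⊗[ℤ_[p]] R).toRingHom c
    rw [RingHom.comp_id] at h3
    refine h3.symm.trans ?_
    rw [show Polynomial.eval₂ (RingHom.id (W p f)) c P = 0 from hroot, map_zero]
  have h2 : algebraMap ℤ_[p] (W p f ⊗[ℤ_[p]] R) =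
      ((Algebra.TensorProduct.includeRight : R →ₐ[ℤ_[p]] W p f ⊗[ℤ_[p]] R).toRingHom.comp
        ((algebraMap O R).comp σ₀)).comp (padicToW p f) := by
    have h3 : ((algebraMap O R).comp σ₀).comp (padicToW p f) = algebraMap ℤ_[p] R :=
      padic_ringHom_ext R _ _
    rw [RingHom.comp_assoc, h3]
    ext x
    exact ((Algebra.TensorProduct.includeRight : R →ₐ[ℤ_[p]] W p f ⊗[ℤ_[p]] R).commutes x).symm
  rw [h2, ← Polynomial.eval₂_map, hQ, Polynomial.eval₂_finsetProd] at h1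
  rw [← h1]
  refine Finset.prod_congr rfl fun j _ => ?_
  rw [Polynomial.eval₂_sub, Polynomial.eval₂_X, Polynomial.eval₂_C]
  rfl

/-- Chinese remainders: for a Teichmüller generator `ζ` the elements `t_j = ζ ⊗ 1 - 1 ⊗ σ_j(ζ)`
differ by units, hence are pairwise coprime, and their product vanishes. In the resulting partition
of unity `t_j` kills `e_j`, so `ζ` acts on `e_j` through `σ_j`. -/
theorem exists_idempotents : ∃ e : ZMod f → W p f ⊗[ℤ_[p]] R, ∑ j, e j = 1 ∧
    ∀ j z, z * e j = (1 : W p f) ⊗ₜ[ℤ_[p]] proj σ₀ R j z * e j := by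
  classical
  have : Fintype (GaloisField p f) := Fintype.ofFinite _
  obtain ⟨c, hgen, hc⟩ := exists_generator p f
  set ζ : W p f := WittVector.teichmuller p (c : GaloisField p f) with hζ
  let t : ZMod f → W p f ⊗[ℤ_[p]] R := fun j =>
    ζ ⊗ₜ[ℤ_[p]] (1 : R) - (1 : W p f) ⊗ₜ[ℤ_[p]] sigmaR σ₀ R j ζ
  have hcop : Pairwise (Function.onFun IsCoprime t) := by
    intro i j hij
    have h1 := sigma_sub_sigma_isUnit hc ((algebraMap O R).comp σ₀) hij
    rw [← hζ] at h1
    obtain ⟨w, hw⟩ := h1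
    refine ⟨-((1 : W p f) ⊗ₜ[ℤ_[p]] ((w⁻¹ : Rˣ) : R)), (1 : W p f) ⊗ₜ[ℤ_[p]] ((w⁻¹ : Rˣ) : R), ?_⟩
    have h2 : t j - t i = (1 : W p f) ⊗ₜ[ℤ_[p]] (w : R) := by
      simp only [t, hw, sub_sub_sub_cancel_left, ← TensorProduct.tmul_sub]
      rfl
    calc _ = (1 : W p f) ⊗ₜ[ℤ_[p]] ((w⁻¹ : Rˣ) : R) * (t j - t i) := by ring
      _ = 1 := by
        rw [h2, Algebra.TensorProduct.tmul_mul_tmul, Units.inv_mul, one_mul]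
        rfl
  obtain ⟨μ, hμ⟩ := exists_sum_eq_one_iff_pairwise_coprime'.mpr hcop
  refine ⟨fun j => μ j * ∏ i ∈ {j}ᶜ, t i, hμ, fun j z => ?_⟩
  set e : W p f ⊗[ℤ_[p]] R := μ j * ∏ i ∈ {j}ᶜ, t i with he
  have hζe : ζ ⊗ₜ[ℤ_[p]] (1 : R) * e = (1 : W p f) ⊗ₜ[ℤ_[p]] sigmaR σ₀ R j ζ * e := by
    rw [← sub_eq_zero, ← sub_mul, he]
    change t j * _ = 0
    rw [mul_left_comm, ← Finset.prod_singleton t j, mul_comm (∏ x ∈ {j}, t x),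
      Finset.prod_compl_mul_prod, prod_sub_eq_zero, mul_zero]
  have hpow : ∀ m : ℕ, (ζ ^ m) ⊗ₜ[ℤ_[p]] (1 : R) * e =
      (1 : W p f) ⊗ₜ[ℤ_[p]] sigmaR σ₀ R j (ζ ^ m) * e := by
    intro m
    induction m with
    | zero => simp
    | succ m ih =>
      have h1 : (ζ ^ (m + 1)) ⊗ₜ[ℤ_[p]] (1 : R) = (ζ ^ m) ⊗ₜ[ℤ_[p]] (1 : R) * ζ ⊗ₜ[ℤ_[p]] (1 : R) := by
        rw [Algebra.TensorProduct.tmul_mul_tmul, one_mul, pow_succ]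
      have h2 : (1 : W p f) ⊗ₜ[ℤ_[p]] sigmaR σ₀ R j (ζ ^ (m + 1)) =
          (1 : W p f) ⊗ₜ[ℤ_[p]] sigmaR σ₀ R j (ζ ^ m) * (1 : W p f) ⊗ₜ[ℤ_[p]] sigmaR σ₀ R j ζ := by
        rw [Algebra.TensorProduct.tmul_mul_tmul, one_mul, ← map_mul, pow_succ]
      rw [h1, h2, mul_assoc, hζe, mul_left_comm, ih]
      ring
  have hteich : ∀ a : GaloisField p f, (WittVector.teichmuller p a : W p f) ⊗ₜ[ℤ_[p]] (1 : R) * e =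
      (1 : W p f) ⊗ₜ[ℤ_[p]] sigmaR σ₀ R j (WittVector.teichmuller p a) * e := by
    intro a
    rcases eq_or_ne a 0 with rfl | ha
    · rw [WittVector.teichmuller_zero, map_zero, TensorProduct.zero_tmul, TensorProduct.tmul_zero]
    · obtain ⟨m, hm⟩ := (isOfFinOrder_of_finite c).mem_powers_iff_mem_zpowers.mpr
        (hgen (Units.mk0 a ha))
      have h1 : a = (c : GaloisField p f) ^ m := by
        have h2 := congrArg Units.val hm
        simpa using h2.symm
      rw [h1, map_pow]
      exact hpow m
  -- Powers of `ζ` and 0 exhaust the Teichmüller elements, and these span `W` over `ℤ_p`.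
  have hW : ∀ w : W p f, w ⊗ₜ[ℤ_[p]] (1 : R) * e =
      (1 : W p f) ⊗ₜ[ℤ_[p]] sigmaR σ₀ R j w * e := by
    intro w
    obtain ⟨d, rfl⟩ := exists_sum_smul_teichmuller w
    have h1 : sigmaR σ₀ R j (∑ a, d a • (WittVector.teichmuller p a : W p f)) =
        ∑ a, d a • sigmaR σ₀ R j (WittVector.teichmuller p a) := by
      change sigmaAlg σ₀ R j _ = ∑ a, d a • sigmaAlg σ₀ R j _
      rw [map_sum]
      simp_rw [map_smul]
    rw [h1, TensorProduct.sum_tmul, TensorProduct.tmul_sum, Finset.sum_mul, Finset.sum_mul]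
    refine Finset.sum_congr rfl fun a _ => ?_
    rw [← TensorProduct.smul_tmul', TensorProduct.tmul_smul, smul_mul_assoc, smul_mul_assoc, hteich]
  induction z using TensorProduct.induction_on with
  | zero => simp
  | tmul w r =>
    have h1 : w ⊗ₜ[ℤ_[p]] r = w ⊗ₜ[ℤ_[p]] (1 : R) * (1 : W p f) ⊗ₜ[ℤ_[p]] r := by
      rw [Algebra.TensorProduct.tmul_mul_tmul, one_mul, mul_one]
    have h2 : (1 : W p f) ⊗ₜ[ℤ_[p]] proj σ₀ R j (w ⊗ₜ r) =
        (1 : W p f) ⊗ₜ[ℤ_[p]] sigmaR σ₀ R j w * (1 : W p f) ⊗ₜ[ℤ_[p]] r := by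
      rw [Algebra.TensorProduct.tmul_mul_tmul, one_mul, proj_tmul]
    rw [h1, ← h1, h2, h1]
    linear_combination (1 : W p f) ⊗ₜ[ℤ_[p]] r * hW w
  | add x y hx hy =>
    rw [add_mul, hx, hy, map_add, TensorProduct.tmul_add, add_mul]

end Coefficients

end Witt

/-! ### The Galois group of `L / K` -/

section Galois

variable {p f : ℕ} [hp : Fact p.Prime] [NeZero f]

theorem irreducible_X_pow_add_p :
    Irreducible (Polynomial.X ^ ee p f + Polynomial.C (p : K p f)) := by
  have he := ee_ne_zero p f
  have hirr : Irreducible (p : W p f) := WittVector.irreducible p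
  set P : Polynomial (W p f) := Polynomial.X ^ ee p f + Polynomial.C (p : W p f) with hP
  have hmonic : P.Monic := Polynomial.monic_X_pow_add_C _ he
  have hdeg : P.natDegree = ee p f := Polynomial.natDegree_X_pow_add_C
  have hEis : P.IsEisensteinAt (Ideal.span {(p : W p f)}) := by
    refine ⟨?_, ?_, ?_⟩
    · rw [hmonic.leadingCoeff, Ideal.mem_span_singleton]
      exact fun h => hirr.not_isUnit (isUnit_of_dvd_one h)
    · intro n hn
      rw [hdeg] at hn
      rw [hP, Polynomial.coeff_add, Polynomial.coeff_X_pow, if_neg (by omega), zero_add,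
        Polynomial.coeff_C, Ideal.mem_span_singleton]
      split_ifs
      · exact dvd_rfl
      · exact dvd_zero _
    · rw [hP, Polynomial.coeff_add, Polynomial.coeff_X_pow, if_neg (Ne.symm he), zero_add,
        Polynomial.coeff_C_zero, Ideal.span_singleton_pow, Ideal.mem_span_singleton]
      rintro ⟨r, hr⟩
      apply hirr.not_isUnit
      refine IsUnit.of_mul_eq_one r ?_
      apply mul_left_cancel₀ hirr.ne_zero
      linear_combination -hr
  have h1 : Irreducible P := by
    refine hEis.irreducible ?_ hmonic.isPrimitive (by omega)
    rw [Ideal.span_singleton_prime hirr.ne_zero]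
    exact hirr.prime
  rw [hmonic.irreducible_iff_irreducible_map_fraction_map (K := K p f)] at h1
  simpa [hP] using h1

theorem minpoly_gen (π : Unif p f) :
    minpoly (K p f) (gen π) = Polynomial.X ^ ee p f + Polynomial.C (p : K p f) := by
  symm
  refine minpoly.eq_of_irreducible_of_monic irreducible_X_pow_add_p ?_
    (Polynomial.monic_X_pow_add_C _ (ee_ne_zero p f))
  rw [map_add, map_pow, Polynomial.aeval_X, Polynomial.aeval_C, gen_pow, map_natCast]
  exact neg_add_cancel _

/-- `u^e + p` is irreducible and has the root `ζ π` for every `e`-th root of unity `ζ`, so `π ↦ ζ π`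
is an automorphism. `Δ` is thus large enough to detect exponents of `u` modulo `e`. -/
theorem exists_omegaPi_eq (π : Unif p f) (c : (GaloisField p f)ˣ) :
    ∃ g : Delta π, (omegaPi π g : W p f) = WittVector.teichmuller p (c : GaloisField p f) := by
  have hroot : Polynomial.aeval (gen π) (Polynomial.X ^ ee p f + Polynomial.C (p : K p f)) = 0 := by
    rw [← minpoly_gen π, minpoly.aeval]
  have hint : IsIntegral (K p f) (π : AlgebraicClosure (K p f)) :=
    Algebra.IsIntegral.isIntegral _
  have hcpow : (WtoL π (WittVector.teichmuller p (c : GaloisField p f))) ^ ee p f = 1 := by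
    have h1 : c ^ ee p f = 1 := by
      have h2 : Nat.card (GaloisField p f)ˣ = ee p f := by
        have : Fintype (GaloisField p f) := Fintype.ofFinite _
        rw [Nat.card_units, GaloisField.card p f (NeZero.ne f)]
        rfl
      rw [← h2, pow_card_eq_one']
    rw [← map_pow, ← map_pow, ← Units.val_pow_eq_pow_val, h1, Units.val_one, map_one, map_one]
  let pb := IntermediateField.adjoin.powerBasis hint
  have hpb : pb.gen = gen π := IntermediateField.adjoin.powerBasis_gen hint
  have hy : Polynomial.aeval (WtoL π (WittVector.teichmuller p (c : GaloisField p f)) * gen π)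
      (minpoly (K p f) pb.gen) = 0 := by
    rw [hpb, minpoly_gen, map_add, map_pow, Polynomial.aeval_X, mul_pow, hcpow, one_mul,
      Polynomial.aeval_C]
    rwa [map_add, map_pow, Polynomial.aeval_X, Polynomial.aeval_C] at hroot
  have : FiniteDimensional (K p f) (L π) := pb.finite
  refine ⟨AlgEquiv.ofBijective (pb.lift _ hy) (AlgHom.bijective _), ?_⟩
  apply WtoL_injective π
  apply mul_right_cancel₀ (gen_ne_zero π)
  refine (exists_ratio π _).choose_spec.trans ?_
  have h2 := pb.lift_gen _ hy
  rw [hpb] at h2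
  exact h2

end Galois

/-! ### The matrices of a Kisin module -/

section KisinModules

variable {p f : ℕ} [hp : Fact p.Prime] [NeZero f] {O : Type*} [CommRing O]
  {σ₀ : W p f →+* O} {R : Type*} [CommRing R] [Algebra ℤ_[p] R] [Algebra O R]
  {M : Type*} [AddCommGroup M] [Module (SR p f R) M]

/-! ### The action of `(W ⊗ R)⟦u⟧` on the components `M^{(j)}`. -/

section Components

variable [IsHausdorff (Ideal.span {(p : R)}) R]

theorem mul_C_idempotent {j : ZMod f} {e : W p f ⊗[ℤ_[p]] R}
    (he : ∀ z, z * e = (1 : W p f) ⊗ₜ[ℤ_[p]] proj σ₀ R j z * e) (F : SR p f R) :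
    F * PowerSeries.C e =
      incl p f R (PowerSeries.map (proj σ₀ R j : W p f ⊗[ℤ_[p]] R →+* R) F) * PowerSeries.C e := by
  ext m
  rw [PowerSeries.coeff_mul_C, PowerSeries.coeff_mul_C, he]
  rfl

theorem ofW_mul_C_idempotent {j : ZMod f} {e : W p f ⊗[ℤ_[p]] R}
    (he : ∀ z, z * e = (1 : W p f) ⊗ₜ[ℤ_[p]] proj σ₀ R j z * e) (x : W p f) :
    ofW p f R x * PowerSeries.C e = ofR p f (sigmaR σ₀ R j x) * PowerSeries.C e := by
  rw [mul_C_idempotent he, ofW, PowerSeries.map_C, ofR]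
  congr 3
  change proj σ₀ R j (x ⊗ₜ 1) = _
  rw [proj_tmul, mul_one]

theorem C_idempotent_smul_mem {j : ZMod f} {e : W p f ⊗[ℤ_[p]] R}
    (he : ∀ z, z * e = (1 : W p f) ⊗ₜ[ℤ_[p]] proj σ₀ R j z * e) (m : M) :
    (PowerSeries.C e : SR p f R) • m ∈ component σ₀ R M j := by
  intro x
  rw [smul_smul, smul_smul, ofW_mul_C_idempotent he]
  rfl

/-- On `e_i m` a Teichmüller generator acts both as `σ_i(ζ)` and as `σ_j(ζ)`, and the difference of
these is a unit. -/
theorem C_idempotent_smul_of_ne {i j : ZMod f} (hij : i ≠ j) {e : W p f ⊗[ℤ_[p]] R}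
    (he : ∀ z, z * e = (1 : W p f) ⊗ₜ[ℤ_[p]] proj σ₀ R i z * e) {m : M}
    (hm : m ∈ component σ₀ R M j) : (PowerSeries.C e : SR p f R) • m = 0 := by
  obtain ⟨c, -, hc⟩ := exists_generator p f
  obtain ⟨w, hw⟩ := sigma_sub_sigma_isUnit hc ((algebraMap O R).comp σ₀) hij
  set ζ : W p f := WittVector.teichmuller p (c : GaloisField p f)
  have h1 : ofR p f (sigmaR σ₀ R i ζ) • (PowerSeries.C e : SR p f R) • m =
      ofR p f (sigmaR σ₀ R j ζ) • (PowerSeries.C e : SR p f R) • m := by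
    rw [smul_smul, ← ofW_mul_C_idempotent he, mul_comm, ← smul_smul, hm ζ, smul_comm]
    rfl
  have h2 : ofR p f (w : R) • (PowerSeries.C e : SR p f R) • m = 0 := by
    rw [hw]
    change ofR p f (sigmaR σ₀ R i ζ - sigmaR σ₀ R j ζ) • _ = _
    rw [ofR, map_sub, map_sub, sub_smul, sub_eq_zero]
    exact h1
  have h3 : ofR p f ((w⁻¹ : Rˣ) : R) * ofR p f (w : R) = 1 := by
    rw [ofR, ofR, ← map_mul, ← map_mul, Units.inv_mul, map_one, map_one]
  rw [← one_smul (SR p f R) ((PowerSeries.C e : SR p f R) • m), ← h3, ← smul_smul, h2, smul_zero]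

theorem C_idempotent_smul_self {e : ZMod f → W p f ⊗[ℤ_[p]] R} (hsum : ∑ j, e j = 1)
    (he : ∀ j z, z * e j = (1 : W p f) ⊗ₜ[ℤ_[p]] proj σ₀ R j z * e j) {j : ZMod f} {m : M}
    (hm : m ∈ component σ₀ R M j) : (PowerSeries.C (e j) : SR p f R) • m = m := by
  have h1 : (PowerSeries.C (∑ j, e j) : SR p f R) • m = m := by
    rw [hsum, map_one, one_smul]
  rw [map_sum, Finset.sum_smul, Finset.sum_eq_single j] at h1
  · exact h1
  · intro i _ hij
    exact C_idempotent_smul_of_ne hij (he i) hm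
  · intro h
    exact absurd (Finset.mem_univ j) h

/-- On `M^{(j)}` multiplication by `e_j` is the identity, and on `e_j` every scalar equals its
`j`-th projection. -/
theorem smul_eq_incl_smul {j : ZMod f} {m : M} (hm : m ∈ component σ₀ R M j) (F : SR p f R) :
    F • m = incl p f R (PowerSeries.map (proj σ₀ R j : W p f ⊗[ℤ_[p]] R →+* R) F) • m := by
  obtain ⟨e, hsum, he⟩ := exists_idempotents σ₀ R
  conv_lhs => rw [← C_idempotent_smul_self hsum he hm]
  rw [smul_smul, mul_C_idempotent (he j), ← smul_smul, C_idempotent_smul_self hsum he hm]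

theorem gHat_incl_smul {π : Unif p f} (g : Delta π) {j : ZMod f} {m : M}
    (hm : m ∈ component σ₀ R M j) (F : R⟦X⟧) : gHat R π g (incl p f R F) • m =
      incl p f R (PowerSeries.rescale (sigmaR σ₀ R j (omegaPi π g)) F) • m := by
  rw [smul_eq_incl_smul hm]
  congr 2
  ext i
  rw [gHat, PowerSeries.coeff_map, PowerSeries.coeff_rescale, PowerSeries.coeff_rescale, incl,
    PowerSeries.coeff_map, map_mul, map_pow]
  change proj σ₀ R j _ ^ i * proj σ₀ R j ((1 : W p f) ⊗ₜ _) = _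
  rw [proj_tmul, proj_tmul, mul_one, map_one, one_mul]

end Components

variable {π : Unif p f} {η : Fin 3 → Delta π →* Oˣ} {h : ℕ}
  {𝔐 : KisinModule σ₀ π η h R M} (β : Eigenbasis 𝔐)

theorem frob_vec (j : ZMod f) (l : Fin 3) :
    𝔐.frob (β.vec j l) = ∑ k, incl p f R (frobMatrix β j k l) • β.vec (j + 1) k :=
  (β.isBasis (j + 1) (𝔐.frob (β.vec j l)) (frob_mem 𝔐 j (β.mem j l))).choose_spec.1

theorem Eigenbasis.coord_ext {j : ZMod f} {c c' : Fin 3 → R⟦X⟧}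
    (h : ∑ k, incl p f R (c k) • β.vec j k = ∑ k, incl p f R (c' k) • β.vec j k) : c = c' :=
  (β.isBasis j _ (sum_mem fun k _ => (component σ₀ R M j).smul_mem _ (β.mem j k))).unique
    (y₁ := c) rfl h

theorem frobS_incl (F : R⟦X⟧) : frobS p f R (incl p f R F) =
    incl p f R (PowerSeries.expand p (p_ne_zero p) F) := by
  rw [incl, PowerSeries.map_expand]
  change PowerSeries.expand p (p_ne_zero p) _ = _
  congr 1
  ext m
  simp [frobW]

theorem incl_X_pow (m : ℕ) : incl p f R (PowerSeries.X ^ m) = PowerSeries.X ^ m := by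
  rw [map_pow, incl, PowerSeries.map_X]

/-- The matrix of `φ` divides `E(u) ^ h`. -/
theorem exists_mul_eq_Eis_pow [IsHausdorff (Ideal.span {(p : R)}) R] (j : ZMod f) :
    ∃ D, frobMatrix β j * D = Matrix.scalar (Fin 3) (Eis p f R ^ h) := by
  obtain ⟨e, hsum, he⟩ := exists_idempotents σ₀ R
  -- Since `e_{j+1} φ(x) = φ(e_j x)`, the `(j+1)`-component of the span of the image of `φ` consists
  -- of combinations of the columns of `C^{(j)}`. The height condition then expresses `E^h` times
  -- each basis vector in this way.
  have hspan : ∀ m ∈ Submodule.span (SR p f R) (Set.range 𝔐.frob), ∃ c : Fin 3 → R⟦X⟧,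
      (PowerSeries.C (e (j + 1)) : SR p f R) • m =
        ∑ k, incl p f R ((frobMatrix β j).mulVec c k) • β.vec (j + 1) k := by
    intro m hm
    induction hm using Submodule.span_induction with
    | mem m hm =>
      obtain ⟨x, rfl⟩ := hm
      have hx : x = ∑ i, (PowerSeries.C (e i) : SR p f R) • x := by
        rw [← Finset.sum_smul, ← map_sum, hsum, map_one, one_smul]
      have h1 : (PowerSeries.C (e (j + 1)) : SR p f R) • 𝔐.frob x =
          𝔐.frob ((PowerSeries.C (e j) : SR p f R) • x) := by
        conv_lhs => rw [hx, map_sum, Finset.smul_sum]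
        rw [Finset.sum_eq_single j]
        · exact C_idempotent_smul_self hsum he (frob_mem 𝔐 j (C_idempotent_smul_mem (he j) x))
        · intro i _ hi
          exact C_idempotent_smul_of_ne (fun h => hi (add_right_cancel h).symm) (he (j + 1))
            (frob_mem 𝔐 i (C_idempotent_smul_mem (he i) x))
        · intro h
          exact absurd (Finset.mem_univ j) h
      obtain ⟨c, hc, -⟩ := β.isBasis j _ (C_idempotent_smul_mem (he j) x)
      refine ⟨fun l => PowerSeries.expand p (p_ne_zero p) (c l), ?_⟩
      rw [h1, hc, map_sum]
      simp_rw [map_smulₛₗ, frobS_incl, frob_vec, Finset.smul_sum, smul_smul]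
      rw [Finset.sum_comm]
      refine Finset.sum_congr rfl fun k _ => ?_
      rw [← Finset.sum_smul, Matrix.mulVec, dotProduct, map_sum]
      congr 1
      refine Finset.sum_congr rfl fun l _ => ?_
      rw [map_mul, mul_comm]
    | zero => exact ⟨0, by simp⟩
    | add x y _ _ hx hy =>
      obtain ⟨c, hc⟩ := hx
      obtain ⟨d, hd⟩ := hy
      refine ⟨c + d, ?_⟩
      rw [smul_add, hc, hd, ← Finset.sum_add_distrib, Matrix.mulVec_add]
      refine Finset.sum_congr rfl fun k _ => ?_
      rw [Pi.add_apply, map_add, add_smul]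
    | smul F x _ hx =>
      obtain ⟨c, hc⟩ := hx
      refine ⟨PowerSeries.map (proj σ₀ R (j + 1) : W p f ⊗[ℤ_[p]] R →+* R) F • c, ?_⟩
      rw [smul_comm, smul_eq_incl_smul (C_idempotent_smul_mem (he (j + 1)) x), hc,
        Finset.smul_sum, Matrix.mulVec_smul]
      refine Finset.sum_congr rfl fun k _ => ?_
      rw [Pi.smul_apply, smul_eq_mul, map_mul, smul_smul]
  choose c hc using fun l => hspan _ (𝔐.height (β.vec (j + 1) l))
  refine ⟨Matrix.of fun k l => c l k, ?_⟩
  have hEis : Eis p f (W p f ⊗[ℤ_[p]] R) ^ h = incl p f R (Eis p f R ^ h) := by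
    rw [map_pow, Eis, Eis, map_add, incl_X_pow, map_natCast]
  refine Matrix.ext fun k l => ?_
  have h1 : (fun k => (frobMatrix β j).mulVec (c l) k) =
      fun k => Matrix.scalar (Fin 3) (Eis p f R ^ h) k l := by
    apply β.coord_ext (j := j + 1)
    rw [← hc l, smul_comm, C_idempotent_smul_self hsum he (β.mem (j + 1) l), hEis,
      Finset.sum_eq_single l]
    · simp
    · intro k _ hk
      simp [Matrix.diagonal_apply_ne _ hk]
    · intro h
      exact absurd (Finset.mem_univ l) h
  exact congrFun h1 k

/-- The matrix of `φ` commutes with the descent datum. -/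
theorem coeff_frobMatrix_mul [IsHausdorff (Ideal.span {(p : R)}) R] (j : ZMod f) (g : Delta π)
    (k l : Fin 3) (m : ℕ) :
    algebraMap O R (η l g) * PowerSeries.coeff m (frobMatrix β j k l) =
      sigmaR σ₀ R (j + 1) (omegaPi π g) ^ m * PowerSeries.coeff m (frobMatrix β j k l) *
        algebraMap O R (η k g) := by
  have h1 : (fun k => PowerSeries.C (algebraMap O R (η l g)) * frobMatrix β j k l) =
      fun k => PowerSeries.rescale (sigmaR σ₀ R (j + 1) (omegaPi π g)) (frobMatrix β j k l) *
        PowerSeries.C (algebraMap O R (η k g)) := by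
    apply β.coord_ext (j := j + 1)
    have h2 := 𝔐.dd_frob g (β.vec j l)
    rw [β.eigen, frob_vec, map_smulₛₗ, frob_vec, map_sum] at h2
    simp_rw [𝔐.dd_smul, β.eigen] at h2
    rw [ofR, frobS_incl, PowerSeries.expand_C, Finset.smul_sum] at h2
    simp_rw [smul_smul] at h2
    simp_rw [map_mul]
    rw [← h2]
    refine Finset.sum_congr rfl fun i _ => ?_
    rw [mul_comm, ← smul_smul, gHat_incl_smul g (β.mem _ _), smul_smul, mul_comm]
    rfl
  have h2 := congrArg (PowerSeries.coeff m) (congrFun h1 k)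
  rw [PowerSeries.coeff_C_mul, PowerSeries.coeff_mul_C, PowerSeries.coeff_rescale] at h2
  exact h2

/-- `p_mul_digitSum` iterated modulo `e`. The characters `η_k` are defined with `𝐚_k^{(0)}` and
`σ_0`; this rewrites them with `𝐚_k^{(j)}` and `σ_j`. -/
theorem digitSum_natCast_modEq (a : Fin 3 → ZMod f → ℕ) (k : Fin 3) (m : ℕ) :
    digitSum p a (m : ZMod f) k ≡ p ^ m * digitSum p a 0 k [MOD ee p f] := by
  induction m with
  | zero => simp [Nat.ModEq.rfl]
  | succ m ih =>
    have h1 := p_mul_digitSum (p := p) (a := a) (m : ZMod f) k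
    rw [← Nat.cast_succ] at h1
    have h2 := ih.mul_left p
    rw [h1, ← mul_assoc, ← pow_succ'] at h2
    exact (Nat.ModEq.symm (by simp [Nat.ModEq])).trans h2

/-! ### The exponents of `u` allowed by the tame type. -/

section TameType

variable {a : Fin 3 → ZMod f → ℕ} [IsHausdorff (Ideal.span {(p : R)}) R]
  {𝔑 : KisinModule σ₀ π (tameType σ₀ π a) h R M} (γ : Eigenbasis 𝔑)

/-- An element `g` with `ω_π(g) = ζ^{p^J}` satisfies `σ_{j+1}(ω_π(g)) = σ_0(ζ)`. Comparing the
action of `g` on both sides of the matrix equation multiplies the coefficient of `u^m` by a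
difference of two powers of `σ_0(ζ)`, a unit unless the exponents agree modulo `e`. -/
theorem hasTwistedSupport_frobMatrix
    (hlt : ∀ j k l, digitSum p a j k < digitSum p a j l + ee p f) (j : ZMod f) :
    HasTwistedSupport p f (digitSum p a (j + 1)) (frobMatrix γ j) := by
  intro k l m hm
  obtain ⟨c, -, hc⟩ := exists_generator p f
  set J := (j + 1).val with hJ
  obtain ⟨g, hg⟩ := exists_omegaPi_eq π (c ^ p ^ J)
  let ρ : W p f →+* R := (algebraMap O R).comp σ₀
  set ζ : W p f := WittVector.teichmuller p (c : GaloisField p f)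
  have hω : (omegaPi π g : W p f) = ζ ^ p ^ J := by
    rw [hg, Units.val_pow_eq_pow_val, map_pow]
  have hσ : sigmaR σ₀ R (j + 1) (omegaPi π g) = ρ ζ := by
    rw [hω, ← map_pow, ← frobenius_iterate_teichmuller]
    exact sigma_iterate (σ₀ := ρ) (j + 1) ζ
  have hη : ∀ k, algebraMap O R (tameType σ₀ π a k g) * ρ ζ ^ (p ^ J * digitSum p a 0 k) = 1 := by
    intro k
    have h1 : (tameType σ₀ π a k g) * (Units.map (σ₀ : W p f →* O) (omegaPi π g)) ^
        digitSum p a 0 k = 1 := by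
      change (Units.map (σ₀ : W p f →* O) (omegaPi π g)) ^ (-(digitSum p a 0 k : ℤ)) * _ = 1
      rw [zpow_neg, zpow_natCast, inv_mul_cancel]
    have h2 := congrArg (fun x : Oˣ => algebraMap O R x) h1
    simp only [Units.val_mul, Units.val_pow_eq_pow_val, Units.val_one, map_mul, map_one,
      map_pow, Units.coe_map, MonoidHom.coe_coe] at h2
    rw [hω, map_pow, map_pow, ← pow_mul] at h2
    exact h2
  have hcoeff := coeff_frobMatrix_mul γ j g k l m
  rw [hσ] at hcoeff
  set x := PowerSeries.coeff m (frobMatrix γ j k l)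
  have hx : (ρ ζ ^ (p ^ J * digitSum p a 0 k) - ρ ζ ^ (m + p ^ J * digitSum p a 0 l)) * x = 0 := by
    rw [pow_add]
    linear_combination (ρ ζ ^ (p ^ J * digitSum p a 0 k) * ρ ζ ^ (p ^ J * digitSum p a 0 l)) *
      hcoeff - ρ ζ ^ (p ^ J * digitSum p a 0 k) * x * hη l +
      ρ ζ ^ m * ρ ζ ^ (p ^ J * digitSum p a 0 l) * x * hη k
  have hmod : p ^ J * digitSum p a 0 k ≡ m + p ^ J * digitSum p a 0 l [MOD ee p f] := by
    by_contra h1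
    have h2 := (teichmuller_pow_sub_isUnit hc h1).map ρ
    rw [map_sub, map_pow, map_pow] at h2
    exact hm (h2.mul_right_eq_zero.mp hx)
  have hcast : ((J : ℕ) : ZMod f) = j + 1 := ZMod.natCast_zmod_val _
  have hb : ∀ k, digitSum p a (j + 1) k ≡ p ^ J * digitSum p a 0 k [MOD ee p f] := by
    intro k
    have := digitSum_natCast_modEq (p := p) a k J
    rwa [hcast] at this
  have hmod' : digitSum p a (j + 1) k ≡ m + digitSum p a (j + 1) l [MOD ee p f] :=
    ((hb k).trans hmod).trans ((hb l).symm.add_left m)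
  have hlt' := hlt (j + 1) k l
  -- A congruence modulo `e` would permit a negative multiple of `e`; it is excluded since the
  -- exponents differ by less than `e`.
  have hle : digitSum p a (j + 1) k ≤ m + digitSum p a (j + 1) l := by
    by_contra h1
    push Not at h1
    have h2 := Nat.le_of_dvd (by omega) ((Nat.modEq_iff_dvd' h1.le).mp hmod'.symm)
    omega
  obtain ⟨t, ht⟩ := (Nat.modEq_iff_dvd' hle).mp hmod'
  exact ⟨t, by omega⟩

end TameType

/-- The two conditions differ by the common factor `u^b` with `b = 𝐚^{(j+1)}_{s_{j+1}(3)}`. The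
orientation makes this exponent minimal, so the subtractions defining `d_k` do not truncate. -/
theorem isIsotypicMatrix_iff {a : Fin 3 → ZMod f → ℕ} {s : ZMod f → Equiv.Perm (Fin 3)}
    (hs : IsOrientation p a s) {A : ZMod f → Matrix (Fin 3) (Fin 3) R⟦X⟧} :
    IsIsotypicMatrix β a s A ↔
      ∀ j, RemovesDescent p (f := f) (digitSum p a (j + 1)) (s (j + 1)) (frobMatrix β j) (A j) := by
  unfold IsIsotypicMatrix RemovesDescent
  refine forall_congr' fun j => ?_
  rw [forall_comm]
  refine forall_congr' fun l => ?_
  have hd : ∀ k, digitSum p a (j + 1) (s (j + 1) k) = (digitSum p a (j + 1) (s (j + 1) k) -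
      digitSum p a (j + 1) (s (j + 1) 2)) + digitSum p a (j + 1) (s (j + 1) 2) := by
    intro k
    have h1 := hs (j + 1)
    have h2 : digitSum p a (j + 1) (s (j + 1) 2) ≤ digitSum p a (j + 1) (s (j + 1) k) := by
      fin_cases k
      · exact h1.2.trans h1.1
      · exact h1.2
      · exact le_rfl
    omega
  set b : Fin 3 → ℕ := fun k => digitSum p a (j + 1) (s (j + 1) k) with hb
  set d : Fin 3 → ℕ := fun k => digitSum p a (j + 1) (s (j + 1) k) -
    digitSum p a (j + 1) (s (j + 1) 2) with hd'
  have h1 : (PowerSeries.X : SR p f R) ^ d l • 𝔐.frob (β.vec j (s (j + 1) l)) =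
      ∑ k, incl p f R (PowerSeries.X ^ d l * frobMatrix β j k (s (j + 1) l)) •
        β.vec (j + 1) k := by
    rw [frob_vec, Finset.smul_sum]
    simp_rw [smul_smul, map_mul, incl_X_pow]
  have h2 : ∑ k, incl p f R (PowerSeries.expand (ee p f) (ee_ne_zero p f) (A j k l)) •
        ((PowerSeries.X : SR p f R) ^ d k • β.vec (j + 1) (s (j + 1) k)) =
      ∑ k, incl p f R (PowerSeries.expand (ee p f) (ee_ne_zero p f)
        (A j ((s (j + 1)).symm k) l) * PowerSeries.X ^ d ((s (j + 1)).symm k)) •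
          β.vec (j + 1) k := by
    symm
    rw [← Equiv.sum_comp (s (j + 1))]
    refine Finset.sum_congr rfl fun k _ => ?_
    rw [Equiv.symm_apply_apply, smul_smul, map_mul, incl_X_pow]
  change (_ = _) ↔ _
  rw [h1, h2]
  constructor
  · intro h k
    have h3 := congrFun (β.coord_ext h) (s (j + 1) k)
    simp only [Equiv.symm_apply_apply] at h3
    rw [hd l, hd k, pow_add, pow_add]
    linear_combination PowerSeries.X ^ digitSum p a (j + 1) (s (j + 1) 2) * h3
  · intro h
    refine Finset.sum_congr rfl fun k _ => ?_
    have h3 := h ((s (j + 1)).symm k)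
    rw [hd l, hd ((s (j + 1)).symm k), pow_add, pow_add, Equiv.apply_symm_apply] at h3
    congr 2
    apply PowerSeries.X_pow_mul_cancel (k := digitSum p a (j + 1) (s (j + 1) 2))
    simp only [hd', Equiv.apply_symm_apply]
    linear_combination h3

end KisinModules

/-! ### The monodromy matrices -/

section Monodromy

variable {p f : ℕ} [hp : Fact p.Prime] [NeZero f]

/-! ### Uniqueness and inverses of twists, the operator `-u d/du`, and `u`-adic divisibility. -/

section Inverse

variable {T : Type*} [CommRing T] {b : Fin 3 → ℕ} {D B B' : Matrix (Fin 3) (Fin 3) T⟦X⟧}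

theorem IsTwist.unique (h : IsTwist p f b D B) (h' : IsTwist p f b D B') : B = B' := by
  have h1 := diagX_mul_left_injective (h.symm.trans h')
  refine Matrix.ext fun k l => ?_
  exact expand_injective (ee_ne_zero p f) (congrFun (congrFun h1 k) l)

/-- The diagonal matrix is not invertible, but its determinant is a power of `u` and cancels. -/
theorem IsTwist.det_eq (h : IsTwist p f b D B) :
    D.det = PowerSeries.expand (ee p f) (ee_ne_zero p f) B.det := by
  have h1 := congrArg Matrix.det h
  rw [Matrix.det_mul, Matrix.det_mul, mul_comm, diagX, Matrix.det_diagonal,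
    Finset.prod_pow_eq_pow_sum] at h1
  rw [PowerSeries.X_pow_mul_cancel h1]
  exact (RingHom.map_det
    (PowerSeries.expand (R := T) (ee p f) (ee_ne_zero p f)).toRingHom B).symm

theorem IsTwist.isUnit_det (h : IsTwist p f b D B) (hD : IsUnit D.det) : IsUnit B.det := by
  rw [PowerSeries.isUnit_iff_constantCoeff] at hD ⊢
  rwa [h.det_eq, PowerSeries.constantCoeff_expand] at hD

theorem IsTwist.inv (h : IsTwist p f b D B) (hD : IsUnit D.det) : IsTwist p f b D⁻¹ B⁻¹ := by
  have hB := h.isUnit_det hD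
  unfold IsTwist at *
  have h1 : diagX T b * B.map (PowerSeries.expand (R := T) (ee p f) (ee_ne_zero p f)).toRingHom *
      B⁻¹.map (PowerSeries.expand (R := T) (ee p f) (ee_ne_zero p f)).toRingHom = diagX T b := by
    rw [mul_assoc, ← Matrix.map_mul, Matrix.mul_nonsing_inv B hB,
      Matrix.map_one _ (map_zero _) (map_one _), mul_one]
  conv_lhs => rw [← h1, ← h]
  rw [← mul_assoc, ← mul_assoc, Matrix.nonsing_inv_mul D hD, one_mul]

theorem scalar_eq_smul_one (F : T) : Matrix.scalar (Fin 3) F = F • 1 :=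
  (Matrix.smul_one_eq_diagonal F).symm

theorem isTwist_scalar (F : T⟦X⟧) : IsTwist p f b
    (Matrix.scalar (Fin 3) (PowerSeries.expand (ee p f) (ee_ne_zero p f) F))
    (Matrix.scalar (Fin 3) F) := by
  have h := (isTwist_one (p := p) (f := f) (b := b) (T := T)).smul F
  rwa [← scalar_eq_smul_one, ← scalar_eq_smul_one] at h

/-- The operator `-u d/du` on matrices. -/
def eulerNeg (D : Matrix (Fin 3) (Fin 3) T⟦X⟧) : Matrix (Fin 3) (Fin 3) T⟦X⟧ :=
  D.map fun F => -(PowerSeries.X * PowerSeries.derivative T F)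

/-- The operator multiplies the coefficient of `u^m` by `-m`, so it creates no new exponents. -/
theorem HasTwistedSupport.eulerNeg (h : HasTwistedSupport p f b D) :
    HasTwistedSupport p f b (eulerNeg D) := by
  intro k l m hm
  apply h k l m
  intro h0
  apply hm
  change PowerSeries.coeff m (-(PowerSeries.X * PowerSeries.derivative T (D k l))) = 0
  cases m with
  | zero => simp
  | succ m =>
    rw [map_neg, PowerSeries.coeff_succ_X_mul, PowerSeries.coeff_derivative, h0, zero_mul, neg_zero]

theorem eulerNeg_map {T' : Type*} [CommRing T'] (g : T →+* T') :
    (eulerNeg D).map (PowerSeries.map g) = KisinMonodromy.eulerNeg (D.map (PowerSeries.map g)) := by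
  refine Matrix.ext fun k l => ?_
  change PowerSeries.map g (-(PowerSeries.X * PowerSeries.derivative T (D k l))) =
    -(PowerSeries.X * PowerSeries.derivative T' (PowerSeries.map g (D k l)))
  rw [map_neg, map_mul, PowerSeries.map_X]
  congr 2
  ext m
  simp [PowerSeries.coeff_derivative]

theorem Eis_eq_expand : Eis p f T =
    PowerSeries.expand (ee p f) (ee_ne_zero p f) (PowerSeries.X + (p : T⟦X⟧)) := by
  rw [Eis, map_add, PowerSeries.expand_X, map_natCast]

/-- Divisibility of all entries by `u ^ d`. -/
def EntriesDvd (d : ℕ) (D : Matrix (Fin 3) (Fin 3) T⟦X⟧) : Prop :=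
  ∀ k l, PowerSeries.X ^ d ∣ D k l

theorem EntriesDvd.mul_left {d : ℕ} (h : EntriesDvd d D) (B : Matrix (Fin 3) (Fin 3) T⟦X⟧) :
    EntriesDvd d (B * D) := by
  intro k l
  rw [Matrix.mul_apply]
  exact Finset.dvd_sum fun i _ => (h i l).mul_left _

theorem EntriesDvd.mul_right {d : ℕ} (h : EntriesDvd d D) (B : Matrix (Fin 3) (Fin 3) T⟦X⟧) :
    EntriesDvd d (D * B) := by
  intro k l
  rw [Matrix.mul_apply]
  exact Finset.dvd_sum fun i _ => (h k i).mul_right _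

theorem EntriesDvd.smul {d : ℕ} (h : EntriesDvd d D) (F : T⟦X⟧) : EntriesDvd d (F • D) :=
  fun k l => (h k l).mul_left _

theorem EntriesDvd.add {d : ℕ} (h : EntriesDvd d D) (h' : EntriesDvd d B) :
    EntriesDvd d (D + B) := fun k l => dvd_add (h k l) (h' k l)

theorem EntriesDvd.mono {d d' : ℕ} (h : EntriesDvd d D) (hd : d' ≤ d) : EntriesDvd d' D :=
  fun k l => (pow_dvd_pow _ hd).trans (h k l)

theorem eq_zero_of_entriesDvd (h : ∀ d, EntriesDvd d D) : D = 0 := by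
  refine Matrix.ext fun k l => ?_
  ext m
  exact PowerSeries.X_pow_dvd_iff.mp (h (m + 1) k l) m (Nat.lt_succ_self m)

end Inverse

variable {R : Type*} [CommRing R]

theorem isUnit_Eis : IsUnit (Eis p f (Rp p R)) := by
  rw [PowerSeries.isUnit_iff_constantCoeff, Eis, map_add, map_pow, PowerSeries.constantCoeff_X,
    zero_pow (ee_ne_zero p f), zero_add, map_natCast]
  exact isUnit_p

theorem EntriesDvd.frob {d : ℕ} {D : Matrix (Fin 3) (Fin 3) (Rp p R)⟦X⟧} (h : EntriesDvd d D) :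
    EntriesDvd (p * d) (D.map (frobRp p R)) := by
  intro k l
  obtain ⟨F, hF⟩ := h k l
  refine ⟨frobRp p R F, ?_⟩
  rw [Matrix.map_apply, hF, map_mul, map_pow, pow_mul]
  congr 2
  exact PowerSeries.expand_X p (p_ne_zero p)

theorem map_nabla (D : Matrix (Fin 3) (Fin 3) (Rp p R)⟦X⟧) :
    D.map (nabla p f R) = lam p f R • eulerNeg D := by
  refine Matrix.ext fun k l => ?_
  change -(PowerSeries.X * lam p f R * PowerSeries.derivative (Rp p R) (D k l)) =
    lam p f R * -(PowerSeries.X * PowerSeries.derivative (Rp p R) (D k l))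
  ring

variable {C N : ZMod f → Matrix (Fin 3) (Fin 3) (Rp p R)⟦X⟧}

theorem entriesDvd_eulerNeg (D : Matrix (Fin 3) (Fin 3) (Rp p R)⟦X⟧) :
    EntriesDvd 1 (eulerNeg D) := by
  intro k l
  change PowerSeries.X ^ 1 ∣ -(PowerSeries.X * PowerSeries.derivative (Rp p R) (D k l))
  rw [pow_one, dvd_neg]
  exact dvd_mul_right _ _

theorem approx_succ (i : ℕ) (j : ZMod f) : approx p f R C (i + 1) j =
    Eis p f (Rp p R) • (C (j - 1) * (approx p f R C i (j - 1)).map (frobRp p R) * (C (j - 1))⁻¹) -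
      lam p f R • (eulerNeg (C (j - 1)) * (C (j - 1))⁻¹) := by
  rw [approx, map_nabla, smul_mul_assoc]

/-- The inhomogeneous terms cancel in the difference, and `φ` multiplies `u`-adic orders by `p`, so
the iteration is a contraction: `p (i + 1) ≥ i + 2`. -/
theorem entriesDvd_approx_succ_sub (i : ℕ) (j : ZMod f) :
    EntriesDvd (i + 1) (approx p f R C (i + 1) j - approx p f R C i j) := by
  have hp1 := hp.out.two_le
  induction i generalizing j with
  | zero =>
    have h1 : approx p f R C (0 + 1) j - approx p f R C 0 j =
        (-lam p f R) • (eulerNeg (C (j - 1)) * (C (j - 1))⁻¹) := by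
      have h0 : ∀ j, approx p f R C 0 j = 0 := fun j => rfl
      rw [approx_succ, h0, h0, Matrix.map_zero _ (map_zero _), mul_zero, zero_mul, smul_zero,
        zero_sub, sub_zero, neg_smul]
    rw [h1, zero_add]
    exact ((entriesDvd_eulerNeg _).mul_right _).smul _
  | succ i ih =>
    have h1 : approx p f R C (i + 1 + 1) j - approx p f R C (i + 1) j = Eis p f (Rp p R) •
        (C (j - 1) * (approx p f R C (i + 1) (j - 1) - approx p f R C i (j - 1)).map (frobRp p R) *
          (C (j - 1))⁻¹) := by
      rw [approx_succ (i + 1), Matrix.map_sub _ (map_sub _), mul_sub, sub_mul, smul_sub]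
      rw [approx_succ i j, sub_sub_sub_cancel_right]
    rw [h1]
    exact ((((ih (j - 1)).frob.mono (by nlinarith)).mul_left _).mul_right _).smul _

theorem coeff_approx_of_le {m i : ℕ} (h : m ≤ i) (j : ZMod f) (k l : Fin 3) :
    PowerSeries.coeff m (approx p f R C i j k l) =
      PowerSeries.coeff m (approx p f R C m j k l) := by
  induction i, h using Nat.le_induction with
  | base => rfl
  | succ i hi ih =>
    rw [← ih, ← sub_eq_zero, ← map_sub]
    exact PowerSeries.X_pow_dvd_iff.mp (entriesDvd_approx_succ_sub (C := C) i j k l) m (by omega)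

theorem existsUnique_isMonodromyMatrix : ∃! N, IsMonodromyMatrix p f R C N := by
  refine ⟨fun j => Matrix.of fun k l => PowerSeries.mk fun m =>
    PowerSeries.coeff m (approx p f R C m j k l), fun j k l m => ?_, fun N hN => ?_⟩
  · filter_upwards [eventually_ge_atTop m] with i hi
    rw [Matrix.of_apply, PowerSeries.coeff_mk, coeff_approx_of_le hi]
  · funext j
    refine Matrix.ext fun k l => ?_
    ext m
    obtain ⟨i, hi, hi'⟩ := ((hN j k l m).and (eventually_ge_atTop m)).exists
    rw [← hi, Matrix.of_apply, PowerSeries.coeff_mk, coeff_approx_of_le hi']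

/-! ### Properties of the limit `N_∞`. -/

namespace IsMonodromyMatrix

variable (hN : IsMonodromyMatrix p f R C N)

include hN

theorem coeff_eq (j : ZMod f) (k l : Fin 3) {i m : ℕ} (h : m ≤ i) :
    PowerSeries.coeff m (N j k l) = PowerSeries.coeff m (approx p f R C i j k l) := by
  obtain ⟨i', hi, hi'⟩ := ((hN j k l m).and (eventually_ge_atTop m)).exists
  rw [← hi, coeff_approx_of_le hi', coeff_approx_of_le h]

theorem entriesDvd_sub (i : ℕ) (j : ZMod f) : EntriesDvd i (N j - approx p f R C i j) := by
  intro k l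
  rw [PowerSeries.X_pow_dvd_iff]
  intro m hm
  rw [Matrix.sub_apply, map_sub, hN.coeff_eq j k l hm.le, sub_self]

/-- Passage to the limit in the recursion: the two sides agree modulo every power of `u`. -/
theorem fixed (j : ZMod f) : N j = Eis p f (Rp p R) •
    (C (j - 1) * (N (j - 1)).map (frobRp p R) * (C (j - 1))⁻¹) -
      lam p f R • (eulerNeg (C (j - 1)) * (C (j - 1))⁻¹) := by
  have hp1 := hp.out.two_le
  rw [← sub_eq_zero]
  apply eq_zero_of_entriesDvd
  intro d
  have h1 := (hN.entriesDvd_sub (d + 1) j).mono (show d ≤ d + 1 by omega)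
  have h2 := (((((hN.entriesDvd_sub d (j - 1)).frob.mono (show d ≤ p * d by nlinarith)).mul_left
    (C (j - 1))).mul_right (C (j - 1))⁻¹).smul (-Eis p f (Rp p R)))
  have h3 := h1.add h2
  convert h3 using 1
  rw [approx_succ, Matrix.map_sub _ (map_sub _), mul_sub, sub_mul, neg_smul, smul_sub]
  abel

theorem constantCoeff_eq_zero (j : ZMod f) (k l : Fin 3) :
    PowerSeries.constantCoeff (N j k l) = 0 := by
  have h := hN.coeff_eq j k l (le_refl 0)
  rw [PowerSeries.coeff_zero_eq_constantCoeff_apply] at h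
  rw [h]
  simp [approx]

theorem satisfiesCommutation (hC : ∀ j, IsUnit (C j).det) : SatisfiesCommutation p f R C N := by
  refine ⟨fun j => ?_, fun j k l => hN.constantCoeff_eq_zero j k l⟩
  conv_lhs => rw [hN.fixed j]
  rw [sub_mul, smul_mul_assoc, smul_mul_assoc, mul_assoc _ (C (j - 1))⁻¹, mul_assoc _ (C (j - 1))⁻¹,
    Matrix.nonsing_inv_mul _ (hC _), mul_one, mul_one, map_nabla, sub_add_cancel]

/-- The equation satisfied by `λ N`, without denominators. -/
theorem lam_smul_eq (hC : ∀ j, IsUnit (C j).det) {j : ZMod f}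
    {D : Matrix (Fin 3) (Fin 3) (Rp p R)⟦X⟧}
    (hD : C (j - 1) * D = Matrix.scalar (Fin 3) (Eis p f (Rp p R) ^ 2)) :
    (p : (Rp p R)⟦X⟧) ^ 2 • (lam p f R • N j) =
      (p : (Rp p R)⟦X⟧) • (C (j - 1) * (lam p f R • N (j - 1)).map (frobRp p R) * D) -
        (frobRp p R (lam p f R)) ^ 2 • (eulerNeg (C (j - 1)) * D) := by
  have hD' : D = Eis p f (Rp p R) ^ 2 • (C (j - 1))⁻¹ := by
    rw [← one_mul D, ← Matrix.nonsing_inv_mul _ (hC (j - 1)), mul_assoc, hD,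
      scalar_eq_smul_one, mul_smul_comm, mul_one]
  have hfrob : (lam p f R • N (j - 1)).map (frobRp p R) =
      frobRp p R (lam p f R) • (N (j - 1)).map (frobRp p R) := by
    refine Matrix.ext fun k l => ?_
    exact map_mul (frobRp p R) _ _
  have hlam := p_mul_lam (p := p) (f := f) (R := R)
  rw [hfrob, hD']
  conv_lhs => rw [hN.fixed j]
  simp only [smul_sub, smul_smul, mul_smul_comm, smul_mul_assoc]
  congr 2
  -- The equation `p λ = E φ(λ)` enters once in the Frobenius term and squared in the derivative
  -- term; this produces the factor `E²` that `D` absorbs.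
  · linear_combination (p : (Rp p R)⟦X⟧) * Eis p f (Rp p R) * hlam
  · linear_combination ((p : (Rp p R)⟦X⟧) * lam p f R +
      Eis p f (Rp p R) * frobRp p R (lam p f R)) * hlam

/-- Each approximation is a twist because the recursion uses only operations preserving twists. The
limit inherits the support condition, its coefficient of `u^m` being that of the `m`-th
approximation. -/
theorem exists_isTwist (hC : ∀ j, IsUnit (C j).det) {b : ZMod f → Fin 3 → ℕ} {α : ZMod f → Fin 3 → ℕ}
    {A : ZMod f → Matrix (Fin 3) (Fin 3) (Rp p R)⟦X⟧}
    (hA : ∀ j, IsTwist p f (b (j + 1)) (C j) (A j))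
    (hb : ∀ j k, p * b j k = b (j + 1) k + ee p f * α (j + 1) k) (hα : ∀ j k, α j k ≤ p - 1)
    (hlt : ∀ j k l, α (j + 1) k < α (j + 1) l → b j k < b j l) (j : ZMod f) :
    ∃ G, IsTwist p f (b j) (N j) G := by
  have happrox : ∀ i j, ∃ G, IsTwist p f (b j) (approx p f R C i j) G := by
    intro i
    induction i with
    | zero => exact fun j => ⟨0, isTwist_zero⟩
    | succ i ih =>
      intro j
      obtain ⟨j, rfl⟩ : ∃ j', j = j' + 1 := ⟨j - 1, by ring⟩
      rw [approx_succ, add_sub_cancel_right]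
      obtain ⟨G, hG⟩ := ih j
      obtain ⟨Y, hY, -⟩ := hG.frob (hb j) (hα _) (hlt j)
      obtain ⟨Z, hZ⟩ := (hA j).hasTwistedSupport.eulerNeg.exists_isTwist
      rw [lam_eq_expand, Eis_eq_expand]
      exact ⟨_, ((((hA j).mul hY).mul ((hA j).inv (hC j))).smul _).sub
        ((hZ.mul ((hA j).inv (hC j))).smul _)⟩
  apply HasTwistedSupport.exists_isTwist
  intro k l m hm
  rw [hN.coeff_eq j k l le_rfl] at hm
  obtain ⟨G, hG⟩ := happrox m j
  exact hG.hasTwistedSupport k l m hm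

end IsMonodromyMatrix

end Monodromy

/-! ### Integrality estimates -/

section Estimates

variable {p : ℕ} {R : Type*} [CommRing R]

/-- The first coefficients of `p ^ K F` are integral. -/
def IntegralUpTo (K m : ℕ) (F : (Rp p R)⟦X⟧) : Prop :=
  ∀ i ≤ m, (p : Rp p R) ^ K * PowerSeries.coeff i F ∈ lattice p R 0

theorem pow_mul_mem_of_le {K K' : ℕ} {x : Rp p R} (h : (p : Rp p R) ^ K * x ∈ lattice p R 0)
    (hK : K ≤ K') : (p : Rp p R) ^ K' * x ∈ lattice p R (K' - K) := by
  have h1 : K' = (K' - K) + K := by omega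
  have h2 := mul_mem_lattice (pow_mem_lattice (p := p) (R := R) (K' - K)) h
  rwa [← mul_assoc, ← pow_add, ← h1, add_zero] at h2

theorem IntegralUpTo.mul {K K' m : ℕ} {F F' : (Rp p R)⟦X⟧} (h : IntegralUpTo K m F)
    (h' : IntegralUpTo K' m F') : IntegralUpTo (K + K') m (F * F') := by
  intro i hi
  rw [PowerSeries.coeff_mul, Finset.mul_sum]
  refine sum_mem fun ij hij => ?_
  rw [Finset.HasAntidiagonal.mem_antidiagonal] at hij
  have h1 := mul_mem_lattice (h ij.1 (by omega)) (h' ij.2 (by omega))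
  rw [add_zero] at h1
  convert h1 using 1
  ring

theorem integralUpTo_toRp (m : ℕ) (F : R⟦X⟧) : IntegralUpTo 0 m (toRp p R F) := by
  intro i _
  rw [pow_zero, one_mul, toRp, PowerSeries.coeff_map]
  exact algebraMap_mem_lattice _

theorem integralUpTo_sum {ι : Type*} {K m : ℕ} (s : Finset ι) {F : ι → (Rp p R)⟦X⟧}
    (h : ∀ i ∈ s, IntegralUpTo K m (F i)) : IntegralUpTo K m (∑ i ∈ s, F i) := by
  intro i hi
  rw [map_sum, Finset.mul_sum]
  exact sum_mem fun x hx => h x hx i hi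

theorem integralUpTo_mul_mul {K m : ℕ} (A B : Matrix (Fin 3) (Fin 3) R⟦X⟧)
    {Y : Matrix (Fin 3) (Fin 3) (Rp p R)⟦X⟧} (h : ∀ k l, IntegralUpTo K m (Y k l)) (k l : Fin 3) :
    IntegralUpTo K m ((A.map (toRp p R) * Y * B.map (toRp p R)) k l) := by
  rw [Matrix.mul_apply]
  refine integralUpTo_sum _ fun i _ => ?_
  refine IntegralUpTo.mul (K' := 0) ?_ (integralUpTo_toRp m _)
  rw [Matrix.mul_apply]
  refine integralUpTo_sum _ fun i' _ => ?_
  have h1 := (integralUpTo_toRp (p := p) m (A k i')).mul (h i' i)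
  rwa [zero_add] at h1

theorem coeff_entry_eq {G Y V : Matrix (Fin 3) (Fin 3) (Rp p R)⟦X⟧} {F : (Rp p R)⟦X⟧}
    (h : (p : (Rp p R)⟦X⟧) ^ 2 • G = (p : (Rp p R)⟦X⟧) • Y - F • V) (k l : Fin 3) (m K : ℕ) :
    (p : Rp p R) ^ (K + 2) * PowerSeries.coeff m (G k l) =
      (p : Rp p R) ^ (K + 1) * PowerSeries.coeff m (Y k l) -
        (p : Rp p R) ^ K * PowerSeries.coeff m (F * V k l) := by
  have h1 := congrArg (PowerSeries.coeff m) (congrFun (congrFun h k) l)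
  rw [Matrix.sub_apply, Matrix.smul_apply, Matrix.smul_apply, Matrix.smul_apply, smul_eq_mul,
    smul_eq_mul, smul_eq_mul, ← map_natCast (PowerSeries.C (R := Rp p R)), ← map_pow, map_sub,
    PowerSeries.coeff_C_mul, PowerSeries.coeff_C_mul] at h1
  rw [pow_add, pow_succ]
  linear_combination (p : Rp p R) ^ K * h1

variable [hp : Fact p.Prime] {f : ℕ} [NeZero f]

/-- The denominators of `λ N` grow at most logarithmically. -/
theorem pow_digitCount_mul_coeff_mem {X : ZMod f → Matrix (Fin 3) (Fin 3) (Rp p R)⟦X⟧}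
    {C D V : ZMod f → Matrix (Fin 3) (Fin 3) R⟦X⟧}
    (heq : ∀ j, (p : (Rp p R)⟦X⟧) ^ 2 • X j = (p : (Rp p R)⟦X⟧) •
      ((C j).map (toRp p R) * (X (j - 1)).map (frobRp p R) * (D j).map (toRp p R)) -
        (frobRp p R (lam p f R)) ^ 2 • (V j).map (toRp p R))
    (h0 : ∀ j k l, PowerSeries.coeff 0 (X j k l) = 0) (m : ℕ) (j : ZMod f) (k l : Fin 3) :
    (p : Rp p R) ^ (2 * digitCount p m + 2) * PowerSeries.coeff m (X j k l) ∈ lattice p R 0 := by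
  have hp1 := hp.out.two_le
  induction m using Nat.strong_induction_on generalizing j k l with
  | _ m ih =>
    rw [coeff_entry_eq (heq j)]
    refine sub_mem ?_ ?_
    -- At index `i = p r`, `r > 0`, the induction hypothesis for `r` needs exponent `2 digitCount r
    -- + 2 = 2 digitCount i`, within the available `2 digitCount m + 1`. For `r = 0` the coefficient
    -- vanishes.
    · refine integralUpTo_mul_mul (m := m) _ _ (fun k l i hi => ?_) k l m le_rfl
      rw [Matrix.map_apply, coeff_frobRp]
      split_ifs with hd
      · obtain ⟨r, rfl⟩ := hd
        rw [Nat.mul_div_cancel_left r hp.out.pos]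
        rcases Nat.eq_zero_or_pos r with rfl | hr
        · rw [h0, mul_zero]
          exact zero_mem _
        · have h1 := digitCount_mul (p := p) hr
          have h2 := digitCount_mono (p := p) hi
          refine lattice_anti (Nat.zero_le _)
            (pow_mul_mem_of_le (ih r (by nlinarith) (j - 1) k l) (by omega))
      · rw [mul_zero]
        exact zero_mem _
    · have hfl : IntegralUpTo (digitCount p m) m (frobRp p R (lam p f R)) := by
        intro i hi
        rw [coeff_frobRp]
        split_ifs
        · exact lattice_anti (Nat.zero_le _) (pow_mul_mem_of_le
            (pow_digitCount_mul_coeff_lam_mem (i / p))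
            (digitCount_mono ((Nat.div_le_self _ _).trans hi)))
        · rw [mul_zero]
          exact zero_mem _
      have h1 := (hfl.mul hfl).mul (integralUpTo_toRp (p := p) m (V j k l))
      rw [add_zero, ← two_mul, ← pow_two] at h1
      exact h1 m le_rfl

theorem exists_linear_le_two_pow (a b : ℕ) : ∃ D, ∀ d ≥ D, a * d + b ≤ 2 ^ (d - 1) := by
  refine ⟨2 * (2 * a + b) + 1, fun d hd => ?_⟩
  -- The second bound carries the induction: raising `d` by 1 adds `a` on the left and `2^{d-1}` on
  -- the right.
  have hstep : a * d + b ≤ 2 ^ (d - 1) ∧ a ≤ 2 ^ (d - 1) := by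
    induction d, hd using Nat.le_induction with
    | base =>
      rw [Nat.add_sub_cancel, two_mul, pow_add]
      have h1 : 2 * a + b + 1 ≤ 2 ^ (2 * a + b) := Nat.lt_two_pow_self
      have h2 := Nat.mul_le_mul h1 h1
      constructor <;> nlinarith
    | succ d hd ih =>
      obtain ⟨ih1, ih2⟩ := ih
      obtain ⟨d, rfl⟩ : ∃ d', d = d' + 1 := ⟨d - 1, by omega⟩
      rw [Nat.add_sub_cancel] at *
      rw [pow_succ]
      constructor <;> nlinarith
  exact hstep.1

/-- A number with `d` digits is at least `p^{d-1}`, which beats any linear function of `d`; for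
small `d`, `m` itself is large. -/
theorem eventually_linear_digitCount_le (a b : ℕ) : ∀ᶠ m in atTop, a * digitCount p m + b ≤ m := by
  have hp1 := hp.out.two_le
  obtain ⟨D, hD⟩ := exists_linear_le_two_pow a b
  filter_upwards [eventually_ge_atTop (a * D + b + 1)] with m hm
  rcases Nat.lt_or_ge (digitCount p m) D with h | h
  · have := Nat.mul_le_mul_left a h.le
    omega
  · refine (hD _ h).trans ?_
    have h1 := digitCount_pos (p := p) (show 0 < m by omega)
    have h2 : p ^ digitCount p m ≤ p * m :=
      Nat.pow_log_le_self p (Nat.mul_ne_zero hp.out.ne_zero (by omega))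
    have h3 : digitCount p m = (digitCount p m - 1) + 1 := by omega
    rw [h3, pow_succ'] at h2
    exact (Nat.pow_le_pow_left hp1 _).trans (Nat.le_of_mul_le_mul_left h2 hp.out.pos)

/-- The `k`-th power of a coefficient has a denominator whose exponent is still logarithmic in `m`,
so `p^m` wins. -/
theorem isRigid_of_bound {F : (Rp p R)⟦X⟧} (a b : ℕ)
    (h : ∀ m, (p : Rp p R) ^ (a * digitCount p m + b) * PowerSeries.coeff m F ∈ lattice p R 0) :
    IsRigid p R F := by
  intro k _ c
  filter_upwards [eventually_linear_digitCount_le (p := p) (k * a) (k * b + c)] with m hm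
  have h1 : ∀ k, (p : Rp p R) ^ (k * (a * digitCount p m + b)) * PowerSeries.coeff m F ^ k ∈
      lattice p R 0 := by
    intro k
    induction k with
    | zero => simpa using algebraMap_mem_lattice (p := p) (1 : R)
    | succ k ih =>
      have h2 := mul_mem_lattice ih (h m)
      rw [add_zero] at h2
      convert h2 using 1
      ring
  have h2 : k * (a * digitCount p m + b) = k * a * digitCount p m + k * b := by ring
  exact lattice_anti (by omega) (pow_mul_mem_of_le (h1 k) (show _ ≤ m by omega))

/-- With `v = u ^ e`, the `t`-th coefficient of `λ N` has denominator at most `p ^ (t + 2)`. -/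
theorem pow_add_two_mul_coeff_mem {G Y : ZMod f → Matrix (Fin 3) (Fin 3) (Rp p R)⟦X⟧}
    {A B V : ZMod f → Matrix (Fin 3) (Fin 3) R⟦X⟧}
    (heq : ∀ j, (p : (Rp p R)⟦X⟧) ^ 2 • G j = (p : (Rp p R)⟦X⟧) •
      ((A j).map (toRp p R) * Y j * (B j).map (toRp p R)) -
        (frobRp p R (lamV p R)) ^ 2 • (V j).map (toRp p R))
    (hY : ∀ j k l t, PowerSeries.coeff t (Y j k l) = 0 ∨ ∃ r, r + 1 ≤ t ∧
      PowerSeries.coeff t (Y j k l) = PowerSeries.coeff r (G (j - 1) k l))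
    (t : ℕ) (j : ZMod f) (k l : Fin 3) :
    (p : Rp p R) ^ (t + 2) * PowerSeries.coeff t (G j k l) ∈ lattice p R 0 := by
  induction t using Nat.strong_induction_on generalizing j k l with
  | _ t ih =>
    rw [coeff_entry_eq (heq j)]
    refine sub_mem ?_ ?_
    -- A coefficient of `Y` at `i ≤ t` comes from `G` at some `r < i`, with denominator at most
    -- `p^{r+2}`, and `r + 2 ≤ t + 1`. The other term involves `φ(λ)²`, which costs at most `p^t`.
    · refine integralUpTo_mul_mul (m := t) _ _ (fun k l i hi => ?_) k l t le_rfl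
      rcases hY j k l i with h | ⟨r, hr, h⟩
      · rw [h, mul_zero]
        exact zero_mem _
      · rw [h]
        exact lattice_anti (Nat.zero_le _)
          (pow_mul_mem_of_le (ih r (by omega) (j - 1) k l) (by omega))
    · have hmu : ∀ s, (p : Rp p R) ^ s * PowerSeries.coeff s (frobRp p R (lamV p R)) ∈
          lattice p R 0 := fun s => lattice_anti (Nat.zero_le _) (pow_mul_coeff_frobRp_lamV_mem s)
      have hmul : ∀ F F' : (Rp p R)⟦X⟧,
          (∀ s, (p : Rp p R) ^ s * PowerSeries.coeff s F ∈ lattice p R 0) →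
          (∀ s, (p : Rp p R) ^ s * PowerSeries.coeff s F' ∈ lattice p R 0) →
          ∀ s, (p : Rp p R) ^ s * PowerSeries.coeff s (F * F') ∈ lattice p R 0 := by
        intro F F' h h' s
        rw [PowerSeries.coeff_mul, Finset.mul_sum]
        refine sum_mem fun ij hij => ?_
        rw [Finset.HasAntidiagonal.mem_antidiagonal] at hij
        have h1 := mul_mem_lattice (h ij.1) (h' ij.2)
        rw [add_zero] at h1
        convert h1 using 1
        rw [← hij, pow_add]
        ring
      rw [pow_two]
      refine hmul _ _ (hmul _ _ hmu hmu) (fun s => ?_) t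
      exact lattice_anti (Nat.zero_le _)
        (pow_mul_mem_of_le (integralUpTo_toRp (p := p) s (V j k l) s le_rfl) (Nat.zero_le s))

/-- The vanishing of the first coefficients of `φ(λ N)` forced by genericity. -/
theorem coeff_frob_twist {n : ℕ} (hn : 1 ≤ n) {α : Fin 3 → ℕ}
    (hgen : ∀ k l, k ≠ l → α k + n ≤ α l ∨ α l + n ≤ α k)
    (hgen' : ∀ k l, k ≠ l → α k + n + 1 ≤ α l + p) {G Y : Matrix (Fin 3) (Fin 3) (Rp p R)⟦X⟧}
    (hY : ∀ k l, PowerSeries.X ^ α l * Y k l = PowerSeries.X ^ α k * frobRp p R (G k l))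
    (hdiag : ∀ k, PowerSeries.coeff 0 (G k k) = 0)
    (hlt : ∀ k l, α k < α l → PowerSeries.coeff 0 (G k l) = 0) (k l : Fin 3) (t : ℕ) :
    PowerSeries.coeff t (Y k l) = 0 ∨ ∃ r, r + n ≤ t ∧ r ≤ t / p + 1 ∧
      PowerSeries.coeff t (Y k l) = PowerSeries.coeff r (G k l) := by
  have hp1 := hp.out.two_le
  rcases coeff_of_X_pow_mul_eq (hY k l) t with h | ⟨r, hr, h⟩
  · exact Or.inl h
  by_cases h0 : PowerSeries.coeff r (G k l) = 0
  · exact Or.inl (h.trans h0)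
  -- A gap between two digits is at least `n` and at most `p - 1 - n`.
  have h2n : 2 * n + 1 ≤ p := by
    have h3 := hgen 0 1 (by decide)
    have h4 := hgen' 0 1 (by decide)
    have h5 := hgen' 1 0 (by decide)
    omega
  right
  refine ⟨r, ?_, ?_, h⟩
  -- For `r = 0` only entries with `α_k > α_l` survive, and `t = α_k - α_l ≥ n`. For `r = q + 1` off
  -- the diagonal, `t ≥ p (q + 1) - (p - 1 - n) = p q + n + 1`; on the diagonal `2 n + 1 ≤ p`
  -- suffices.
  · rcases Nat.eq_zero_or_pos r with rfl | hr0
    · rcases eq_or_ne k l with rfl | hkl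
      · exact absurd (hdiag k) h0
      · have h3 : ¬ α k < α l := fun h4 => h0 (hlt k l h4)
        rcases hgen k l hkl with h4 | h4 <;> omega
    · obtain ⟨q, rfl⟩ : ∃ q, r = q + 1 := ⟨r - 1, by omega⟩
      have h3 : 2 * q ≤ p * q := Nat.mul_le_mul_right q hp1
      rw [mul_add, mul_one] at hr
      rcases eq_or_ne k l with rfl | hkl
      · omega
      · have h4 := hgen' k l hkl
        have h5 := hgen' l k hkl.symm
        omega
  -- The bound `r ≤ t / p + 1` is what makes `Y` converge at `v = -p`: the denominators grow much
  -- more slowly than `p^t`.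
  · rcases Nat.eq_zero_or_pos r with rfl | hr0
    · exact Nat.zero_le _
    · obtain ⟨q, rfl⟩ : ∃ q, r = q + 1 := ⟨r - 1, by omega⟩
      rw [mul_add, mul_one] at hr
      have h3 : q ≤ t / p := by
        rw [Nat.le_div_iff_mul_le hp.out.pos, mul_comm]
        rcases eq_or_ne k l with rfl | hkl
        · omega
        · have h5 := hgen' l k hkl.symm
          omega
      omega

end Estimates

/-! ### The value of `λ N` at `v = -p` -/

section Values

variable {p f : ℕ} [hp : Fact p.Prime] [NeZero f] {R : Type*} [CommRing R]

theorem toRp_injective (hinj : Function.Injective (algebraMap R (Rp p R))) :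
    Function.Injective (toRp p R) := by
  intro F G h
  ext m
  have h1 := congrArg (PowerSeries.coeff m) h
  rw [toRp, PowerSeries.coeff_map, PowerSeries.coeff_map] at h1
  exact hinj h1

theorem map_toRp_injective (hinj : Function.Injective (algebraMap R (Rp p R)))
    {D D' : Matrix (Fin 3) (Fin 3) R⟦X⟧} (h : D.map (toRp p R) = D'.map (toRp p R)) : D = D' :=
  Matrix.map_injective (toRp_injective hinj) h

theorem toRp_Eis : toRp p R (Eis p f R) = Eis p f (Rp p R) := by
  rw [Eis, Eis, map_add, map_pow, map_natCast, toRp, PowerSeries.map_X]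

theorem scalar_map_toRp (F : R⟦X⟧) :
    (Matrix.scalar (Fin 3) F).map (toRp p R) = Matrix.scalar (Fin 3) (toRp p R F) :=
  Matrix.diagonal_map (map_zero _)

theorem isUnit_det_of_mul_eq {C D : Matrix (Fin 3) (Fin 3) R⟦X⟧}
    (h : C * D = Matrix.scalar (Fin 3) (Eis p f R ^ 2)) : IsUnit (C.map (toRp p R)).det := by
  have h1 := congrArg (fun D => Matrix.det (D.map (toRp p R))) h
  simp only [Matrix.map_mul, Matrix.det_mul] at h1
  rw [scalar_map_toRp, map_pow, toRp_Eis, scalar_eq_smul_one, Matrix.det_smul, Matrix.det_one,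
    mul_one] at h1
  exact isUnit_of_mul_isUnit_left (h1 ▸ (isUnit_Eis.pow 2).pow _)

/-- Over `R[1/p]⟦u⟧` the matrix `C` is invertible, so `D` is `E² C⁻¹` and commutes with it;
injectivity of `R → R[1/p]` brings this back to `R`. -/
theorem mul_eq_scalar_comm (hinj : Function.Injective (algebraMap R (Rp p R)))
    {C D : Matrix (Fin 3) (Fin 3) R⟦X⟧}
    (h : C * D = Matrix.scalar (Fin 3) (Eis p f R ^ 2)) :
    D * C = Matrix.scalar (Fin 3) (Eis p f R ^ 2) := by
  have hC := isUnit_det_of_mul_eq h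
  apply map_toRp_injective hinj
  have h1 := congrArg (fun D => D.map (toRp p R)) h
  simp only [Matrix.map_mul] at h1 ⊢
  rw [scalar_map_toRp, scalar_eq_smul_one] at h1 ⊢
  have h2 : D.map (toRp p R) = toRp p R (Eis p f R ^ 2) • (C.map (toRp p R))⁻¹ := by
    rw [← one_mul (D.map (toRp p R)), ← Matrix.nonsing_inv_mul _ hC, mul_assoc, h1, mul_smul_comm,
      mul_one]
  rw [h2, smul_mul_assoc, Matrix.nonsing_inv_mul _ hC]

/-- The complementary matrix of `A`, which comes from the one of `C`. -/
theorem exists_complement (hinj : Function.Injective (algebraMap R (Rp p R))) {b : Fin 3 → ℕ}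
    {C D A : Matrix (Fin 3) (Fin 3) R⟦X⟧}
    (h : C * D = Matrix.scalar (Fin 3) (Eis p f R ^ 2)) (hA : IsTwist p f b C A) :
    ∃ B, IsTwist p f b D B ∧
      A * B = Matrix.scalar (Fin 3) ((PowerSeries.X + (p : R⟦X⟧)) ^ 2) ∧
      B * A = Matrix.scalar (Fin 3) ((PowerSeries.X + (p : R⟦X⟧)) ^ 2) := by
  have hC := isUnit_det_of_mul_eq h
  have hA' := hA.map (algebraMap R (Rp p R))
  have h1 := congrArg (fun D => D.map (toRp p R)) h
  simp only [Matrix.map_mul] at h1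
  rw [scalar_map_toRp, scalar_eq_smul_one, map_pow, toRp_Eis] at h1
  have h2 : D.map (toRp p R) = Eis p f (Rp p R) ^ 2 • (C.map (toRp p R))⁻¹ := by
    rw [← one_mul (D.map (toRp p R)), ← Matrix.nonsing_inv_mul _ hC, mul_assoc, h1, mul_smul_comm,
      mul_one]
  -- The exponents are read off over `R[1/p]`, where `D = E² C⁻¹` is visibly a twist.
  have h3 : HasTwistedSupport p f b D := by
    intro k l m hm
    have h4 := ((hA'.inv hC).smul ((PowerSeries.X + (p : (Rp p R)⟦X⟧)) ^ 2)).hasTwistedSupport k l m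
    apply h4
    rw [map_pow, ← Eis_eq_expand]
    change PowerSeries.coeff m ((Eis p f (Rp p R) ^ 2 • (C.map (toRp p R))⁻¹) k l) ≠ 0
    rw [← h2, Matrix.map_apply, toRp, PowerSeries.coeff_map]
    intro h5
    exact hm (hinj (h5.trans (map_zero _).symm))
  obtain ⟨B, hB⟩ := h3.exists_isTwist
  have h4 := isTwist_scalar (p := p) (f := f) (b := b) ((PowerSeries.X + (p : R⟦X⟧)) ^ 2)
  rw [map_pow, ← Eis_eq_expand] at h4
  refine ⟨B, hB, ?_, ?_⟩
  · have h5 := hA.mul hB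
    rw [h] at h5
    exact h5.unique h4
  · have h5 := hB.mul hA
    rw [mul_eq_scalar_comm hinj h] at h5
    exact h5.unique h4

/-! ### Rigidity of `λ N` and its value at `v = -p`. -/

section Main

variable {n : ℕ} {b α : ZMod f → Fin 3 → ℕ} {C D : ZMod f → Matrix (Fin 3) (Fin 3) R⟦X⟧}
  {N : ZMod f → Matrix (Fin 3) (Fin 3) (Rp p R)⟦X⟧}

theorem scaled_eq (hCD : ∀ j, C j * D j = Matrix.scalar (Fin 3) (Eis p f R ^ 2))
    (hN : IsMonodromyMatrix p f R (fun j => (C j).map (toRp p R)) N) (j : ZMod f) :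
    (p : (Rp p R)⟦X⟧) ^ 2 • (lam p f R • N j) = (p : (Rp p R)⟦X⟧) •
      ((C (j - 1)).map (toRp p R) * (lam p f R • N (j - 1)).map (frobRp p R) *
        (D (j - 1)).map (toRp p R)) -
        (frobRp p R (lam p f R)) ^ 2 • (eulerNeg (C (j - 1)) * D (j - 1)).map (toRp p R) := by
  rw [Matrix.map_mul]
  have h1 : (eulerNeg (C (j - 1))).map (toRp p R) = eulerNeg ((C (j - 1)).map (toRp p R)) :=
    eulerNeg_map _
  rw [h1]
  refine hN.lam_smul_eq (fun j => isUnit_det_of_mul_eq (hCD j)) ?_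
  have h2 := congrArg (fun D => D.map (toRp p R)) (hCD (j - 1))
  simp only [Matrix.map_mul] at h2
  rw [h2, scalar_map_toRp, map_pow, toRp_Eis]

theorem isRigid_lam_mul (hCD : ∀ j, C j * D j = Matrix.scalar (Fin 3) (Eis p f R ^ 2))
    (hN : IsMonodromyMatrix p f R (fun j => (C j).map (toRp p R)) N) (j : ZMod f) (k l : Fin 3) :
    IsRigid p R (lam p f R * N j k l) := by
  refine isRigid_of_bound 2 2 fun m => ?_
  refine pow_digitCount_mul_coeff_mem (X := fun j => lam p f R • N j) (C := fun j => C (j - 1))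
    (D := fun j => D (j - 1)) (V := fun j => eulerNeg (C (j - 1)) * D (j - 1))
    (scaled_eq hCD hN) (fun j k l => ?_) m j k l
  rw [Matrix.smul_apply, smul_eq_mul, PowerSeries.coeff_zero_eq_constantCoeff_apply, map_mul,
    hN.constantCoeff_eq_zero, mul_zero]

/-- The identity `p² G = p A Y B - φ(λ)² A† B` is evaluated at `v = -p`. The second term gives the
main part, and `Y(-p) ∈ p^{n-2} R` bounds the first. -/
theorem exists_value [IsLocalRing R] [IsAdicComplete (Ideal.span {(p : R)}) R]
    (hpR : (p : R) ∈ IsLocalRing.maximalIdeal R)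
    (hinj : Function.Injective (algebraMap R (Rp p R))) (hn : 2 ≤ n)
    (hb : ∀ j k, p * b j k = b (j + 1) k + ee p f * α (j + 1) k) (hα : ∀ j k, α j k ≤ p - 1)
    (hlt : ∀ j k l, α (j + 1) k < α (j + 1) l → b j k < b j l)
    (hgen : ∀ j k l, k ≠ l → α j k + n ≤ α j l ∨ α j l + n ≤ α j k)
    (hgen' : ∀ j k l, k ≠ l → α j k + n + 1 ≤ α j l + p)
    (hCD : ∀ j, C j * D j = Matrix.scalar (Fin 3) (Eis p f R ^ 2))
    {A : ZMod f → Matrix (Fin 3) (Fin 3) R⟦X⟧} (hA : ∀ j, IsTwist p f (b (j + 1)) (C j) (A j))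
    (hN : IsMonodromyMatrix p f R (fun j => (C j).map (toRp p R)) N) :
    ∃ z : (Rp p R)ˣ, ∀ j : ZMod f, ∃ Adag B : Matrix (Fin 3) (Fin 3) R⟦X⟧,
      ∃ G : Matrix (Fin 3) (Fin 3) (Rp p R)⟦X⟧,
        IsTwist p f (b j) (eulerNeg (C (j - 1))) Adag ∧
        A (j - 1) * B = Matrix.scalar (Fin 3) ((PowerSeries.X + (p : R⟦X⟧)) ^ 2) ∧
        B * A (j - 1) = Matrix.scalar (Fin 3) ((PowerSeries.X + (p : R⟦X⟧)) ^ 2) ∧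
        IsTwist p f (b j) (lam p f R • N j) G ∧
        ∃ A₀ B₀ P₀ : Matrix (Fin 3) (Fin 3) R, ∃ G₀ : Matrix (Fin 3) (Fin 3) (Rp p R),
          MatEvalsTo p R (A (j - 1)) A₀ ∧ MatEvalsTo p R B B₀ ∧
          MatEvalsTo p R (Adag * B) P₀ ∧ MatEvalsTo p R G G₀ ∧
          ∃ Z : Matrix (Fin 3) (Fin 3) R,
            G₀ = (z : Rp p R) •
              (P₀ - (p : R) ^ (n - 1) • (A₀ * Z * B₀)).map (algebraMap R (Rp p R)) := by
  have hp1 := hp.out.two_le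
  have hA1 : ∀ j, IsTwist p f (b j) (C (j - 1)) (A (j - 1)) := by
    intro j
    have h := hA (j - 1)
    rwa [sub_add_cancel] at h
  choose B hB hAB hBA using fun j => exists_complement hinj (hCD (j - 1)) (hA1 j)
  choose Adag hAdag using fun j => (hA1 j).hasTwistedSupport.eulerNeg.exists_isTwist
  choose H hH using fun j => hN.exists_isTwist (fun j => isUnit_det_of_mul_eq (hCD j))
    (fun j => (hA j).map (algebraMap R (Rp p R))) hb hα hlt j
  let G : ZMod f → Matrix (Fin 3) (Fin 3) (Rp p R)⟦X⟧ := fun j => lamV p R • H j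
  have hG : ∀ j, IsTwist p f (b j) (lam p f R • N j) (G j) := by
    intro j
    rw [lam_eq_expand]
    exact (hH j).smul _
  have hY : ∀ j, ∃ Y, IsTwist p f (b j) ((lam p f R • N (j - 1)).map (frobRp p R)) Y ∧
      ∀ k l, PowerSeries.X ^ α j l * Y k l =
        PowerSeries.X ^ α j k * frobRp p R (G (j - 1) k l) := by
    intro j
    have h1 := hb (j - 1)
    have h2 := hlt (j - 1)
    rw [sub_add_cancel] at h1 h2
    exact (hG (j - 1)).frob h1 (hα j) h2
  choose Y hY hYG using hY
  have hcoeff : ∀ j k l t, PowerSeries.coeff t (Y j k l) = 0 ∨ ∃ r, r + n ≤ t ∧ r ≤ t / p + 1 ∧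
      PowerSeries.coeff t (Y j k l) = PowerSeries.coeff r (G (j - 1) k l) := by
    intro j
    refine coeff_frob_twist (by omega) (hgen j) (hgen' j) (hYG j) (fun k => ?_) (fun k l h => ?_)
    · rw [(hG (j - 1)).constantCoeff_diag, Matrix.smul_apply, smul_eq_mul,
        PowerSeries.coeff_zero_eq_constantCoeff_apply, map_mul, hN.constantCoeff_eq_zero, mul_zero]
    · have h2 := hlt (j - 1) k l
      rw [sub_add_cancel] at h2
      exact (hG (j - 1)).constantCoeff_eq_zero (h2 h)
  have heq : ∀ j, (p : (Rp p R)⟦X⟧) ^ 2 • G j = (p : (Rp p R)⟦X⟧) •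
      ((A (j - 1)).map (toRp p R) * Y j * (B j).map (toRp p R)) -
        (frobRp p R (lamV p R)) ^ 2 • (Adag j * B j).map (toRp p R) := by
    intro j
    have h1 := (hG j).smul ((p : (Rp p R)⟦X⟧) ^ 2)
    rw [map_pow, map_natCast, scaled_eq hCD hN j] at h1
    have h2 := (((((hA1 j).map (algebraMap R (Rp p R))).mul (hY j)).mul
      ((hB j).map (algebraMap R (Rp p R)))).smul (p : (Rp p R)⟦X⟧)).sub
      ((((hAdag j).mul (hB j)).map (algebraMap R (Rp p R))).smul ((frobRp p R (lamV p R)) ^ 2))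
    rw [map_pow, map_natCast, ← frobRp_expand, ← lam_eq_expand] at h2
    exact h1.unique h2
  have hint := pow_add_two_mul_coeff_mem (A := fun j => A (j - 1)) heq fun j k l t =>
    (hcoeff j k l t).imp_right fun ⟨r, h1, _, h3⟩ => ⟨r, by omega, h3⟩
  obtain ⟨w, hw⟩ := exists_evalsTo_frobRp_lamV hpR
  -- The scalar is `-w²/p²`, where `w` is the value of `φ(λ)`.
  obtain ⟨z, hz⟩ : IsUnit (-(pInv p R ^ 2 * algebraMap R (Rp p R) w ^ 2)) :=
    (((IsUnit.of_mul_eq_one _ pInv_mul).pow 2).mul ((w.isUnit.map _).pow 2)).neg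
  refine ⟨z, fun j => ⟨Adag j, B j, G j, hAdag j, hAB j, hBA j, hG j, ?_⟩⟩
  obtain ⟨A₀, hA₀⟩ := exists_matEvalsTo (p := p) (A (j - 1))
  obtain ⟨B₀, hB₀⟩ := exists_matEvalsTo (p := p) (B j)
  obtain ⟨P₀, hP₀⟩ := exists_matEvalsTo (p := p) (Adag j * B j)
  have hYval : ∀ k l, ∃ y : R,
      EvalsTo p R (Y j k l) (algebraMap R (Rp p R) ((p : R) ^ (n - 2) * y)) := by
    intro k l
    -- The constant 3 is the 2 of the denominator `p^{r+2}` plus the 1 of `r ≤ t / p + 1`; what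
    -- remains is a decay of `t - t/p ≥ t/2`.
    obtain ⟨x, hx⟩ := exists_evalsTo_of_bound (F := Y j k l) 3 (fun t => by
      rcases hcoeff j k l t with h | ⟨r, h1, h2, h3⟩
      · rw [h, mul_zero]
        exact zero_mem _
      · rw [h3]
        have h4 : t / p ≤ t / 2 := Nat.div_le_div_left hp1 (by omega)
        exact lattice_anti (by omega) (pow_mul_mem_of_le (hint r (j - 1) k l)
          (show r + 2 ≤ 3 + t by omega)))
    -- Every term at `v = -p` is divisible by `p^{t-r-2}`, hence by `p^{n-2}`. One partial sum whose
    -- remainder is also divisible by `p^{n-2}` then decides the value.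
    obtain ⟨m, hm⟩ := (hx (n - 2)).exists
    have h1 : x - _ ∈ lattice p R (n - 2) := hm
    have h2 : ∑ i ∈ Finset.range m, PowerSeries.coeff i (Y j k l) * (-(p : Rp p R)) ^ i ∈
        lattice p R (n - 2) := by
      refine sum_mem fun t _ => ?_
      rw [mul_comm, neg_pow_mul_mem]
      rcases hcoeff j k l t with h | ⟨r, h1, h2, h3⟩
      · rw [h, mul_zero]
        exact zero_mem _
      · rw [h3]
        exact lattice_anti (by omega) (pow_mul_mem_of_le (hint r (j - 1) k l)
          (show r + 2 ≤ t by omega))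
    have h3 := add_mem h1 h2
    rw [sub_add_cancel] at h3
    obtain ⟨y, hy⟩ := h3
    exact ⟨y, by rw [← hy]; exact hx⟩
  choose y hy using hYval
  let y₀ : Matrix (Fin 3) (Fin 3) R := Matrix.of y
  have hY₀ : MatEvalsTo p R (Y j) ((p : Rp p R) ^ (n - 2) • y₀.map (algebraMap R (Rp p R))) := by
    intro k l
    have h1 := hy k l
    rw [map_mul, map_pow, map_natCast] at h1
    exact h1
  have hGform : G j = PowerSeries.C (pInv p R) •
      ((A (j - 1)).map (toRp p R) * Y j * (B j).map (toRp p R)) +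
      (PowerSeries.C (-(pInv p R ^ 2)) * (frobRp p R (lamV p R)) ^ 2) •
        (Adag j * B j).map (toRp p R) := by
    have h1 : PowerSeries.C (pInv p R) * (p : (Rp p R)⟦X⟧) = 1 := by
      rw [← map_natCast (PowerSeries.C (R := Rp p R)), ← map_mul, pInv_mul, map_one]
    have h2 := congrArg (fun D => (PowerSeries.C (pInv p R)) ^ 2 • D) (heq j)
    simp only [smul_sub, smul_smul] at h2
    rw [← mul_pow, h1, one_pow, one_smul, pow_two (PowerSeries.C (pInv p R)), mul_assoc, h1,
      mul_one] at h2
    rw [h2, sub_eq_add_neg, ← neg_smul, map_neg, map_pow]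
    congr 2
    ring
  -- Factoring `-w²/p²` out of `p^{-1} p^{n-2} A₀ y₀ B₀ - p^{-2} w² P₀` leaves `P₀ - p^{n-1} A₀
  -- (w^{-2} y₀) B₀`, whence the choice of `Z`.
  refine ⟨A₀, B₀, P₀, _, hA₀, hB₀, hP₀, hGform ▸ (MatEvalsTo.smul (evalsTo_C _)
    ((hA₀.map.mul hY₀).mul hB₀.map)).add (MatEvalsTo.smul ((evalsTo_C _).mul
      (show EvalsTo p R _ (algebraMap R (Rp p R) w ^ 2) by
        rw [pow_two, pow_two]; exact hw.mul hw)) hP₀.map),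
    ((w⁻¹ : Rˣ) : R) ^ 2 • y₀, ?_⟩
  have hwi : algebraMap R (Rp p R) w * algebraMap R (Rp p R) ((w⁻¹ : Rˣ) : R) = 1 := by
    rw [← map_mul, Units.mul_inv, map_one]
  have hmap : (P₀ - (p : R) ^ (n - 1) • (A₀ * (((w⁻¹ : Rˣ) : R) ^ 2 • y₀) * B₀)).map
      (algebraMap R (Rp p R)) = P₀.map (algebraMap R (Rp p R)) -
        ((p : Rp p R) ^ (n - 1) * algebraMap R (Rp p R) ((w⁻¹ : Rˣ) : R) ^ 2) •
          (A₀.map (algebraMap R (Rp p R)) * y₀.map (algebraMap R (Rp p R)) *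
            B₀.map (algebraMap R (Rp p R))) := by
    have hprod : A₀.map (algebraMap R (Rp p R)) * y₀.map (algebraMap R (Rp p R)) *
        B₀.map (algebraMap R (Rp p R)) = (A₀ * y₀ * B₀).map (algebraMap R (Rp p R)) := by
      rw [Matrix.map_mul, Matrix.map_mul]
    rw [hprod, mul_smul_comm, smul_mul_assoc, smul_smul, Matrix.map_sub _ (map_sub _)]
    congr 1
    refine Matrix.ext fun k l => ?_
    simp [-Matrix.map_mul]
  rw [hmap, smul_sub, smul_smul, mul_smul_comm, smul_mul_assoc, smul_smul, hz, neg_mul,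
    ← neg_mul (pInv p R ^ 2), sub_eq_add_neg, ← neg_smul, add_comm]
  congr 2
  obtain ⟨n, rfl⟩ : ∃ n', n = n' + 2 := ⟨n - 2, by omega⟩
  rw [Nat.add_sub_cancel, show n + 2 - 1 = n + 1 by omega, pow_succ]
  linear_combination (-(pInv p R * (p : Rp p R) ^ n)) * pInv_mul (p := p) (R := R) *
    (algebraMap R (Rp p R) w * algebraMap R (Rp p R) ((w⁻¹ : Rˣ) : R)) ^ 2 -
    pInv p R * (p : Rp p R) ^ n *
      (algebraMap R (Rp p R) w * algebraMap R (Rp p R) ((w⁻¹ : Rˣ) : R) + 1) * hwi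

end Main

end Values

/-! ### The coefficient ring -/

section CoefficientRing

/-- An infinite ring cannot embed in a finite field, so `ℤ_p` has a nonzero kernel `(p^m)` in the
residue field, where `p` is then nilpotent and hence 0. -/
theorem p_mem_maximalIdeal (p : ℕ) [hp : Fact p.Prime] (R : Type*) [CommRing R] [IsLocalRing R]
    [Finite (IsLocalRing.ResidueField R)] [Algebra ℤ_[p] R] :
    (p : R) ∈ IsLocalRing.maximalIdeal R := by
  let g : ℤ_[p] →+* IsLocalRing.ResidueField R := (IsLocalRing.residue R).comp (algebraMap ℤ_[p] R)
  have hker : RingHom.ker g ≠ ⊥ := by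
    intro h
    have hinj : Function.Injective g := (RingHom.injective_iff_ker_eq_bot g).mpr h
    have : Finite ℤ_[p] := Finite.of_injective g hinj
    have h1 := Infinite.of_injective (Nat.cast : ℕ → ℤ_[p]) Nat.cast_injective
    exact not_finite ℤ_[p]
  obtain ⟨m, hm⟩ := PadicInt.ideal_eq_span_pow_p hker
  have h1 : g ((p : ℤ_[p]) ^ m) = 0 := by
    rw [← RingHom.mem_ker, hm]
    exact Ideal.mem_span_singleton_self _
  rw [map_pow, map_natCast] at h1
  rw [← IsLocalRing.residue_eq_zero_iff, map_natCast]
  exact eq_zero_of_pow_eq_zero h1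

/-- Flatness over the domain `O` keeps the nonzero element `p` regular on `R`. -/
theorem algebraMap_Rp_injective (p : ℕ) {O R : Type*} [CommRing O] [IsDomain O] [CommRing R]
    [Algebra O R] [Module.Flat O R] (hO : (p : O) ≠ 0) :
    Function.Injective (algebraMap R (Rp p R)) := by
  have h1 : IsSMulRegular R (p : O) :=
    Module.Flat.isSMulRegular_of_nonZeroDivisors (mem_nonZeroDivisors_of_ne_zero hO)
  apply IsLocalization.injective (M := Submonoid.powers (p : R))
  rw [Submonoid.powers_le, mem_nonZeroDivisors_iff_right]
  intro x hx
  apply h1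
  simp only [smul_zero]
  rw [Algebra.smul_def, map_natCast, mul_comm]
  exact hx

end CoefficientRing

end

end KisinMonodromy

/-! ### Assembly of the theorem. -/

theorem mainTheorem6 {p f n : ℕ} [Fact p.Prime] [NeZero f] (hp : 3 < p)
    {E : Type*} [Field E] [Algebra ℚ_[p] E] [FiniteDimensional ℚ_[p] E]
    [Algebra ℤ_[p] E] [IsScalarTower ℤ_[p] ℚ_[p] E]
    (σ₀ : W p f →+* integralClosure ℤ_[p] E) (π : Unif p f)
    (a : Fin 3 → ZMod f → ℕ) (ha : ∀ k j, a k j ≤ p - 1)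
    (hn : 2 ≤ n) (hgen : IsGeneric p n a)
    (s : ZMod f → Equiv.Perm (Fin 3)) (hs : IsOrientation p a s)
    {R : Type*} [CommRing R] [IsLocalRing R] [IsNoetherianRing R]
    [IsAdicComplete (IsLocalRing.maximalIdeal R) R] [Finite (IsLocalRing.ResidueField R)]
    [Algebra ℤ_[p] R] [Algebra (integralClosure ℤ_[p] E) R]
    [IsScalarTower ℤ_[p] (integralClosure ℤ_[p] E) R] [Module.Flat (integralClosure ℤ_[p] E) R]
    {M : Type*} [AddCommGroup M] [Module (SR p f R) M]
    (𝔐 : KisinModule σ₀ π (tameType σ₀ π a) 2 R M) (β : Eigenbasis 𝔐) :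
    (∃! A, IsIsotypicMatrix β a s A) ∧
    (∀ j, IsUnit (frobMatrixRp β j).det) ∧
    (∃! N, IsMonodromyMatrix p f R (frobMatrixRp β) N) ∧
    ∀ A N, IsIsotypicMatrix β a s A → IsMonodromyMatrix p f R (frobMatrixRp β) N →
      SatisfiesCommutation p f R (frobMatrixRp β) N ∧
      (∀ j k l, IsRigid p R (lam p f R * N j k l)) ∧
      ∃ z : (Rp p R)ˣ, ∀ j : ZMod f,
        ∃ Adag B : Matrix (Fin 3) (Fin 3) R⟦X⟧,
        ∃ G : Matrix (Fin 3) (Fin 3) (Rp p R)⟦X⟧,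
          RemovesDescent p (f := f) (digitSum p a j) (s j)
            ((frobMatrix β (j - 1)).map fun F => -(PowerSeries.X * PowerSeries.derivative R F))
            Adag ∧
          A (j - 1) * B = Matrix.scalar (Fin 3) ((PowerSeries.X + (p : R⟦X⟧)) ^ 2) ∧
          B * A (j - 1) = Matrix.scalar (Fin 3) ((PowerSeries.X + (p : R⟦X⟧)) ^ 2) ∧
          RemovesDescent p (f := f) (digitSum p a j) (s j) (lam p f R • N j) G ∧
          ∃ A₀ B₀ P₀ : Matrix (Fin 3) (Fin 3) R, ∃ G₀ : Matrix (Fin 3) (Fin 3) (Rp p R),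
            MatEvalsTo p R (A (j - 1)) A₀ ∧
            MatEvalsTo p R B B₀ ∧
            MatEvalsTo p R (Adag * B) P₀ ∧
            MatEvalsTo p R G G₀ ∧
            ∃ Merr Z : Matrix (Fin 3) (Fin 3) R,
              G₀ = (z : Rp p R) • (P₀ - (p : R) ^ (n - 1) • Merr).map (algebraMap R (Rp p R)) ∧
              Merr = A₀ * Z * B₀ := by
  have hp1 := hp
  have hpR := p_mem_maximalIdeal p R
  have hO : (p : integralClosure ℤ_[p] E) ≠ 0 := by
    intro h
    have h1 := congrArg (algebraMap (integralClosure ℤ_[p] E) E) h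
    rw [map_natCast, map_zero] at h1
    have : CharZero E := charZero_of_injective_algebraMap (algebraMap ℚ_[p] E).injective
    exact (Fact.out : p.Prime).ne_zero (Nat.cast_eq_zero.mp h1)
  have hinj : Function.Injective (algebraMap R (Rp p R)) := algebraMap_Rp_injective p hO
  have hcomplete : IsAdicComplete (Ideal.span {(p : R)}) R := isAdicComplete_span_singleton hpR
  have hcmp : ∀ j k l, digitSum p a j k < digitSum p a j l + ee p f := by
    intro j k l
    refine digitSum_lt_add (fun j => ?_) j
    rcases eq_or_ne k l with rfl | hkl
    · omega
    · have h1 := (hgen j k l hkl).2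
      rw [abs_le] at h1
      omega
  choose D hD using fun j => exists_mul_eq_Eis_pow β j
  have hC : ∀ j, IsUnit (frobMatrixRp β j).det := fun j => isUnit_det_of_mul_eq (hD j)
  have hsupp := hasTwistedSupport_frobMatrix β hcmp
  refine ⟨?_, hC, existsUnique_isMonodromyMatrix, ?_⟩
  · choose A hA using fun j => (hsupp j).exists_isTwist
    refine ⟨fun j => (A j).submatrix (s (j + 1)) (s (j + 1)), ?_, fun A' hA' => ?_⟩
    · refine (isIsotypicMatrix_iff β hs).mpr fun j => ?_
      rw [removesDescent_iff, Matrix.submatrix_submatrix]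
      simpa using hA j
    · replace hA' := (isIsotypicMatrix_iff β hs).mp hA'
      funext j
      rw [(hA j).unique (removesDescent_iff.mp (hA' j)), Matrix.submatrix_submatrix]
      simp
  · intro A N hA hN
    rw [isIsotypicMatrix_iff β hs] at hA
    refine ⟨hN.satisfiesCommutation hC, isRigid_lam_mul hD hN, ?_⟩
    -- The digit split off from `p 𝐚_k^{(j-1)}` is `a_{k,-j}`, hence the choice of `α`.
    obtain ⟨z, hz⟩ := exists_value (b := digitSum p a) (α := fun j k => a k (-j)) hpR hinj hn
      p_mul_digitSum (fun j k => ha k _) (fun j k l => digitSum_lt_of_lt ha)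
      (fun j k l hkl => by
        have h1 := (hgen (-j) k l hkl).1
        rw [le_abs] at h1
        omega)
      (fun j k l hkl => by
        have h1 := (hgen (-j) k l hkl).2
        rw [abs_le] at h1
        omega)
      hD (fun j => removesDescent_iff.mp (hA j)) hN
    refine ⟨z, fun j => ?_⟩
    obtain ⟨Adag, B, G, h1, h2, h3, h4, A₀, B₀, P₀, G₀, h5, h6, h7, h8, Z, h9⟩ := hz j
    simp only [sub_add_cancel] at h2 h3 h5
    have hscalar : ∀ F : R⟦X⟧, (Matrix.scalar (Fin 3) F).submatrix (s j) (s j) =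
        Matrix.scalar (Fin 3) F := by
      intro F
      refine Matrix.ext fun k l => ?_
      simp [Matrix.diagonal_apply]
    have hA' : ((A (j - 1)).submatrix (s j).symm (s j).symm).submatrix (s j) (s j) =
        A (j - 1) := by
      rw [Matrix.submatrix_submatrix]
      simp
    -- Simultaneous permutation of rows and columns respects products, scalar matrices and
    -- evaluation, so all the data are reindexed by `s_j` at once.
    refine ⟨Adag.submatrix (s j) (s j), B.submatrix (s j) (s j), G.submatrix (s j) (s j),
      ?_, ?_, ?_, ?_, A₀.submatrix (s j) (s j), B₀.submatrix (s j) (s j),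
      P₀.submatrix (s j) (s j), G₀.submatrix (s j) (s j), ?_, fun k l => h6 (s j k) (s j l), ?_,
      fun k l => h8 (s j k) (s j l), _, Z.submatrix (s j) (s j), ?_, rfl⟩
    · rw [removesDescent_iff, Matrix.submatrix_submatrix]
      simpa [eulerNeg] using h1
    · have h := congrArg (fun D => D.submatrix (s j) (s j)) h2
      rwa [hscalar, ← Matrix.submatrix_mul_equiv _ _ _ (s j), hA'] at h
    · have h := congrArg (fun D => D.submatrix (s j) (s j)) h3
      rwa [hscalar, ← Matrix.submatrix_mul_equiv _ _ _ (s j), hA'] at h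
    · rw [removesDescent_iff, Matrix.submatrix_submatrix]
      simpa using h4
    · rw [← hA']
      exact fun k l => h5 (s j k) (s j l)
    · rw [Matrix.submatrix_mul_equiv]
      exact fun k l => h7 (s j k) (s j l)
    · rw [Matrix.submatrix_mul_equiv, Matrix.submatrix_mul_equiv, h9]
      rfl
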